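/- A $k$-uniform hypergraph $H=(V,E)$ consists of a set $V$ of $n$ vertices and a multiset $E$ of edges, each a $k$-element subset of $V$. The problem Exact Cover by $k$-Sets asks, given such an $H$, whether there is a set $S\subseteq E$ of edges with $\bigcup_{s\in S}s=V$ and $s_1\cap s_2=\emptyset$ for all distinct $s_1,s_2\in S$. Theorem. There are constants $c_k$ ($k\ge 2$) with $$c_3=1.496,\quad c_4=1.642,\quad c_5=1.721,\quad c_6=1.771,\quad c_7=1.806,$$ and, for every $k\ge 2$, $$c_k<2\left(8.415\,k^{0.9-k}(k-1)^{0.6}(k-1.5)^{k-1.5}\right)^{-1/k},$$ and there is a Monte Carlo algorithm for Exact Cover by $k$-Sets (on a random access machine with logarithmic cost and fair coin flips, with $k$ as part of the input) such that, on every $k$-uniform hypergraph $H=(V,E)$ with $n$ vertices and $k\ge 2$: (i) if $H$ has no exact cover, the algorithm always answers "No"; if $H$ has an exact cover, it answers "Yes" with probability at least $1-2^{-n}$; (ii) whatever the coin flips are, it runs in time $O^*(c_k^n)$ and polynomial space: for a single polynomial $p$ (the same for all $k$), the time is at most $p(n+k+|E|)\,c_k^n$ and the space at most $p(n+k+|E|)$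 bits. Consequently, for each fixed $k$ there is a polynomial $q$ such that on all inputs without repeated edges the time is at most $q(n)\,c_k^n$ and the space at most $q(n)$ bits. -/

import Mathlib

open MeasureTheory ProbabilityTheory
open scoped ENNReal

namespace XkC

/-! ### The problem -/

/-- A `k`-uniform (multi)hypergraph on the vertex set `Fin n`: a list of edges (repetitions are
allowed), each of which is a vertex set with exactly `k` elements. -/
structure UniformHypergraph (k n : ℕ) where
  edges : List (Finset (Fin n))
  card_eq : ∀ e ∈ edges, e.card = k

/-- The question of Exact Cover by `k`-Sets: is there a set `S` of edges whose union is the whole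
vertex set and whose distinct members are disjoint? -/
def UniformHypergraph.HasExactCover {k n : ℕ} (H : UniformHypergraph k n) : Prop :=
  ∃ S : Finset (Finset (Fin n)),
    (∀ e ∈ S, e ∈ H.edges) ∧ (∀ v : Fin n, ∃ e ∈ S, v ∈ e) ∧
      ∀ e₁ ∈ S, ∀ e₂ ∈ S, e₁ ≠ e₂ → Disjoint e₁ e₂

/-- The input word: `n`, `k`, the number of edges, and then edge by edge the vertices of the edge
in increasing order. -/
def UniformHypergraph.encode {k n : ℕ} (H : UniformHypergraph k n) : List ℕ :=
  n :: k :: H.edges.length ::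
    H.edges.flatMap fun e => (e.sort (· ≤ ·)).map fun v => (v : ℕ)

/-! ### The machine model

A random access machine with logarithmic cost and a fair coin. Its memory consists of arrays of
natural numbers, of which a program names finitely many. Its programs are structured. -/

/-- The binary operations of the machine. Comparisons return `1` for true and `0` for false. -/
inductive BinOp
  | add | sub | mul | div | mod | xor | lt | eq

/-- The value of an operation on natural numbers: `sub` is truncated subtraction, `div` and `mod`
are quotient and remainder, `xor` is the bitwise exclusive or of binary representations. -/
def BinOp.eval : BinOp → ℕ → ℕ → ℕ
  | .add, x, y => x + y
  | .sub, x, y => x - y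
  | .mul, x, y => x * y
  | .div, x, y => x / y
  | .mod, x, y => x % y
  | .xor, x, y => x ^^^ y
  | .lt, x, y => if x < y then 1 else 0
  | .eq, x, y => if x = y then 1 else 0

/-- Expressions: constants, reading cell `i` of the array with name `a`, and operations. -/
inductive Expr
  | const (c : ℕ)
  | get (a : ℕ) (i : Expr)
  | op (f : BinOp) (x y : Expr)

/-- Programs: do nothing, write `e` to cell `i` of array `a`, write a fresh coin flip (`0` or `1`)
to cell `i` of array `a`, composition, branching and looping (a condition holds if it is not `0`).
-/
inductive Prog
  | skip
  | set (a : ℕ) (i e : Expr)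
  | flip (a : ℕ) (i : Expr)
  | seq (p q : Prog)
  | ite (b : Expr) (p q : Prog)
  | while (b : Expr) (p : Prog)

/-- Memory contents: the pair `(a, i)` addresses cell `i` of array `a`; all but finitely many cells
hold `0`. -/
abbrev Mem := ℕ × ℕ →₀ ℕ

/-- The number of bits used by a memory: every nonzero cell counts with the binary lengths of its
index and of its content. -/
def Mem.bits (μ : Mem) : ℕ :=
  μ.sum fun q v => 1 + q.2.size + v.size

/-- The value of an expression. -/
def Expr.eval (μ : Mem) : Expr → ℕ
  | .const c => c
  | .get a i => μ (a, i.eval μ)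
  | .op f x y => f.eval (x.eval μ) (y.eval μ)

/-- The time to evaluate an expression, in bit operations: reading costs the binary lengths of
the index and of the content, an operation costs the product of the binary lengths of its
arguments. -/
def Expr.cost (μ : Mem) : Expr → ℕ
  | .const c => 1 + c.size
  | .get a i => i.cost μ + (1 + (i.eval μ).size + (μ (a, i.eval μ)).size)
  | .op _ x y => x.cost μ + y.cost μ + (1 + (x.eval μ).size) * (1 + (y.eval μ).size)

/-- A state of a computation: the memory and the number of coins flipped so far. -/
structure State where
  mem : Mem
  flips : ℕ

/-- `Exec r P σ σ' t s`: if the successive coin flips show `r 0`, `r 1`, ..., then the program `P`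
started in the state `σ` halts in the state `σ'` after time `t`, and the largest number of bits
used by the memory in the course of the computation is `s`. -/
inductive Exec (r : ℕ → Bool) : Prog → State → State → ℕ → ℕ → Prop
  | skip (σ : State) : Exec r .skip σ σ 1 σ.mem.bits
  | set (a : ℕ) (i e : Expr) (σ : State) :
      Exec r (.set a i e) σ ⟨σ.mem.update (a, i.eval σ.mem) (e.eval σ.mem), σ.flips⟩
        (i.cost σ.mem + e.cost σ.mem + (1 + (i.eval σ.mem).size + (e.eval σ.mem).size))
        (max σ.mem.bits (Mem.bits (σ.mem.update (a, i.eval σ.mem) (e.eval σ.mem))))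
  | flip (a : ℕ) (i : Expr) (σ : State) :
      Exec r (.flip a i) σ
        ⟨σ.mem.update (a, i.eval σ.mem) (r σ.flips).toNat, σ.flips + 1⟩
        (i.cost σ.mem + (2 + (i.eval σ.mem).size))
        (max σ.mem.bits (Mem.bits (σ.mem.update (a, i.eval σ.mem) (r σ.flips).toNat)))
  | seq {p q : Prog} {σ σ' σ'' : State} {t t' s s' : ℕ} :
      Exec r p σ σ' t s → Exec r q σ' σ'' t' s' → Exec r (.seq p q) σ σ'' (t + t') (max s s')
  | ite_true {b : Expr} {p q : Prog} {σ σ' : State} {t s : ℕ} :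
      b.eval σ.mem ≠ 0 → Exec r p σ σ' t s →
        Exec r (.ite b p q) σ σ' (1 + b.cost σ.mem + t) s
  | ite_false {b : Expr} {p q : Prog} {σ σ' : State} {t s : ℕ} :
      b.eval σ.mem = 0 → Exec r q σ σ' t s →
        Exec r (.ite b p q) σ σ' (1 + b.cost σ.mem + t) s
  | while_true {b : Expr} {p : Prog} {σ σ' σ'' : State} {t t' s s' : ℕ} :
      b.eval σ.mem ≠ 0 → Exec r p σ σ' t s → Exec r (.while b p) σ' σ'' t' s' →
        Exec r (.while b p) σ σ'' (1 + b.cost σ.mem + t + t') (max s s')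
  | while_false {b : Expr} {p : Prog} {σ : State} :
      b.eval σ.mem = 0 → Exec r (.while b p) σ σ (1 + b.cost σ.mem) σ.mem.bits

/-- The initial state for the input word `x`: cell `i` of array `0` holds the `i`-th number of
`x`, all other cells hold `0`. -/
noncomputable def initial (x : List ℕ) : State where
  mem := Finsupp.onFinset ({0} ×ˢ Finset.range x.length)
    (fun q => if q.1 = 0 then x.getD q.2 0 else 0) (by
      rintro ⟨a, i⟩ h
      have ha : a = 0 := by
        by_contra h'
        simp [h'] at h
      have hi : i < x.length := by
        by_contra h'
        simp [List.getElem?_eq_none (not_lt.mp h')] at h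
      simp [ha, hi])
  flips := 0

/-- With the coin flips `r`, the program halts on the input word `x` and answers "Yes": in the
end cell `0` of array `1` is not `0`. -/
def AnswersYes (P : Prog) (x : List ℕ) (r : ℕ → Bool) : Prop :=
  ∃ σ' t s, Exec r P (initial x) σ' t s ∧ σ'.mem (1, 0) ≠ 0

/-- With the coin flips `r`, the program halts on the input word `x` and answers "No": in the
end cell `0` of array `1` is `0`. -/
def AnswersNo (P : Prog) (x : List ℕ) (r : ℕ → Bool) : Prop :=
  ∃ σ' t s, Exec r P (initial x) σ' t s ∧ σ'.mem (1, 0) = 0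

/-- Whatever the coin flips are, the program halts on the input word `x` after time at most `T`
and never uses more than `S` bits of memory. -/
def RunsWithin (P : Prog) (x : List ℕ) (T : ℝ) (S : ℕ) : Prop :=
  ∀ r : ℕ → Bool, ∃ σ' t s, Exec r P (initial x) σ' t s ∧ (t : ℝ) ≤ T ∧ s ≤ S

/-- The distribution of a sequence of independent fair coin flips. -/
noncomputable def coinMeasure : Measure (ℕ → Bool) :=
  Measure.infinitePi fun _ : ℕ => (PMF.uniformOfFintype Bool).toMeasure

end XkC

/-! Let n = km. Select a random set S of vertices, each with probability p = `numer k / denom k`,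
and suppose |S| = D ≤ 2m. Adding 2m - D dummy indices to S gives 2m indices. Give every pair of an
edge e and an index i a random weight z(e, i), and consider the matrix with zero diagonal whose
entry at i ≠ j sums z(e, i) z(e, j) over the edges e with e ∩ S = {i, j} ∩ S. An exact cover whose
members all meet S in at most two vertices becomes a perfect matching of the indices, labelled by
edges that also cover the complement of S. Determinants in characteristic two detect such matchings.

Covering the complement is enforced by inclusion-exclusion modulo two: the edges are restricted to
those avoiding a set Y outside S, and the determinants are summed over all Y (`sum_avoids`,
`sum_det_pairMat`). In the expanded sum, a permutation σ with edge choices f contributes the same as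
σ⁻¹ with f ∘ σ⁻¹, so the two cancel unless they coincide (`exists_symmetric_of_sum_ne_zero`). What
survives is a fixed-point-free involution with f constant on its pairs. These are at most m distinct
edges of size k that cover km vertices, hence an exact cover (`exactCover_of_symmetric`), so a "Yes"
is never wrong. Conversely, if a cover meets S as required, suitable 0-1 weights isolate a single
contribution (`exists_weights_sum_eq_one`), so the sum is a nonzero polynomial in the weights, and
by Schwartz-Zippel at least half of the weights make it nonzero (`two_mul_card_trial_eq_zero_le`).

A trial with |S| = D costs 2^(n-D) determinants, so the number of such trials is made proportional
to 2^D; then every D costs the same up to rounding. The expected number of successes is governed by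
the sum of (2p)^|U| (1-p)^(n-|U|) over the sets U that meet every member of the cover in at most two
vertices. This sum factors over the members into the m-th power of the sum of C(k, j) (2p)^j
(1-p)^(k-j) over j ≤ 2 (`sum_good`). With `reps` trials for each D the expectation is at least n
(`le_sum_reps`), so all trials fail with probability at most e^(-n), while the number of
determinants for each D is at most (4n+1) `ratio k` ^ m. The choice p = 3/(2k), or 11/20 if k = 3,
yields the constants (`ratio_le_growth_pow`, `growth_lt`).

On the machine, weights are polynomials over the field with two elements, coded by binary digits:
addition is exclusive or and multiplication is carryless. This ring is a domain, so no finite field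
has to be constructed, and Bird's algorithm computes determinants without division (`birdR_eq_det`).
Programs are assembled from terms, and the rules for `Ev` and `PEv` keep account of values, coins,
steps and registers. -/

namespace XkC

/-! ### A language of terms on top of the machine -/

/-- Reading register `j`. -/
abbrev Tm.rd (j : ℕ) : Expr := .get 2 (.const j)

/-- The data of a run: coins, input, a bound `W` on the number of bits of all registers and a bound
`J` on the number of registers. -/
structure Ctx where
  r : ℕ → Bool
  x : List ℕ
  W : ℕ
  J : ℕ
  x_lt : ∀ i, x.getD i 0 < 2 ^ W
  length_le : x.length ≤ W
  J_le : J ≤ W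
  le_W : 5 ≤ W

namespace Ctx

/-- The memory holds the input in array `0`, the registers `ρ` in array `2`, and nothing else. -/
structure St (C : Ctx) (ρ : ℕ → ℕ) (μ : Mem) : Prop where
  inp : ∀ i, μ (0, i) = C.x.getD i 0
  reg : ∀ j, μ (2, j) = ρ j
  zero : ∀ a i, a ≠ 0 → a ≠ 2 → μ (a, i) = 0
  lt : ∀ j, ρ j < 2 ^ C.W
  top : ∀ j, C.J ≤ j → ρ j = 0

/-- The space bound of a context. -/
def space (C : Ctx) : ℕ := (C.W + C.W) * (1 + C.W + C.W)

/-- The time bound for a single command in a context. -/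
def unit (C : Ctx) : ℕ := 20 * (C.W + 1) ^ 2

variable {C : Ctx}

/-- Only the input cells and the first `J` registers can be nonzero, at most `2 * W` cells in all,
and their indices and contents have at most `W` bits. This invariant alone gives the space bound,
whatever the program does. -/
theorem St.bits_le {ρ : ℕ → ℕ} {μ : Mem} (h : C.St ρ μ) : Mem.bits μ ≤ C.space := by
  classical
  set F : Finset (ℕ × ℕ) := ({0} : Finset ℕ) ×ˢ Finset.range C.x.length ∪
    ({2} : Finset ℕ) ×ˢ Finset.range C.J with hF
  have hsupp : ∀ q : ℕ × ℕ, μ q ≠ 0 →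
      (q.1 = 0 ∧ q.2 < C.x.length) ∨ (q.1 = 2 ∧ q.2 < C.J) := by
    rintro ⟨a, i⟩ hq
    by_cases h0 : a = 0
    · subst h0
      left
      refine ⟨rfl, ?_⟩
      by_contra hi
      apply hq
      rw [h.inp, List.getD_eq_default _ _ (not_lt.mp hi)]
    · by_cases h2 : a = 2
      · subst h2
        right
        refine ⟨rfl, ?_⟩
        by_contra hi
        apply hq
        rw [h.reg, h.top _ (not_lt.mp hi)]
      · exact absurd (h.zero a i h0 h2) hq
  have hsub : μ.support ⊆ F := by
    rintro q hq
    rcases hsupp q (Finsupp.mem_support_iff.mp hq) with ⟨h1, h2⟩ | ⟨h1, h2⟩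
    · exact Finset.mem_union_left _ (Finset.mem_product.mpr ⟨by simp [h1], by simp [h2]⟩)
    · exact Finset.mem_union_right _ (Finset.mem_product.mpr ⟨by simp [h1], by simp [h2]⟩)
  have hval : ∀ q ∈ μ.support, 1 + q.2.size + (μ q).size ≤ 1 + C.W + C.W := by
    rintro ⟨a, i⟩ hq
    have hs := hsupp _ (Finsupp.mem_support_iff.mp hq)
    have hi : i.size ≤ C.W := by
      rw [Nat.size_le]
      have : i < C.W := by
        have h1 := C.length_le
        have h2 := C.J_le
        rcases hs with hs | hs <;> have := hs.2 <;> simp only at this <;> omega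
      exact this.trans Nat.lt_two_pow_self
    have hv : (μ (a, i)).size ≤ C.W := by
      rw [Nat.size_le]
      rcases hs with ⟨h1, -⟩ | ⟨h1, -⟩ <;> simp only at h1 <;> subst h1
      · rw [h.inp]; exact C.x_lt i
      · rw [h.reg]; exact h.lt i
    simp only
    omega
  have hcard : μ.support.card ≤ C.W + C.W := by
    refine (Finset.card_le_card hsub).trans ((Finset.card_union_le _ _).trans ?_)
    have h1 := C.length_le
    have h2 := C.J_le
    simp
    omega
  calc Mem.bits μ ≤ μ.support.card • (1 + C.W + C.W) := Finset.sum_le_card_nsmul _ _ _ hval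
    _ ≤ C.space := Nat.mul_le_mul_right _ hcard

theorem St.update {ρ : ℕ → ℕ} {μ : Mem} (h : C.St ρ μ) {d v : ℕ} (hd : d < C.J)
    (hv : v < 2 ^ C.W) : C.St (Function.update ρ d v) (μ.update (2, d) v) where
  inp i := by simp [Finsupp.update, Function.update, h.inp]
  reg j := by simp [Finsupp.update, Function.update, h.reg]
  zero a i h0 h2 := by simp [Finsupp.update, Function.update, h.zero a i h0 h2, h2]
  lt j := by
    by_cases hj : j = d
    · simpa [hj] using hv
    · simpa [hj] using h.lt j
  top j hj := by
    have : j ≠ d := by omega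
    simpa [this] using h.top j hj

/-- The registers with the numbers `0, 1, …` hold the values listed in `Γ`. -/
def Match (Γ : List ℕ) (ρ : ℕ → ℕ) : Prop := ∀ j v, Γ[j]? = some v → ρ j = v

theorem Match.congr {Γ : List ℕ} {ρ ρ' : ℕ → ℕ} (h : Match Γ ρ)
    (h' : ∀ j < Γ.length, ρ' j = ρ j) : Match Γ ρ' := fun j v hj => by
  rw [h' j (List.getElem?_eq_some_iff.mp hj).1, h j v hj]

theorem Match.snoc {Γ : List ℕ} {ρ : ℕ → ℕ} {a : ℕ} (h : Match Γ ρ) (ha : ρ Γ.length = a) :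
    Match (Γ ++ [a]) ρ := fun j v hj => by
  rcases lt_trichotomy j Γ.length with hlt | rfl | hgt
  · rw [List.getElem?_append_left hlt] at hj
    exact h j v hj
  · simp at hj
    omega
  · rw [List.getElem?_eq_none (by simp; omega)] at hj
    cases hj

/-- The program `P`, started with registers `ρ`, halts with registers that agree with `ρ` below
`d` and hold `v` at `d`. -/
def Post (C : Ctx) (P : Prog) (σ : State) (ρ : ℕ → ℕ) (d v fl' S : ℕ) : Prop :=
  ∃ σ' t s ρ', Exec C.r P σ σ' t s ∧ C.St ρ' σ'.mem ∧ (∀ j < d, ρ' j = ρ j) ∧ ρ' d = v ∧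
    σ'.flips = fl' ∧ t ≤ S * C.unit ∧ s ≤ C.space

/-- Every register assignment in a compiled term goes through this lemma. The slack between `10 * (W
+ 1) ^ 2` for the expression and the constant 20 in `unit` pays for the write itself. -/
theorem post_set {σ : State} {ρ : ℕ → ℕ} (h : C.St ρ σ.mem) {d v : ℕ} {e : Expr} (hd : d < C.J)
    (hv : v < 2 ^ C.W) (he : e.eval σ.mem = v)
    (hc : e.cost σ.mem ≤ 10 * (C.W + 1) ^ 2) :
    ∃ σ' t s, Exec C.r (.set 2 (.const d) e) σ σ' t s ∧ C.St (Function.update ρ d v) σ'.mem ∧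
      σ'.flips = σ.flips ∧ t ≤ C.unit ∧ s ≤ C.space := by
  refine ⟨_, _, _, Exec.set 2 (.const d) e σ, ?_, rfl, ?_, ?_⟩
  · simp only [he, Expr.eval]
    exact h.update hd hv
  · have h1 : d.size ≤ C.W := by
      rw [Nat.size_le]
      exact (hd.trans_le C.J_le).trans Nat.lt_two_pow_self
    have h2 : v.size ≤ C.W := by rwa [Nat.size_le]
    simp only [he, Expr.eval, Expr.cost, unit]
    nlinarith
  · refine max_le h.bits_le ?_
    simp only [he, Expr.eval]
    exact (h.update hd hv).bits_le

theorem size_reg_le {d : ℕ} (hd : d < C.J) : d.size ≤ C.W := by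
  rw [Nat.size_le]
  exact (hd.trans_le C.J_le).trans Nat.lt_two_pow_self

theorem cost_reg {σ : State} {ρ : ℕ → ℕ} (h : C.St ρ σ.mem) {d : ℕ} (hd : d < C.J) :
    (Tm.rd d).cost σ.mem ≤ 2 + 3 * C.W := by
  have h1 := size_reg_le hd
  have h2 : (ρ d).size ≤ C.W := by
    rw [Nat.size_le]
    exact h.lt d
  simp only [Expr.cost, Expr.eval, h.reg]
  omega

theorem cost_op {σ : State} {ρ : ℕ → ℕ} (h : C.St ρ σ.mem) {d e : ℕ} (hd : d < C.J) (he : e < C.J)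
    (f : BinOp) : (Expr.op f (Tm.rd d) (Tm.rd e)).cost σ.mem ≤
      10 * (C.W + 1) ^ 2 := by
  have h1 := cost_reg h hd
  have h2 := cost_reg h he
  have h3 : (ρ d).size ≤ C.W := by
    rw [Nat.size_le]
    exact h.lt d
  have h4 : (ρ e).size ≤ C.W := by
    rw [Nat.size_le]
    exact h.lt e
  have h5 : (1 + (ρ d).size) * (1 + (ρ e).size) ≤ (1 + C.W) * (1 + C.W) := by gcongr
  rw [Expr.cost]
  simp only [Expr.eval, h.reg]
  nlinarith

end Ctx

/-! ### Terms -/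

/-- A term is a program for every register `d`; it leaves its value in register `d` and changes no
register with a smaller number. -/
abbrev Tm := ℕ → Prog

namespace Tm

def var (j : ℕ) : Tm := fun d => .set 2 (.const d) (rd j)

def lit (c : ℕ) : Tm := fun d => .set 2 (.const d) (.const c)

def inp (t : Tm) : Tm := fun d => .seq (t d) (.set 2 (.const d) (.get 0 (rd d)))

def op (f : BinOp) (x y : Tm) : Tm := fun d =>
  .seq (x d) (.seq (y (d + 1)) (.set 2 (.const d) (.op f (rd d) (rd (d + 1)))))

def coin : Tm := fun d => .flip 2 (.const d)

def letT (x : Tm) (b : Tm → Tm) : Tm := fun d =>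
  .seq (x d) (.seq (b (var d) (d + 1)) (.set 2 (.const d) (rd (d + 1))))

def ifT (c x y : Tm) : Tm := fun d => .seq (c d) (.ite (rd d) (x d) (y d))

/-- Iterate `body i acc` for `i = 0, …, n - 1`, starting from `init`. -/
def foldT (n init : Tm) (body : Tm → Tm → Tm) : Tm := fun d =>
  .seq (n d) (.seq (.set 2 (.const (d + 1)) (.const 0)) (.seq (init (d + 2)) (.seq
    (.while (.op .lt (rd (d + 1)) (rd d))
      (.seq (body (var (d + 1)) (var (d + 2)) (d + 3))
        (.seq (.set 2 (.const (d + 2)) (rd (d + 3)))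
          (.set 2 (.const (d + 1)) (.op .add (rd (d + 1)) (.const 1))))))
    (.set 2 (.const d) (rd (d + 2))))))

end Tm

/-- In every environment that extends `Γ`, the term `t` started when `fl` coins have been flipped
takes the value `v`, has then flipped `fl'` coins, takes at most `S` commands and `h` registers. -/
def Ev (C : Ctx) (t : Tm) (Γ : List ℕ) (fl v fl' S h : ℕ) : Prop :=
  v < 2 ^ C.W ∧ ∀ Γ' : List ℕ, Γ <+: Γ' → Γ'.length + h ≤ C.J → ∀ σ ρ, C.St ρ σ.mem →
    Ctx.Match Γ' ρ → σ.flips = fl → C.Post (t Γ'.length) σ ρ Γ'.length v fl' S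

/-- `t` flips no coins and takes the value `v` after polynomially many commands. -/
def PEv (C : Ctx) (t : Tm) (Γ : List ℕ) (v h : ℕ) : Prop :=
  ∀ fl, Ev C t Γ fl v fl (C.W ^ h) h

open Tm Ctx

/-! ### Evaluation rules for terms, with step and register counts -/

section rules
variable {C : Ctx} {Γ : List ℕ}

theorem Ev.mono {t : Tm} {fl v fl' S h : ℕ} (H : Ev C t Γ fl v fl' S h) {Γ' : List ℕ}
    (hΓ : Γ <+: Γ') : Ev C t Γ' fl v fl' S h :=
  ⟨H.1, fun _ h1 => H.2 _ (hΓ.trans h1)⟩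

theorem Ev.weaken {t : Tm} {fl v fl' S h S' h' : ℕ} (H : Ev C t Γ fl v fl' S h) (hS : S ≤ S')
    (hh : h ≤ h') : Ev C t Γ fl v fl' S' h' :=
  ⟨H.1, fun Γ' h1 h2 σ ρ h3 h4 h5 => by
    obtain ⟨σ', t', s, ρ', e1, e2, e3, e4, e5, e6, e7⟩ := H.2 Γ' h1 (by omega) σ ρ h3 h4 h5
    exact ⟨σ', t', s, ρ', e1, e2, e3, e4, e5, e6.trans (Nat.mul_le_mul_right _ hS), e7⟩⟩

theorem PEv.mono {t : Tm} {v h : ℕ} (H : PEv C t Γ v h) {Γ' : List ℕ} (hΓ : Γ <+: Γ') :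
    PEv C t Γ' v h := fun fl => (H fl).mono hΓ

theorem PEv.lt {t : Tm} {v h : ℕ} (H : PEv C t Γ v h) : v < 2 ^ C.W := (H 0).1

theorem Ctx.one_le_W (C : Ctx) : 1 ≤ C.W := le_trans (by norm_num) C.le_W

theorem PEv.weaken {t : Tm} {v h h' : ℕ} (H : PEv C t Γ v h) (hh : h ≤ h') : PEv C t Γ v h' :=
  fun fl => (H fl).weaken (Nat.pow_le_pow_right C.one_le_W hh) hh

theorem Ev.lit (c : ℕ) (hc : c < 2 ^ C.W) (fl : ℕ) : Ev C (Tm.lit c) Γ fl c fl 1 1 := by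
  refine ⟨hc, fun Γ' h1 h2 σ ρ h3 h4 h5 => ?_⟩
  have hs : c.size ≤ C.W := by rwa [Nat.size_le]
  obtain ⟨σ', t, s, e1, e2, e3, e4, e5⟩ := post_set (e := .const c) (v := c) h3
    (show Γ'.length < C.J by omega) hc rfl (by simp only [Expr.cost]; nlinarith)
  exact ⟨σ', t, s, _, e1, e2, fun j hj => Function.update_of_ne (by omega) _ _,
    Function.update_self .., e3.trans h5, by omega, e5⟩

theorem PEv.lit (c : ℕ) (hc : c < 2 ^ C.W) : PEv C (Tm.lit c) Γ c 1 := fun fl =>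
  (Ev.lit c hc fl).weaken (by simpa using C.one_le_W) le_rfl

theorem Ev.var {j v : ℕ} (hj : Γ[j]? = some v) (hv : v < 2 ^ C.W) (fl : ℕ) :
    Ev C (Tm.var j) Γ fl v fl 1 1 := by
  refine ⟨hv, fun Γ' h1 h2 σ ρ h3 h4 h5 => ?_⟩
  have hj' : Γ'[j]? = some v := by
    obtain ⟨l, rfl⟩ := h1
    rw [List.getElem?_append_left (List.getElem?_eq_some_iff.mp hj).1, hj]
  have hlt := (List.getElem?_eq_some_iff.mp hj').1
  have hcost := cost_reg h3 (show j < C.J by omega)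
  obtain ⟨σ', t, s, e1, e2, e3, e4, e5⟩ := post_set (e := rd j) (v := v) h3
    (show Γ'.length < C.J by omega) hv
    (by simp only [Expr.eval, h3.reg]; exact h4 j v hj') (by nlinarith)
  exact ⟨σ', t, s, _, e1, e2, fun j hj => Function.update_of_ne (by omega) _ _,
    Function.update_self .., e3.trans h5, by omega, e5⟩

theorem PEv.var {j v : ℕ} (hj : Γ[j]? = some v) (hv : v < 2 ^ C.W) : PEv C (Tm.var j) Γ v 1 :=
  fun fl => (Ev.var hj hv fl).weaken (by simpa using C.one_le_W) le_rfl

theorem Ev.coin (fl : ℕ) : Ev C Tm.coin Γ fl (C.r fl).toNat (fl + 1) 1 1 := by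
  have hv : (C.r fl).toNat < 2 ^ C.W :=
    lt_of_le_of_lt (Bool.toNat_le _) (Nat.one_lt_two_pow (by have := C.le_W; omega))
  refine ⟨hv, fun Γ' h1 h2 σ ρ h3 h4 h5 => ?_⟩
  have hd : Γ'.length < C.J := by omega
  have hs := size_reg_le hd
  subst h5
  refine ⟨_, _, _, _, Exec.flip 2 (.const Γ'.length) σ, h3.update hd hv,
    fun j hj => Function.update_of_ne (show j ≠ Γ'.length by omega) _ _,
    Function.update_self .., rfl, ?_, ?_⟩
  · simp only [Expr.cost, Expr.eval, unit]
    nlinarith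
  · exact max_le h3.bits_le (h3.update hd hv).bits_le

theorem Ev.inp {t : Tm} {fl v fl' S h : ℕ} (H : Ev C t Γ fl v fl' S h) :
    Ev C (Tm.inp t) Γ fl (C.x.getD v 0) fl' (S + 1) (h + 1) := by
  refine ⟨C.x_lt v, fun Γ' h1 h2 σ ρ h3 h4 h5 => ?_⟩
  obtain ⟨σ₁, t₁, s₁, ρ₁, e1, e2, e3, e4, e5, e6, e7⟩ := H.2 Γ' h1 (by omega) σ ρ h3 h4 h5
  have hd : Γ'.length < C.J := by omega
  have hcost := cost_reg e2 hd
  have hv : v.size ≤ C.W := by rw [Nat.size_le]; exact H.1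
  have hx : (C.x.getD v 0).size ≤ C.W := by rw [Nat.size_le]; exact C.x_lt v
  obtain ⟨σ', t, s, f1, f2, f3, f4, f5⟩ := post_set (e := .get 0 (rd Γ'.length))
    (v := C.x.getD v 0) e2 hd (C.x_lt v)
    (by simp only [Expr.eval, e2.reg, e4, e2.inp])
    (by
      rw [Expr.cost]
      simp only [Expr.eval, e2.reg, e4, e2.inp]
      nlinarith)
  exact ⟨σ', _, _, _, Exec.seq e1 f1, f2,
    fun j hj => (Function.update_of_ne (by omega) _ _).trans (e3 j hj),
    Function.update_self .., f3.trans e5, by rw [add_mul, one_mul]; omega, max_le e7 f5⟩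

theorem Ev.op {x y : Tm} {fl a fl₁ b fl₂ S₁ S₂ h : ℕ} (f : BinOp) (hx : Ev C x Γ fl a fl₁ S₁ h)
    (hy : Ev C y Γ fl₁ b fl₂ S₂ h) (hv : f.eval a b < 2 ^ C.W) :
    Ev C (Tm.op f x y) Γ fl (f.eval a b) fl₂ (S₁ + S₂ + 1) (h + 2) := by
  refine ⟨hv, fun Γ' h1 h2 σ ρ h3 h4 h5 => ?_⟩
  obtain ⟨σ₁, t₁, s₁, ρ₁, e1, e2, e3, e4, e5, e6, e7⟩ := hx.2 Γ' h1 (by omega) σ ρ h3 h4 h5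
  -- The second argument runs in the environment extended by the first value, and therefore leaves
  -- the register holding that value intact.
  obtain ⟨σ₂, t₂, s₂, ρ₂, f1, f2, f3, f4, f5, f6, f7⟩ := hy.2 (Γ' ++ [a])
    (h1.trans (List.prefix_append ..)) (by simp; omega) σ₁ ρ₁ e2 ((h4.congr e3).snoc e4) e5
  simp only [List.length_append, List.length_singleton] at f1 f3 f4
  obtain ⟨σ', t, s, g1, g2, g3, g4, g5⟩ := post_set
    (e := .op f (rd Γ'.length) (rd (Γ'.length + 1))) (v := f.eval a b) (d := Γ'.length) f2
    (by omega) hv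
    (by simp only [Expr.eval, f2.reg, f4, f3 Γ'.length (by omega), e4])
    (cost_op f2 (by omega) (by omega) f)
  refine ⟨σ', _, _, _, Exec.seq e1 (Exec.seq f1 g1), g2, fun j hj => ?_,
    Function.update_self .., g3.trans f5, ?_, max_le e7 (max_le f7 g5)⟩
  · rw [Function.update_of_ne (by omega), f3 j (by omega), e3 j hj]
  · rw [add_mul, add_mul, one_mul]; omega

/-- The hypothesis on `b` is stated for every term of value `a`, so later proofs never mention the
register in which the bound value is kept. -/
theorem Ev.letT {x : Tm} {b : Tm → Tm} {fl a fl₁ v fl₂ S₁ S₂ h : ℕ}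
    (hx : Ev C x Γ fl a fl₁ S₁ h)
    (hb : ∀ Γ', Γ <+: Γ' → ∀ u, PEv C u Γ' a 1 → Ev C (b u) Γ' fl₁ v fl₂ S₂ h) :
    Ev C (Tm.letT x b) Γ fl v fl₂ (S₁ + S₂ + 1) (h + 2) := by
  refine ⟨(hb (Γ ++ [a]) (List.prefix_append ..) (Tm.var Γ.length)
    (PEv.var (by simp) hx.1)).1, fun Γ' h1 h2 σ ρ h3 h4 h5 => ?_⟩
  obtain ⟨σ₁, t₁, s₁, ρ₁, e1, e2, e3, e4, e5, e6, e7⟩ := hx.2 Γ' h1 (by omega) σ ρ h3 h4 h5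
  have hb' := hb (Γ' ++ [a]) (h1.trans (List.prefix_append ..)) (Tm.var Γ'.length)
    (PEv.var (by simp) hx.1)
  obtain ⟨σ₂, t₂, s₂, ρ₂, f1, f2, f3, f4, f5, f6, f7⟩ := hb'.2 (Γ' ++ [a])
    List.prefix_rfl (by simp; omega) σ₁ ρ₁ e2 ((h4.congr e3).snoc e4) e5
  simp only [List.length_append, List.length_singleton] at f1 f3 f4
  have hcost := cost_reg f2 (show Γ'.length + 1 < C.J by omega)
  obtain ⟨σ', t, s, g1, g2, g3, g4, g5⟩ := post_set
    (e := rd (Γ'.length + 1)) (v := v) (d := Γ'.length) f2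
    (by omega) hb'.1 (by simp only [Expr.eval, f2.reg, f4]) (by nlinarith)
  refine ⟨σ', _, _, _, Exec.seq e1 (Exec.seq f1 g1), g2, fun j hj => ?_,
    Function.update_self .., g3.trans f5, ?_, max_le e7 (max_le f7 g5)⟩
  · rw [Function.update_of_ne (by omega), f3 j (by omega), e3 j hj]
  · rw [add_mul, add_mul, one_mul]; omega

theorem Ev.ifT {c x y : Tm} {fl a fl₁ v fl₂ S₁ S₂ h : ℕ}
    (hc : Ev C c Γ fl a fl₁ S₁ h) (hx : a ≠ 0 → Ev C x Γ fl₁ v fl₂ S₂ h)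
    (hy : a = 0 → Ev C y Γ fl₁ v fl₂ S₂ h) :
    Ev C (Tm.ifT c x y) Γ fl v fl₂ (S₁ + S₂ + 1) (h + 1) := by
  refine ⟨?_, fun Γ' h1 h2 σ ρ h3 h4 h5 => ?_⟩
  · by_cases ha : a = 0
    exacts [(hy ha).1, (hx ha).1]
  obtain ⟨σ₁, t₁, s₁, ρ₁, e1, e2, e3, e4, e5, e6, e7⟩ := hc.2 Γ' h1 (by omega) σ ρ h3 h4 h5
  have hcost := cost_reg e2 (show Γ'.length < C.J by omega)
  have hval : (rd Γ'.length).eval σ₁.mem = a := by simp only [Expr.eval, e2.reg, e4]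
  have hu : 1 + (rd Γ'.length).cost σ₁.mem ≤ C.unit := by
    simp only [unit]
    nlinarith
  by_cases ha : a = 0
  · obtain ⟨σ₂, t₂, s₂, ρ₂, f1, f2, f3, f4, f5, f6, f7⟩ :=
      (hy ha).2 Γ' h1 (by omega) σ₁ ρ₁ e2 (h4.congr e3) e5
    refine ⟨_, _, _, _, Exec.seq e1 (Exec.ite_false (hval.trans ha) f1), f2,
      fun j hj => (f3 j hj).trans (e3 j hj), f4, f5, ?_, max_le e7 f7⟩
    rw [add_mul, add_mul, one_mul]; omega
  · obtain ⟨σ₂, t₂, s₂, ρ₂, f1, f2, f3, f4, f5, f6, f7⟩ :=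
      (hx ha).2 Γ' h1 (by omega) σ₁ ρ₁ e2 (h4.congr e3) e5
    refine ⟨_, _, _, _, Exec.seq e1 (Exec.ite_true (hval ▸ ha) f1), f2,
      fun j hj => (f3 j hj).trans (e3 j hj), f4, f5, ?_, max_le e7 f7⟩
    rw [add_mul, add_mul, one_mul]; omega

/-- The loop of `foldT`, entered with counter `j`. -/
theorem post_while {Γ' : List ℕ} {body : Tm → Tm → Tm} {N S h : ℕ} {F fl : ℕ → ℕ}
    (hN : N < 2 ^ C.W) (hJ : Γ'.length + (h + 4) ≤ C.J)
    (hbody : ∀ j < N, ∀ Γ₁, Γ' <+: Γ₁ → ∀ i a, PEv C i Γ₁ j 1 → PEv C a Γ₁ (F j) 1 →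
      Ev C (body i a) Γ₁ (fl j) (F (j + 1)) (fl (j + 1)) S h) (k : ℕ) :
    ∀ j σ ρ, j + k = N → C.St ρ σ.mem → Match Γ' ρ → ρ Γ'.length = N → ρ (Γ'.length + 1) = j →
      ρ (Γ'.length + 2) = F j → σ.flips = fl j →
      ∃ σ' t s ρ', Exec C.r (.while (.op .lt (rd (Γ'.length + 1)) (rd Γ'.length))
      (.seq (body (Tm.var (Γ'.length + 1)) (Tm.var (Γ'.length + 2)) (Γ'.length + 3))
        (.seq (.set 2 (.const (Γ'.length + 2)) (rd (Γ'.length + 3)))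
          (.set 2 (.const (Γ'.length + 1)) (.op .add (rd (Γ'.length + 1)) (.const 1)))))) σ σ' t s ∧
        C.St ρ' σ'.mem ∧ (∀ j < Γ'.length, ρ' j = ρ j) ∧ ρ' (Γ'.length + 2) = F N ∧
        σ'.flips = fl N ∧ t ≤ (k * (S + 3) + 1) * C.unit ∧ s ≤ C.space := by
  have hu : ∀ σ : State, ∀ ρ, C.St ρ σ.mem →
      1 + (Expr.op .lt (rd (Γ'.length + 1)) (rd Γ'.length)).cost σ.mem ≤ C.unit := by
    intro σ ρ h
    have := cost_op h (show Γ'.length + 1 < C.J by omega) (show Γ'.length < C.J by omega) .lt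
    have h1 := Nat.one_le_pow 2 (C.W + 1) (by omega)
    simp only [unit]
    omega
  induction k with
  | zero =>
    intro j σ ρ hj h3 h4 hn hi ha hf
    obtain rfl : j = N := by omega
    refine ⟨σ, _, _, ρ, Exec.while_false ?_, h3, fun _ _ => rfl, ha, hf, ?_, h3.bits_le⟩
    · simp [Expr.eval, BinOp.eval, h3.reg, hn, hi]
    · simpa using hu σ ρ h3
  | succ k ih =>
    intro j σ ρ hj h3 h4 hn hi ha hf
    have hjN : j < N := by omega
    have hFj : F j < 2 ^ C.W := ha ▸ h3.lt _
    -- During an iteration the limit, the counter and the accumulator are three further environment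
    -- entries, so the body cannot overwrite them.
    have hm : Match (Γ' ++ [N] ++ [j] ++ [F j]) ρ :=
      (((h4.snoc hn).snoc (by simpa using hi)).snoc (by simpa using ha))
    have hb := hbody j hjN (Γ' ++ [N] ++ [j] ++ [F j]) ⟨[N] ++ [j] ++ [F j], by simp⟩
      (Tm.var (Γ'.length + 1)) (Tm.var (Γ'.length + 2))
      (PEv.var (by simp) (hjN.trans hN)) (PEv.var (by simp) hFj)
    obtain ⟨σ₁, t₁, s₁, ρ₁, e1, e2, e3, e4, e5, e6, e7⟩ := hb.2 _ List.prefix_rfl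
      (by simp; omega) σ ρ h3 hm hf
    simp only [List.length_append, List.length_singleton] at e1 e3 e4
    have hc3 := cost_reg e2 (show Γ'.length + 3 < C.J by omega)
    obtain ⟨σ₂, t₂, s₂, f1, f2, f3, f4, f5⟩ := post_set
      (e := rd (Γ'.length + 3)) (v := F (j + 1)) (d := Γ'.length + 2) e2
      (by omega) hb.1 (by simp only [Expr.eval, e2.reg, e4]) (by nlinarith)
    have hc4 := cost_reg f2 (show Γ'.length + 1 < C.J by omega)
    have hj1 : Function.update ρ₁ (Γ'.length + 2) (F (j + 1)) (Γ'.length + 1) = j := by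
      rw [Function.update_of_ne (by omega), e3 _ (by omega), hi]
    have hjs : j.size ≤ C.W := by
      rw [Nat.size_le]; omega
    obtain ⟨σ₃, t₃, s₃, g1, g2, g3, g4, g5⟩ := post_set
      (e := .op .add (rd (Γ'.length + 1)) (.const 1)) (v := j + 1) (d := Γ'.length + 1) f2
      (by omega) (by omega) (by simp only [Expr.eval, f2.reg, hj1, BinOp.eval])
      (by
        rw [Expr.cost]
        simp only [Expr.eval, f2.reg, hj1, Nat.size_one, Expr.cost] at hc4 ⊢
        nlinarith)
    obtain ⟨σ₄, t₄, s₄, ρ₄, k1, k2, k3, k4, k5, k6, k7⟩ := ih (j + 1) σ₃ _ (by omega) g2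
      (h4.congr fun i hi => by
        rw [Function.update_of_ne (by omega), Function.update_of_ne (by omega), e3 _ (by omega)])
      (by rw [Function.update_of_ne (by omega), Function.update_of_ne (by omega),
        e3 _ (by omega), hn])
      (Function.update_self ..)
      (by rw [Function.update_of_ne (by omega), Function.update_self])
      ((g3.trans f3).trans e5)
    refine ⟨σ₄, _, _, ρ₄, Exec.while_true ?_ (Exec.seq e1 (Exec.seq f1 g1)) k1, k2, ?_, k4, k5, ?_,
      max_le (max_le e7 (max_le f5 g5)) k7⟩
    · simp [Expr.eval, BinOp.eval, h3.reg, hn, hi, hjN]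
    · intro i hi
      rw [k3 i hi, Function.update_of_ne (by omega), Function.update_of_ne (by omega),
        e3 _ (by omega)]
    · have := hu σ ρ h3
      have hexp : ((k + 1) * (S + 3) + 1) * C.unit =
          C.unit + S * C.unit + C.unit + C.unit + (k * (S + 3) + 1) * C.unit := by ring
      rw [hexp]
      omega

theorem Ev.foldT {n init : Tm} {body : Tm → Tm → Tm} {N S₁ S₂ S h : ℕ} {F fl : ℕ → ℕ}
    (hn : Ev C n Γ (fl 0) N (fl 0) S₁ h) (hi : Ev C init Γ (fl 0) (F 0) (fl 0) S₂ h)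
    (hbody : ∀ j < N, ∀ Γ', Γ <+: Γ' → ∀ i a, PEv C i Γ' j 1 → PEv C a Γ' (F j) 1 →
      Ev C (body i a) Γ' (fl j) (F (j + 1)) (fl (j + 1)) S h) :
    Ev C (Tm.foldT n init body) Γ (fl 0) (F N) (fl N) (S₁ + S₂ + N * (S + 3) + 3) (h + 4) := by
  -- `Ev` includes a size bound for its value. Instantiating the body in an environment that holds
  -- `j` and `F j` carries this bound from one accumulator to the next.
  have hFN : ∀ j ≤ N, F j < 2 ^ C.W := by
    intro j hj
    induction j with
    | zero => exact hi.1
    | succ j ih =>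
      have hj0 := ih (by omega)
      exact (hbody j hj (Γ ++ [j] ++ [F j]) (by simp)
        (Tm.var Γ.length) (Tm.var (Γ.length + 1)) (PEv.var (by simp) (by have := hn.1; omega))
        (PEv.var (by simp) hj0)).1
  refine ⟨hFN N le_rfl, fun Γ' h1 h2 σ ρ h3 h4 h5 => ?_⟩
  obtain ⟨σ₁, t₁, s₁, ρ₁, e1, e2, e3, e4, e5, e6, e7⟩ := hn.2 Γ' h1 (by omega) σ ρ h3 h4 h5
  have hm1 := (h4.congr e3).snoc e4
  have h0 : 0 < 2 ^ C.W := by positivity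
  obtain ⟨σ₂, t₂, s₂, f1, f2, f3, f4, f5⟩ := post_set
      (e := .const 0) (v := 0) (d := Γ'.length + 1) e2
      (by omega) h0 rfl (by simp only [Expr.cost, Nat.size_zero]; have := Nat.one_le_pow 2 (C.W + 1) (by omega); omega)
  have hag : ∀ j < Γ'.length + 1, Function.update ρ₁ (Γ'.length + 1) 0 j = ρ₁ j := fun j hj =>
    Function.update_of_ne (by omega) _ _
  have hm2 : Match (Γ' ++ [N] ++ [0]) (Function.update ρ₁ (Γ'.length + 1) 0) :=
    (hm1.congr (by simpa using hag)).snoc (by simp)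
  obtain ⟨σ₃, t₃, s₃, ρ₃, g1, g2, g3, g4, g5, g6, g7⟩ := hi.2 (Γ' ++ [N] ++ [0])
    (h1.trans ⟨[N] ++ [0], by simp⟩) (by simp; omega) σ₂ _ f2 hm2 (f3.trans e5)
  simp only [List.length_append, List.length_singleton] at g1 g3 g4
  obtain ⟨σ₄, t₄, s₄, ρ₄, k1, k2, k3, k4, k5, k6, k7⟩ := post_while hn.1 h2
    (fun j hj Γ₁ hΓ₁ i a => hbody j hj Γ₁ (h1.trans hΓ₁) i a) N 0 σ₃ ρ₃ (by omega) g2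
    (h4.congr fun j hj => by rw [g3 j (by omega), hag j (by omega), e3 j hj])
    (by rw [g3 _ (by omega), hag _ (by omega), e4])
    (by rw [g3 _ (by omega), Function.update_self]) g4 g5
  have hcost := cost_reg k2 (show Γ'.length + 2 < C.J by omega)
  obtain ⟨σ', t, s, l1, l2, l3, l4, l5⟩ := post_set
    (e := rd (Γ'.length + 2)) (v := F N) (d := Γ'.length) k2
    (by omega) (hFN N le_rfl) (by simp only [Expr.eval, k2.reg, k4]) (by nlinarith)
  refine ⟨σ', _, _, _, Exec.seq e1 (Exec.seq f1 (Exec.seq g1 (Exec.seq k1 l1))), l2,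
    fun j hj => ?_, Function.update_self .., l3.trans k5, ?_,
    max_le e7 (max_le f5 (max_le g7 (max_le k7 l5)))⟩
  · rw [Function.update_of_ne (by omega), k3 j hj, g3 j (by omega), hag j (by omega), e3 j hj]
  -- Each iteration costs the body, two assignments and a test. Outside there remain the counter's
  -- initialization, the last test and the copy of the result.
  · have hexp : (S₁ + S₂ + N * (S + 3) + 3) * C.unit = S₁ * C.unit + C.unit + S₂ * C.unit +
      (N * (S + 3) + 1) * C.unit + C.unit := by ring
    rw [hexp]
    omega

end rules

/-! ### Terms of polynomial cost -/

section
variable {C : Ctx} {Γ : List ℕ}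

/-- Since `5 ≤ W`, two more factors `W` absorb a constant factor and a constant term. This is why a
single number can bound the exponent of the step count and the number of registers, and grows by two
with every operation. -/
theorem Ctx.step_bound (C : Ctx) (h c d : ℕ) (hc : c ≤ 4) (hd : d ≤ 10) :
    c * C.W ^ h + d ≤ C.W ^ (h + 2) := by
  have h1 := Nat.one_le_pow h C.W C.one_le_W
  have h2 := C.le_W
  have h3 : C.W ^ (h + 2) = C.W ^ h * (C.W * C.W) := by ring
  rw [h3]
  nlinarith [Nat.mul_le_mul h2 h2, Nat.mul_le_mul_left (C.W ^ h) (Nat.mul_le_mul h2 h2),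
    Nat.mul_le_mul_right (C.W ^ h) hc]

theorem PEv.inp {t : Tm} {v h : ℕ} (H : PEv C t Γ v h) :
    PEv C (Tm.inp t) Γ (C.x.getD v 0) (h + 2) := fun fl =>
  (H fl).inp.weaken (by have := C.step_bound h 1 1 (by norm_num) (by norm_num); omega) (by omega)

theorem PEv.op {x y : Tm} {a b h₁ h₂ : ℕ} (f : BinOp) (hx : PEv C x Γ a h₁) (hy : PEv C y Γ b h₂)
    (hv : f.eval a b < 2 ^ C.W) : PEv C (Tm.op f x y) Γ (f.eval a b) (max h₁ h₂ + 2) := fun fl =>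
  (Ev.op f (hx.weaken (le_max_left h₁ h₂) fl) (hy.weaken (le_max_right h₁ h₂) fl) hv).weaken
    (by have := C.step_bound (max h₁ h₂) 2 1 (by norm_num) (by norm_num); omega) (by omega)

theorem PEv.ifT {c x y : Tm} {a v h₁ h₂ h₃ : ℕ} (hc : PEv C c Γ a h₁)
    (hx : a ≠ 0 → PEv C x Γ v h₂) (hy : a = 0 → PEv C y Γ v h₃) :
    PEv C (Tm.ifT c x y) Γ v (max h₁ (max h₂ h₃) + 2) := fun fl =>
  (Ev.ifT (hc.weaken (le_max_left h₁ (max h₂ h₃)) fl)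
    (fun h => (hx h).weaken (h' := max h₁ (max h₂ h₃)) (by omega) fl)
    (fun h => (hy h).weaken (h' := max h₁ (max h₂ h₃)) (by omega) fl)).weaken
    (by have := C.step_bound (max h₁ (max h₂ h₃)) 2 1 (by norm_num) (by norm_num); omega) (by omega)

theorem Ctx.fold_le (C : Ctx) {N : ℕ} (h : ℕ) (hN : N ≤ C.W) :
    C.W ^ h + C.W ^ h + N * (C.W ^ h + 3) + 3 ≤ C.W ^ (h + 4) := by
  have h1 := Nat.one_le_pow h C.W C.one_le_W
  have h2 := C.le_W
  have h3 := C.step_bound h 4 10 (by norm_num) (by norm_num)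
  have h4 : C.W ^ (h + 4) = C.W ^ (h + 2) * (C.W * C.W) := by ring
  have h5 : N * (C.W ^ h + 3) ≤ C.W * C.W ^ (h + 2) := Nat.mul_le_mul hN (by omega)
  have h6 : 5 * C.W ≤ C.W * C.W := Nat.mul_le_mul_right _ h2
  have h7 : C.W ^ (h + 2) * (5 * C.W) ≤ C.W ^ (h + 2) * (C.W * C.W) := Nat.mul_le_mul_left _ h6
  have h8 : C.W ^ (h + 2) * 5 ≤ C.W ^ (h + 2) * C.W := Nat.mul_le_mul_left _ h2
  rw [h4]
  nlinarith

/-- Only loops with at most `W` iterations stay polynomial. The exponentially long loops use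
`Ev.foldT` directly. -/
theorem PEv.foldT {n init : Tm} {body : Tm → Tm → Tm} {N h₁ h₂ h₃ : ℕ} {F : ℕ → ℕ}
    (hn : PEv C n Γ N h₁) (hi : PEv C init Γ (F 0) h₂) (hN : N ≤ C.W)
    (hbody : ∀ j < N, ∀ Γ', Γ <+: Γ' → ∀ i a, PEv C i Γ' j 1 → PEv C a Γ' (F j) 1 →
      PEv C (body i a) Γ' (F (j + 1)) h₃) :
    PEv C (Tm.foldT n init body) Γ (F N) (max h₁ (max h₂ h₃) + 4) := fun fl => by
  have h := Ev.foldT (fl := fun _ => fl) (hn.weaken (h' := max h₁ (max h₂ h₃)) (by omega) fl)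
    (hi.weaken (h' := max h₁ (max h₂ h₃)) (by omega) fl)
    (fun j hj Γ' hΓ i a hi ha =>
      (hbody j hj Γ' hΓ i a hi ha).weaken (h' := max h₁ (max h₂ h₃)) (by omega) fl)
  exact h.weaken (C.fold_le _ hN) le_rfl

theorem PEv.letT {x : Tm} {b : Tm → Tm} {a v h₁ h₂ : ℕ} (hx : PEv C x Γ a h₁)
    (hb : ∀ Γ', Γ <+: Γ' → ∀ u, PEv C u Γ' a 1 → PEv C (b u) Γ' v h₂) :
    PEv C (Tm.letT x b) Γ v (max h₁ h₂ + 2) := fun fl =>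
  (Ev.letT (hx.weaken (le_max_left h₁ h₂) fl)
    (fun Γ' hΓ u hu => (hb Γ' hΓ u hu).weaken (le_max_right h₁ h₂) fl)).weaken
    (by have := C.step_bound (max h₁ h₂) 2 1 (by norm_num) (by norm_num); omega) (by omega)

theorem PEv.congr {t : Tm} {v v' h : ℕ} (H : PEv C t Γ v h) (hv : v = v') : PEv C t Γ v' h :=
  hv ▸ H

theorem PEv.of_le {c : ℕ} (hc : c ≤ C.W) : PEv C (Tm.lit c) Γ c 1 :=
  PEv.lit c (hc.trans_lt Nat.lt_two_pow_self)

/-! ### Rules for the operations of the machine -/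

variable {x y : Tm} {a b h₁ h₂ : ℕ}

theorem PEv.add (hx : PEv C x Γ a h₁) (hy : PEv C y Γ b h₂) (hv : a + b < 2 ^ C.W) :
    PEv C (Tm.op .add x y) Γ (a + b) (max h₁ h₂ + 2) := hx.op .add hy hv

theorem PEv.mul (hx : PEv C x Γ a h₁) (hy : PEv C y Γ b h₂) (hv : a * b < 2 ^ C.W) :
    PEv C (Tm.op .mul x y) Γ (a * b) (max h₁ h₂ + 2) := hx.op .mul hy hv

theorem PEv.sub (hx : PEv C x Γ a h₁) (hy : PEv C y Γ b h₂) :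
    PEv C (Tm.op .sub x y) Γ (a - b) (max h₁ h₂ + 2) :=
  hx.op .sub hy ((Nat.sub_le _ _).trans_lt hx.lt)

theorem PEv.div (hx : PEv C x Γ a h₁) (hy : PEv C y Γ b h₂) :
    PEv C (Tm.op .div x y) Γ (a / b) (max h₁ h₂ + 2) :=
  hx.op .div hy ((Nat.div_le_self _ _).trans_lt hx.lt)

theorem PEv.mod (hx : PEv C x Γ a h₁) (hy : PEv C y Γ b h₂) :
    PEv C (Tm.op .mod x y) Γ (a % b) (max h₁ h₂ + 2) :=
  hx.op .mod hy ((Nat.mod_le _ _).trans_lt hx.lt)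

theorem PEv.xor (hx : PEv C x Γ a h₁) (hy : PEv C y Γ b h₂) :
    PEv C (Tm.op .xor x y) Γ (a ^^^ b) (max h₁ h₂ + 2) :=
  hx.op .xor hy (Nat.xor_lt_two_pow hx.lt hy.lt)

theorem Ctx.bool_lt (C : Ctx) (p : Prop) [Decidable p] : (if p then 1 else 0) < 2 ^ C.W := by
  have : 1 < 2 ^ C.W := Nat.one_lt_two_pow (by have := C.le_W; omega)
  split_ifs <;> omega

theorem PEv.blt (hx : PEv C x Γ a h₁) (hy : PEv C y Γ b h₂) :
    PEv C (Tm.op .lt x y) Γ (if a < b then 1 else 0) (max h₁ h₂ + 2) :=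
  hx.op .lt hy (C.bool_lt _)

theorem PEv.beq (hx : PEv C x Γ a h₁) (hy : PEv C y Γ b h₂) :
    PEv C (Tm.op .eq x y) Γ (if a = b then 1 else 0) (max h₁ h₂ + 2) :=
  hx.op .eq hy (C.bool_lt _)

/-- `ifT` with a condition whose value is the truth value of a proposition. -/
theorem PEv.cond {c x y : Tm} {p : Prop} [Decidable p] {v w h₁ h₂ h₃ : ℕ}
    (hc : PEv C c Γ (if p then 1 else 0) h₁) (hx : p → PEv C x Γ v h₂) (hy : ¬ p → PEv C y Γ w h₃) :
    PEv C (Tm.ifT c x y) Γ (if p then v else w) (max h₁ (max h₂ h₃) + 2) := by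
  refine PEv.ifT hc (fun h => ?_) (fun h => ?_)
  · have hp : p := by by_contra hp; simp [hp] at h
    simpa [hp] using hx hp
  · have hp : ¬ p := by intro hp; simp [hp] at h
    simpa [hp] using hy hp

/-! ### Sums, powers, and iterated exclusive or -/

/-- The exclusive or of `f 0, …, f (N - 1)`. -/
def xorSum : ℕ → (ℕ → ℕ) → ℕ
  | 0, _ => 0
  | N + 1, f => xorSum N f ^^^ f N

theorem xorSum_lt {N p : ℕ} {f : ℕ → ℕ} (h : ∀ i < N, f i < 2 ^ p) : xorSum N f < 2 ^ p := by
  induction N with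
  | zero => simp [xorSum]
  | succ N ih => exact Nat.xor_lt_two_pow (ih fun i hi => h i (by omega)) (h N (by omega))

namespace Tm

def xorT (n : Tm) (f : Tm → Tm) : Tm := foldT n (lit 0) fun i a => op .xor a (f i)

def sumT (n : Tm) (f : Tm → Tm) : Tm := foldT n (lit 0) fun i a => op .add a (f i)

def allT (n : Tm) (f : Tm → Tm) : Tm := foldT n (lit 1) fun i a => ifT (f i) a (lit 0)

def powT (b e : Tm) : Tm := foldT e (lit 1) fun _ a => op .mul a b

end Tm

variable {n : Tm} {f : Tm → Tm} {N h : ℕ} {F : ℕ → ℕ}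

theorem PEv.xorT (hn : PEv C n Γ N h₁) (hN : N ≤ C.W)
    (hf : ∀ j < N, ∀ Γ', Γ <+: Γ' → ∀ i, PEv C i Γ' j 1 → PEv C (f i) Γ' (F j) h) :
    PEv C (Tm.xorT n f) Γ (xorSum N F) (max h₁ h + 8) := by
  refine (PEv.foldT (F := fun N => xorSum N F) hn (PEv.of_le (c := 0) (Nat.zero_le _)) hN
    (fun j hj Γ' hΓ i a hi ha => ha.xor (hf j hj Γ' hΓ i hi))).weaken (by omega)

theorem PEv.sumT (hn : PEv C n Γ N h₁) (hN : N ≤ C.W) (hlt : ∑ i ∈ Finset.range N, F i < 2 ^ C.W)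
    (hf : ∀ j < N, ∀ Γ', Γ <+: Γ' → ∀ i, PEv C i Γ' j 1 → PEv C (f i) Γ' (F j) h) :
    PEv C (Tm.sumT n f) Γ (∑ i ∈ Finset.range N, F i) (max h₁ h + 8) := by
  refine (PEv.foldT (F := fun N => ∑ i ∈ Finset.range N, F i) hn (PEv.of_le (c := 0) (Nat.zero_le _)) hN
    (fun j hj Γ' hΓ i a hi ha => (ha.add (hf j hj Γ' hΓ i hi) ?_).congr ?_)).weaken (by omega)
  · rw [← Finset.sum_range_succ]
    exact (Finset.sum_le_sum_of_subset (Finset.range_mono hj)).trans_lt hlt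
  · rw [Finset.sum_range_succ]

theorem PEv.allT {p : ℕ → Prop} [DecidablePred p] (hn : PEv C n Γ N h₁) (hN : N ≤ C.W)
    (hf : ∀ j < N, ∀ Γ', Γ <+: Γ' → ∀ i, PEv C i Γ' j 1 →
      PEv C (f i) Γ' (if p j then 1 else 0) h) :
    PEv C (Tm.allT n f) Γ (if ∀ i < N, p i then 1 else 0) (max h₁ h + 8) := by
  refine (PEv.foldT (F := fun N => if ∀ i < N, p i then 1 else 0) hn
    ((PEv.of_le (c := 1) C.one_le_W).congr (by simp)) hN
    (fun j hj Γ' hΓ i a hi ha => ((hf j hj Γ' hΓ i hi).cond (fun _ => ha)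
      (fun _ => PEv.of_le (Nat.zero_le _))).congr ?_)).weaken (by omega)
  simp only [Nat.lt_succ_iff_lt_or_eq, or_imp, forall_and, forall_eq]
  by_cases h1 : p j <;> simp [h1]

theorem PEv.powT (hx : PEv C x Γ a h₁) (hy : PEv C y Γ b h₂) (ha : 0 < a) (hb : b ≤ C.W)
    (hlt : a ^ b < 2 ^ C.W) : PEv C (Tm.powT x y) Γ (a ^ b) (max h₁ h₂ + 8) := by
  refine (PEv.foldT (F := fun N => a ^ N) hy ((PEv.of_le (c := 1) C.one_le_W).congr (by simp)) hb
    (fun j hj Γ' hΓ i c hi hc => (hc.mul (hx.mono hΓ) ?_).congr ?_)).weaken (by omega)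
  · rw [← pow_succ]
    exact (Nat.pow_le_pow_right ha hj).trans_lt hlt
  · rw [pow_succ]

theorem PEv.two_pow (hy : PEv C y Γ b h₂) (hb : b < C.W) :
    PEv C (Tm.powT (.lit 2) y) Γ (2 ^ b) (h₂ + 9) :=
  ((PEv.of_le (c := 2) (by have := C.le_W; omega)).powT hy (by norm_num) hb.le
    (Nat.pow_lt_pow_right (by norm_num) hb)).weaken (by omega)

end

/-! ### The quantities computed by the algorithm -/

/-- The carryless product of `a` and `b`, if `b` has at most `w` bits. -/
def clmul (w a b : ℕ) : ℕ := xorSum w fun j => a * 2 ^ j * (b / 2 ^ j % 2)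

theorem clmul_lt {w a b p : ℕ} (ha : a < 2 ^ p) : clmul w a b < 2 ^ (p + w) := by
  refine xorSum_lt fun j hj => ?_
  have h1 : b / 2 ^ j % 2 ≤ 1 := by omega
  calc a * 2 ^ j * (b / 2 ^ j % 2) ≤ a * 2 ^ j * 1 := Nat.mul_le_mul_left _ h1
    _ < 2 ^ p * 2 ^ j := by
      rw [mul_one]; exact Nat.mul_lt_mul_of_pos_right ha (by positivity)
    _ = 2 ^ (p + j) := by rw [pow_add]
    _ ≤ 2 ^ (p + w) := Nat.pow_le_pow_right (by norm_num) (by omega)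

/-- The vertex `v` is selected by the random number `ρ`. -/
def Sel (n a ρ v : ℕ) : Prop := ρ / 2 ^ ((n + 3) * v) % 2 ^ (n + 3) < a

instance (n a ρ v : ℕ) : Decidable (Sel n a ρ v) := Nat.decLt _ _

/-- The number of `u < v` outside `S`. -/
def rnk (S : ℕ → Prop) [DecidablePred S] (v : ℕ) : ℕ := ∑ u ∈ Finset.range v, if S u then 0 else 1

theorem rnk_le (S : ℕ → Prop) [DecidablePred S] (v : ℕ) : rnk S v ≤ v := by
  calc rnk S v ≤ ∑ _u ∈ Finset.range v, 1 := Finset.sum_le_sum fun u _ => by split_ifs <;> simp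
    _ = v := by simp

/-- The multiplicity of the vertex `u` in edge number `e` of the input word. -/
def memE (x : List ℕ) (k e u : ℕ) : ℕ :=
  ∑ q ∈ Finset.range k, if x.getD (3 + e * k + q) 0 = u then 1 else 0

theorem memE_le (x : List ℕ) (k e u : ℕ) : memE x k e u ≤ k := by
  calc memE x k e u ≤ ∑ _q ∈ Finset.range k, 1 :=
        Finset.sum_le_sum fun u _ => by split_ifs <;> simp
    _ = k := by simp

/-- The edge with multiplicities `μ` avoids the set numbered `y` and meets `S` in `{i, j}`. -/
def Fits (n : ℕ) (S : ℕ → Prop) [DecidablePred S] (μ : ℕ → ℕ) (y i j : ℕ) : Prop :=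
  ∀ u < n, (if S u then μ u else μ u * (y / 2 ^ rnk S u % 2)) =
    if S u then (if u = i then 1 else 0) + (if u = j then 1 else 0) else 0

instance (n : ℕ) (S : ℕ → Prop) [DecidablePred S] (μ : ℕ → ℕ) (y i j : ℕ) :
    Decidable (Fits n S μ y i j) := by unfold Fits; infer_instance

/-- The random weight for edge `e` and index `i`. -/
def wt (n ρ e i : ℕ) : ℕ := ρ / 2 ^ ((n + 3) * n + (n + 2) * (e * (2 * n) + i)) % 2 ^ (n + 2)

/-- An index is active if it is a selected vertex or not a vertex at all. -/
def Act (n : ℕ) (S : ℕ → Prop) (i : ℕ) : Prop := i < n → S i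

instance (n : ℕ) (S : ℕ → Prop) [DecidablePred S] (i : ℕ) : Decidable (Act n S i) := by
  unfold Act; infer_instance

/-- The entries of the matrix for the set numbered `y`. -/
def ent (x : List ℕ) (n k L a ρ y i j : ℕ) : ℕ :=
  if i = j then (if Act n (Sel n a ρ) i then 0 else 1) else
    if Act n (Sel n a ρ) i then if Act n (Sel n a ρ) j then
      xorSum L fun e => if Fits n (Sel n a ρ) (memE x k e) y i j then
        clmul (n + 2) (wt n ρ e i) (wt n ρ e j) else 0
    else 0 else 0

theorem ent_lt (x : List ℕ) (n k L a ρ y i j : ℕ) : ent x n k L a ρ y i j < 2 ^ (2 * n + 4) := by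
  have h0 : 0 < 2 ^ (2 * n + 4) := by positivity
  have h1 : 1 < 2 ^ (2 * n + 4) := Nat.one_lt_two_pow (by omega)
  unfold ent
  split_ifs
  · exact h0
  · exact h1
  · refine xorSum_lt fun e _ => ?_
    split_ifs
    · refine (clmul_lt (p := n + 2) (Nat.mod_lt _ (by positivity))).trans_eq ?_
      congr 1
      ring
    · exact h0
  · exact h0
  · exact h0

/-- Bird's iteration for determinants, in characteristic two. -/
def birdN (w M : ℕ) (A : ℕ → ℕ → ℕ) : ℕ → ℕ → ℕ → ℕ
  | 0, i, j => A i j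
  | t + 1, i, j => xorSum M fun l => if i < l then
      clmul w (birdN w M A t i l) (A l j) ^^^ clmul w (birdN w M A t l l) (A i j) else 0

/-- Every step multiplies by one matrix entry and so adds `w` bits; carryless sums add none. -/
theorem birdN_lt {w M : ℕ} {A : ℕ → ℕ → ℕ} (hA : ∀ i j, A i j < 2 ^ w) (t : ℕ) :
    ∀ i j, birdN w M A t i j < 2 ^ ((t + 1) * w) := by
  induction t with
  | zero => simpa [birdN] using hA
  | succ t ih =>
    intro i j
    rw [birdN]
    refine xorSum_lt fun l _ => ?_
    split_ifs
    · rw [show (t + 1 + 1) * w = (t + 1) * w + w by ring]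
      exact Nat.xor_lt_two_pow (clmul_lt (ih i l)) (clmul_lt (ih l l))
    · positivity

/-- The outcome of a trial: an exclusive or of determinants, if the selected set has size `D`. -/
def trial (x : List ℕ) (n k L a D ρ : ℕ) : ℕ :=
  if n - rnk (Sel n a ρ) n = D then
    xorSum (2 ^ (n - D)) fun y =>
      birdN (2 * n + 4) (n + 2 * (n / k) - D) (ent x n k L a ρ y) (n + 2 * (n / k) - D - 1) 0 0
  else 0

/-! ### Packed tables -/

/-- The number with digits `f 0, …, f (N - 1)` in base `b`. -/
def pack (b N : ℕ) (f : ℕ → ℕ) : ℕ := ∑ i ∈ Finset.range N, f i * b ^ i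

theorem pack_lt {b N : ℕ} {f : ℕ → ℕ} (h : ∀ i < N, f i < b) : pack b N f < b ^ N := by
  induction N with
  | zero => simp [pack]
  | succ N ih =>
    have h1 := ih fun i hi => h i (by omega)
    have h2 := h N (by omega)
    rw [pack, Finset.sum_range_succ, ← pack, pow_succ']
    calc pack b N f + f N * b ^ N < b ^ N + f N * b ^ N := by omega
      _ = (f N + 1) * b ^ N := by ring
      _ ≤ b * b ^ N := Nat.mul_le_mul_right _ h2

theorem pack_digit {b N : ℕ} {f : ℕ → ℕ} (h : ∀ i < N, f i < b) {i : ℕ} (hi : i < N) :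
    pack b N f / b ^ i % b = f i := by
  induction N with
  | zero => omega
  | succ N ih =>
    have hb : 0 < b := by have := h i hi; omega
    have hN := pack_lt fun i (hi : i < N) => h i (by omega)
    have hfN := h N (by omega)
    rw [pack, Finset.sum_range_succ, ← pack]
    rcases Nat.lt_succ_iff_lt_or_eq.mp hi with hi | rfl
    · rw [show f N * b ^ N = f N * b ^ (N - i - 1) * b * b ^ i by
        rw [mul_assoc, mul_assoc, ← pow_succ', ← pow_add]; congr 2; omega,
        Nat.add_mul_div_right _ _ (by positivity), Nat.add_mul_mod_self_right]
      exact ih (fun i hi => h i (by omega)) hi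
    · rw [Nat.add_mul_div_right _ _ (by positivity), Nat.div_eq_of_lt hN, zero_add,
        Nat.mod_eq_of_lt hfN]

/-! ### The terms that compute them -/

namespace Tm

def add (x y : Tm) : Tm := op .add x y
def mul (x y : Tm) : Tm := op .mul x y
def sub (x y : Tm) : Tm := op .sub x y
def div (x y : Tm) : Tm := op .div x y
def mod (x y : Tm) : Tm := op .mod x y
def twoPow (e : Tm) : Tm := powT (lit 2) e

def nT : Tm := inp (lit 0)
def kT : Tm := inp (lit 1)
def lT : Tm := inp (lit 2)

def clmulT (w a b : Tm) : Tm :=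
  xorT w fun j => mul (mul a (twoPow j)) (mod (div b (twoPow j)) (lit 2))

def selT (a ρ v : Tm) : Tm :=
  op .lt (mod (div ρ (twoPow (mul (add nT (lit 3)) v))) (twoPow (add nT (lit 3)))) a

def rnkT (a ρ v : Tm) : Tm := sumT v fun u => ifT (selT a ρ u) (lit 0) (lit 1)

def memT (e u : Tm) : Tm :=
  sumT kT fun q => op .eq (inp (add (add (lit 3) (mul e kT)) q)) u

def fitsT (a ρ y e i j : Tm) : Tm :=
  allT nT fun u => op .eq
    (ifT (selT a ρ u) (memT e u) (mul (memT e u) (mod (div y (twoPow (rnkT a ρ u))) (lit 2))))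
    (ifT (selT a ρ u) (add (op .eq u i) (op .eq u j)) (lit 0))

def wtT (ρ e i : Tm) : Tm :=
  mod (div ρ (twoPow (add (mul (add nT (lit 3)) nT)
    (mul (add nT (lit 2)) (add (mul e (mul (lit 2) nT)) i))))) (twoPow (add nT (lit 2)))

/-- Numbers from `n` on are the dummy indices, which are always active. -/
def actT (a ρ i : Tm) : Tm := ifT (op .lt i nT) (selT a ρ i) (lit 1)

def entT (a ρ y i j : Tm) : Tm :=
  ifT (op .eq i j) (ifT (actT a ρ i) (lit 0) (lit 1))
    (ifT (actT a ρ i) (ifT (actT a ρ j)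
      (xorT lT fun e => ifT (fitsT a ρ y e i j)
        (clmulT (add nT (lit 2)) (wtT ρ e i) (wtT ρ e j)) (lit 0)) (lit 0)) (lit 0))

def dimT (D : Tm) : Tm := sub (add nT (mul (lit 2) (div nT kT))) D

/-- Twice the bound `n + 2` on the number of bits of the weights. -/
def widthT : Tm := add (mul (lit 2) nT) (lit 4)

def baseT (D : Tm) : Tm := twoPow (mul (dimT D) widthT)

/-- The table of all `f i j` with `i` and `j` below the dimension. -/
def tableT (D : Tm) (f : Tm → Tm → Tm) : Tm :=
  sumT (mul (dimT D) (dimT D)) fun s => letT (div s (dimT D)) fun i => letT (mod s (dimT D)) fun j =>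
    mul (f i j) (powT (baseT D) s)

def entryT (D X i j : Tm) : Tm :=
  mod (div X (powT (baseT D) (add (mul i (dimT D)) j))) (baseT D)

/-- Only the current table of the iteration is kept, packed into one number. The entries of the
matrix are computed afresh at every use. -/
def birdT (a ρ D y : Tm) : Tm :=
  entryT D (foldT (sub (dimT D) (lit 1)) (tableT D fun i j => entT a ρ y i j) fun _ X =>
    tableT D fun i j => xorT (dimT D) fun l => ifT (op .lt i l)
      (op .xor (clmulT widthT (entryT D X i l) (entT a ρ y l j))
        (clmulT widthT (entryT D X l l) (entT a ρ y i j))) (lit 0)) (lit 0) (lit 0)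

end Tm

/-- A context for an instance with `n` vertices and `L` edges of size `k`. -/
structure Params (C : Ctx) (n k L : ℕ) : Prop where
  x_zero : C.x.getD 0 0 = n
  x_one : C.x.getD 1 0 = k
  x_two : C.x.getD 2 0 = L
  two_le : 2 ≤ k
  W_const : n + k + L + 20 ≤ C.W
  W_index : 3 + L * k + k ≤ C.W
  W_coins : (n + 3) * n + (n + 2) * (L * (2 * n)) + n + 5 ≤ C.W
  W_table : 2 * n * (2 * n + 4) * (2 * n * (2 * n)) + 2 * n * (2 * n + 4) + (2 * n + 4) + 1 ≤ C.W
  W_reps : (4 * k + 28) * (n + k) + 6 * n + 300 * k * k + 300 ≤ C.W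

/-! ### The terms evaluate to the quantities of the algorithm -/

section
variable {C : Ctx} {n k L : ℕ} (P : Params C n k L) {Γ : List ℕ}
include P

theorem Params.nT : PEv C Tm.nT Γ n 3 := (PEv.of_le (c := 0) (Nat.zero_le _)).inp.congr P.x_zero

theorem Params.kT : PEv C Tm.kT Γ k 3 :=
  (PEv.of_le (c := 1) (by have := P.W_const; omega)).inp.congr P.x_one

theorem Params.lT : PEv C Tm.lT Γ L 3 :=
  (PEv.of_le (c := 2) (by have := P.W_const; omega)).inp.congr P.x_two

end

section
variable {C : Ctx} {Γ : List ℕ}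

theorem Ctx.lt_of_le (C : Ctx) {v : ℕ} (h : v ≤ C.W) : v < 2 ^ C.W := h.trans_lt Nat.lt_two_pow_self

theorem Ctx.lt_of_lt_pow (C : Ctx) {v p : ℕ} (h : v < 2 ^ p) (hp : p ≤ C.W) : v < 2 ^ C.W :=
  h.trans_le (Nat.pow_le_pow_right (by norm_num) hp)

theorem PEv.twoPow {y : Tm} {b h : ℕ} (hy : PEv C y Γ b h) (hb : b < C.W) :
    PEv C (Tm.twoPow y) Γ (2 ^ b) (h + 9) := PEv.two_pow hy hb

theorem PEv.clmulT {w a b : Tm} {wv av bv h p : ℕ} (hw : PEv C w Γ wv h) (ha : PEv C a Γ av h)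
    (hb : PEv C b Γ bv h) (hav : av < 2 ^ p) (hp : p + wv < C.W) :
    PEv C (Tm.clmulT w a b) Γ (clmul wv av bv) (h + 30) := by
  refine (PEv.xorT (h := h + 22) hw (by omega) fun j hj Γ' hΓ i hi => ?_).weaken (by omega)
  have hpow := hi.twoPow (by omega)
  have h1 : av * 2 ^ j < 2 ^ (p + j) := by
    rw [pow_add]; exact Nat.mul_lt_mul_of_pos_right hav (by positivity)
  have h2 := C.lt_of_lt_pow h1 (by omega)
  have h3 : av * 2 ^ j * (bv / 2 ^ j % 2) ≤ av * 2 ^ j * 1 := Nat.mul_le_mul_left _ (by omega)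
  exact (((ha.mono hΓ).mul hpow h2).mul (((hb.mono hΓ).div hpow).mod
    (PEv.of_le (by have := C.le_W; omega))) (by omega)).weaken (by omega)

variable {n k L : ℕ} (P : Params C n k L)
include P

theorem Params.selT {a ρ v : Tm} {av ρv vv h : ℕ} (ha : PEv C a Γ av h) (hρ : PEv C ρ Γ ρv h)
    (hv : PEv C v Γ vv h) (hvn : vv ≤ n) :
    PEv C (Tm.selT a ρ v) Γ (if Sel n av ρv vv then 1 else 0) (h + 30) := by
  have h1 := P.W_const
  have h2 := P.W_coins
  have h3 : (n + 3) * vv ≤ (n + 3) * n := Nat.mul_le_mul_left _ hvn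
  have h4 : PEv C (Tm.add Tm.nT (.lit 3)) Γ (n + 3) 5 :=
    P.nT.add (PEv.of_le (by omega)) (C.lt_of_le (by omega))
  exact ((hρ.div (h4.mul hv (C.lt_of_le (by omega)) |>.twoPow (by omega))).mod
    (h4.twoPow (by omega)) |>.blt ha).weaken (by omega)

theorem Params.rnkT {a ρ v : Tm} {av ρv vv h : ℕ} (ha : PEv C a Γ av h) (hρ : PEv C ρ Γ ρv h)
    (hv : PEv C v Γ vv h) (hvn : vv ≤ n) (hh : 1 ≤ h) :
    PEv C (Tm.rnkT a ρ v) Γ (rnk (Sel n av ρv) vv) (h + 40) := by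
  have h1 := P.W_const
  refine (PEv.sumT (h := h + 32) hv (by omega) (C.lt_of_le ((rnk_le _ _).trans (by omega)))
    fun j hj Γ' hΓ i hi => ?_).weaken (by omega)
  exact ((P.selT (ha.mono hΓ) (hρ.mono hΓ) (hi.weaken hh) (by omega)).cond
    (fun _ => PEv.of_le (c := 0) (by omega)) (fun _ => PEv.of_le (c := 1) (by omega))).weaken (by omega)

theorem Params.memT {e u : Tm} {ev uv h : ℕ} (he : PEv C e Γ ev h) (hu : PEv C u Γ uv h)
    (hev : ev < L) (hh : 1 ≤ h) : PEv C (Tm.memT e u) Γ (memE C.x k ev uv) (h + 30) := by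
  have h1 := P.W_const
  have h2 := P.W_index
  have h3 : ev * k ≤ L * k := Nat.mul_le_mul_right _ hev.le
  refine (PEv.sumT (h := h + 20) P.kT (by omega) (C.lt_of_le ((memE_le _ _ _ _).trans (by omega)))
    fun j hj Γ' hΓ i hi => ?_).weaken (by omega)
  refine ((((PEv.of_le (c := 3) (by omega)).add ((he.mono hΓ).mul P.kT (C.lt_of_le (by omega)))
    (C.lt_of_le (by omega))).add hi (C.lt_of_le (by omega))).inp.beq (hu.mono hΓ)).weaken (by omega)

theorem Params.fitsT {a ρ y e i j : Tm} {av ρv yv ev iv jv h : ℕ} (ha : PEv C a Γ av h)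
    (hρ : PEv C ρ Γ ρv h) (hy : PEv C y Γ yv h) (he : PEv C e Γ ev h) (hi : PEv C i Γ iv h)
    (hj : PEv C j Γ jv h) (hev : ev < L) (hh : 1 ≤ h) :
    PEv C (Tm.fitsT a ρ y e i j) Γ
      (if Fits n (Sel n av ρv) (memE C.x k ev) yv iv jv then 1 else 0) (h + 90) := by
  have h1 := P.W_const
  refine (PEv.allT (h := h + 80) P.nT (by omega) fun u hu Γ' hΓ t ht => ?_).weaken (by omega)
  have ht' := ht.weaken hh
  have hs := P.selT (ha.mono hΓ) (hρ.mono hΓ) ht' hu.le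
  have hm := P.memT (he.mono hΓ) (hu := ht') hev hh
  have hr := P.rnkT (ha.mono hΓ) (hρ.mono hΓ) ht' hu.le hh
  have hrn := rnk_le (Sel n av ρv) u
  have hmk := memE_le C.x k ev u
  refine ((hs.cond (fun _ => hm) (fun _ => hm.mul (((hy.mono hΓ).div (hr.twoPow (by omega))).mod
    (PEv.of_le (by omega))) (C.lt_of_le ?_))).beq (hs.cond (fun _ => ((ht'.beq (hi.mono hΓ)).add
    (ht'.beq (hj.mono hΓ)) (C.lt_of_le ?_))) (fun _ => PEv.of_le (c := 0) (by omega)))).weaken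
    (by omega)
  · have : yv / 2 ^ rnk (Sel n av ρv) u % 2 ≤ 1 := by omega
    calc _ ≤ memE C.x k ev u * 1 := Nat.mul_le_mul_left _ this
      _ ≤ C.W := by omega
  · split_ifs <;> omega

theorem Params.wtT {ρ e i : Tm} {ρv ev iv h : ℕ} (hρ : PEv C ρ Γ ρv h) (he : PEv C e Γ ev h)
    (hi : PEv C i Γ iv h) (hev : ev < L) (hiv : iv < 2 * n) :
    PEv C (Tm.wtT ρ e i) Γ (wt n ρv ev iv) (h + 30) := by
  have h1 := P.W_const
  have h2 := P.W_coins
  have h3 : (n + 2) * (ev * (2 * n) + iv) ≤ (n + 2) * (L * (2 * n)) := by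
    refine Nat.mul_le_mul_left _ ?_
    calc ev * (2 * n) + iv ≤ (ev + 1) * (2 * n) := by rw [add_mul]; omega
      _ ≤ L * (2 * n) := Nat.mul_le_mul_right _ hev
  have h4 : ev * (2 * n) + iv ≤ (n + 2) * (ev * (2 * n) + iv) := Nat.le_mul_of_pos_left _ (by omega)
  have hn3 : PEv C (Tm.add Tm.nT (.lit 3)) Γ (n + 3) 5 :=
    P.nT.add (PEv.of_le (by omega)) (C.lt_of_le (by omega))
  have hn2 : PEv C (Tm.add Tm.nT (.lit 2)) Γ (n + 2) 5 :=
    P.nT.add (PEv.of_le (by omega)) (C.lt_of_le (by omega))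
  have h2n : PEv C (Tm.mul (.lit 2) Tm.nT) Γ (2 * n) 5 :=
    (PEv.of_le (by omega)).mul P.nT (C.lt_of_lt_pow (p := n + 1)
      (by rw [pow_succ']; exact Nat.mul_lt_mul_of_pos_left Nat.lt_two_pow_self (by norm_num))
      (by omega))
  refine ((hρ.div (((hn3.mul P.nT (C.lt_of_le (by omega))).add (hn2.mul
    ((he.mul h2n (C.lt_of_le (by omega))).add hi (C.lt_of_le (by omega)))
    (C.lt_of_le (by omega))) (C.lt_of_le (by omega))).twoPow (by omega))).mod
    (hn2.twoPow (by omega))).weaken (by omega)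

theorem Params.actT {a ρ i : Tm} {av ρv iv h : ℕ} (ha : PEv C a Γ av h)
    (hρ : PEv C ρ Γ ρv h) (hi : PEv C i Γ iv h) :
    PEv C (Tm.actT a ρ i) Γ (if Act n (Sel n av ρv) iv then 1 else 0) (h + 40) := by
  refine (((hi.blt P.nT).cond (v := if Sel n av ρv iv then 1 else 0) (w := 1)
    (fun h => P.selT ha hρ hi h.le)
    (fun _ => PEv.of_le (by have := P.W_const; omega))).congr ?_).weaken (by omega)
  unfold Act
  by_cases h : iv < n <;> simp [h]

theorem Params.entT {a ρ y i j : Tm} {av ρv yv iv jv h : ℕ} (ha : PEv C a Γ av h)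
    (hρ : PEv C ρ Γ ρv h) (hy : PEv C y Γ yv h) (hi : PEv C i Γ iv h)
    (hj : PEv C j Γ jv h) (hin : iv < 2 * n) (hjn : jv < 2 * n) (hh : 1 ≤ h) :
    PEv C (Tm.entT a ρ y i j) Γ (ent C.x n k L av ρv yv iv jv) (h + 120) := by
  have h1 := P.W_const
  have h2 := P.W_table
  have h0 : ∀ {Γ}, PEv C (.lit 0) Γ 0 1 := PEv.of_le (by omega)
  have hai := P.actT ha hρ hi
  have haj := P.actT ha hρ hj
  refine ((hi.beq hj).cond (fun _ => hai.cond (fun _ => h0) (fun _ => PEv.of_le (by omega)))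
    (fun _ => hai.cond (fun _ => haj.cond (fun _ => PEv.xorT (h := h + 95) P.lT (by omega)
      (fun e he Γ' hΓ t ht => ?_)) (fun _ => h0)) (fun _ => h0))).weaken (by omega)
  have hn2 : PEv C (Tm.add Tm.nT (.lit 2)) Γ' (n + 2) 5 :=
    P.nT.add (PEv.of_le (by omega)) (C.lt_of_le (by omega))
  have ht' := ht.weaken hh
  refine ((P.fitsT (ha.mono hΓ) (hρ.mono hΓ) (hy.mono hΓ) ht' (hi.mono hΓ) (hj.mono hΓ) he hh).cond
    (fun _ => PEv.clmulT (h := h + 30) (p := n + 2) (hn2.weaken (by omega))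
      (P.wtT (hρ.mono hΓ) ht' (hi.mono hΓ) he hin)
      (P.wtT (hρ.mono hΓ) ht' (hj.mono hΓ) he hjn) (Nat.mod_lt _ (by positivity)) (by omega))
    (fun _ => h0)).weaken (by omega)

/-- Here `2 ≤ k` is needed. The bound justifies reserving `2 * n` weights for every edge. -/
theorem Params.dim_le {D : ℕ} : n + 2 * (n / k) - D ≤ 2 * n := by
  have h1 : n / k ≤ n / 2 := Nat.div_le_div_left P.two_le (by norm_num)
  omega

theorem Params.dimT {D : Tm} {Dv h : ℕ} (hD : PEv C D Γ Dv h) :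
    PEv C (Tm.dimT D) Γ (n + 2 * (n / k) - Dv) (h + 11) := by
  have h1 := P.W_const
  have h2 := P.dim_le (D := 0)
  have h3 : 2 * n < 2 ^ C.W := C.lt_of_lt_pow (p := n + 1)
      (by rw [pow_succ']; exact Nat.mul_lt_mul_of_pos_left Nat.lt_two_pow_self (by norm_num))
      (by omega)
  exact ((P.nT.add ((PEv.of_le (c := 2) (by omega)).mul (P.nT.div P.kT) (by omega))
    (by omega)).sub hD).weaken (by omega)

theorem Params.widthT : PEv C Tm.widthT Γ (2 * n + 4) 7 := by
  have h1 := P.W_const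
  have h2 := P.W_table
  exact ((PEv.of_le (c := 2) (by omega)).mul P.nT (C.lt_of_le (by omega))).add
    (PEv.of_le (by omega)) (C.lt_of_le (by omega))

theorem Params.baseT {D : Tm} {Dv h : ℕ} (hD : PEv C D Γ Dv h) :
    PEv C (Tm.baseT D) Γ (2 ^ ((n + 2 * (n / k) - Dv) * (2 * n + 4))) (h + 22) := by
  have h1 : (n + 2 * (n / k) - Dv) * (2 * n + 4) ≤ 2 * n * (2 * n + 4) :=
    Nat.mul_le_mul_right _ P.dim_le
  have h2 := P.W_table
  exact ((P.dimT hD).mul P.widthT (C.lt_of_le (by omega)) |>.twoPow (by omega)).weaken (by omega)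

theorem Params.basePow {D s : Tm} {Dv sv h : ℕ} (hD : PEv C D Γ Dv h) (hs : PEv C s Γ sv h)
    (hsv : sv ≤ 2 * n * (2 * n)) :
    PEv C (Tm.powT (Tm.baseT D) s) Γ ((2 ^ ((n + 2 * (n / k) - Dv) * (2 * n + 4))) ^ sv) (h + 30) := by
  have h1 : (n + 2 * (n / k) - Dv) * (2 * n + 4) ≤ 2 * n * (2 * n + 4) :=
    Nat.mul_le_mul_right _ P.dim_le
  have h3 : (n + 2 * (n / k) - Dv) * (2 * n + 4) * sv ≤ 2 * n * (2 * n + 4) * (2 * n * (2 * n)) :=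
    Nat.mul_le_mul h1 hsv
  have h4 : sv ≤ 2 * n * (2 * n + 4) * (2 * n * (2 * n)) := by
    rcases Nat.eq_zero_or_pos n with rfl | hn
    · simp at hsv; omega
    · exact hsv.trans (Nat.le_mul_of_pos_left _ (by positivity))
  have h2 := P.W_table
  refine ((P.baseT hD).powT hs (by positivity) (by omega) ?_).weaken (by omega)
  rw [← pow_mul]
  exact Nat.pow_lt_pow_right (by norm_num) (by omega)

theorem Params.tableT {D : Tm} {f : Tm → Tm → Tm} {F : ℕ → ℕ → ℕ} {Dv h h' : ℕ}
    (hD : PEv C D Γ Dv h) (hh : 1 ≤ h)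
    (hF : ∀ i j, i < n + 2 * (n / k) - Dv → j < n + 2 * (n / k) - Dv →
      F i j < 2 ^ ((n + 2 * (n / k) - Dv) * (2 * n + 4)))
    (hf : ∀ iv jv, iv < n + 2 * (n / k) - Dv → jv < n + 2 * (n / k) - Dv → ∀ Γ', Γ <+: Γ' →
      ∀ i j, PEv C i Γ' iv 1 → PEv C j Γ' jv 1 → PEv C (f i j) Γ' (F iv jv) h') :
    PEv C (Tm.tableT D f) Γ (pack (2 ^ ((n + 2 * (n / k) - Dv) * (2 * n + 4)))
      ((n + 2 * (n / k) - Dv) * (n + 2 * (n / k) - Dv)) fun s =>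
        F (s / (n + 2 * (n / k) - Dv)) (s % (n + 2 * (n / k) - Dv))) (max h h' + 50) := by
  have hdim {Γ'} (hΓ : Γ <+: Γ') := P.dimT (hD.mono hΓ)
  have hpow {Γ' s sv} (hΓ : Γ <+: Γ') := P.basePow (s := s) (sv := sv) (hD.mono hΓ)
  have hle : n + 2 * (n / k) - Dv ≤ 2 * n := P.dim_le
  generalize n + 2 * (n / k) - Dv = M at *
  have h2 := P.W_table
  have hMM : M * M ≤ 2 * n * (2 * n) := Nat.mul_le_mul hle hle
  have hMM' : M * M ≤ C.W := by
    rcases Nat.eq_zero_or_pos n with rfl | hn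
    · obtain rfl : M = 0 := by simpa using hle
      simp
    · have : 2 * n * (2 * n) ≤ 2 * n * (2 * n + 4) * (2 * n * (2 * n)) :=
        Nat.le_mul_of_pos_left _ (by positivity)
      omega
  have hb : M * (2 * n + 4) * (M * M) ≤ 2 * n * (2 * n + 4) * (2 * n * (2 * n)) :=
    Nat.mul_le_mul (Nat.mul_le_mul_right _ hle) hMM
  have hF' : ∀ s < M * M, F (s / M) (s % M) < 2 ^ (M * (2 * n + 4)) := fun s hs =>
    hF _ _ (Nat.div_lt_of_lt_mul hs) (Nat.mod_lt _ (by by_contra h; simp_all))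
  -- The partial tables are bounded too, since each summand is added to a partial table during the
  -- computation.
  have hpk : ∀ N ≤ M * M, pack (2 ^ (M * (2 * n + 4))) N (fun s => F (s / M) (s % M)) < 2 ^ C.W := by
    intro N hN
    refine (pack_lt fun s hs => hF' s (by omega)).trans_le ?_
    rw [← pow_mul]
    refine Nat.pow_le_pow_right (by norm_num) ?_
    have := Nat.mul_le_mul_left (M * (2 * n + 4)) hN
    omega
  have hd0 := hdim List.prefix_rfl
  refine (PEv.sumT (h := max h h' + 40) (hd0.mul hd0 (C.lt_of_le hMM')) hMM' (hpk _ le_rfl)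
    fun s hs Γ' hΓ t ht => ?_).weaken (by omega)
  have hM0 : 0 < M := by by_contra h; simp_all
  refine (PEv.letT ((ht.weaken hh).div (hdim hΓ)) fun Γ₁ hΓ₁ i hi =>
    PEv.letT (((ht.mono hΓ₁).weaken hh).mod (hdim (hΓ.trans hΓ₁))) fun Γ₂ hΓ₂ j hj =>
    (hf _ _ (Nat.div_lt_of_lt_mul hs) (Nat.mod_lt s hM0) Γ₂ ((hΓ.trans hΓ₁).trans hΓ₂) i j
      (hi.mono hΓ₂) hj).mul (hpow ((hΓ.trans hΓ₁).trans hΓ₂)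
        (((ht.mono hΓ₁).mono hΓ₂).weaken hh) (by omega)) ?_).weaken (by omega)
  have := hpk (s + 1) (by omega)
  rw [pack, Finset.sum_range_succ] at this
  omega

theorem Params.entryT {D X i j : Tm} {F : ℕ → ℕ → ℕ} {Dv iv jv h : ℕ}
    (hD : PEv C D Γ Dv h)
    (hX : PEv C X Γ (pack (2 ^ ((n + 2 * (n / k) - Dv) * (2 * n + 4)))
      ((n + 2 * (n / k) - Dv) * (n + 2 * (n / k) - Dv)) fun s =>
        F (s / (n + 2 * (n / k) - Dv)) (s % (n + 2 * (n / k) - Dv))) h)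
    (hF : ∀ i j, i < n + 2 * (n / k) - Dv → j < n + 2 * (n / k) - Dv →
      F i j < 2 ^ ((n + 2 * (n / k) - Dv) * (2 * n + 4)))
    (hi : PEv C i Γ iv h) (hj : PEv C j Γ jv h) (hiv : iv < n + 2 * (n / k) - Dv)
    (hjv : jv < n + 2 * (n / k) - Dv) :
    PEv C (Tm.entryT D X i j) Γ (F iv jv) (h + 60) := by
  have hdim := P.dimT hD
  have hpow {s sv} := P.basePow (s := s) (sv := sv) (hD.weaken (show h ≤ h + 20 by omega))
  have hbase := P.baseT hD
  have hle : n + 2 * (n / k) - Dv ≤ 2 * n := P.dim_le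
  generalize n + 2 * (n / k) - Dv = M at *
  have hM0 : 0 < M := by omega
  have h2 := P.W_table
  have hMM : M * M ≤ 2 * n * (2 * n) := Nat.mul_le_mul hle hle
  have hidx : iv * M + jv < M * M := by
    calc iv * M + jv < (iv + 1) * M := by rw [add_mul]; omega
      _ ≤ M * M := Nat.mul_le_mul_right _ hiv
  have hW : iv * M + jv ≤ C.W := by
    have : 2 * n * (2 * n) ≤ 2 * n * (2 * n + 4) * (2 * n * (2 * n)) :=
      Nat.le_mul_of_pos_left _ (Nat.mul_pos (by omega) (by omega))
    omega
  refine ((hX.div (hpow (((hi.mul hdim (C.lt_of_le (by omega))).add hj (C.lt_of_le hW)).weaken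
    (by omega)) (by omega))).mod hbase |>.congr ?_).weaken (by omega)
  rw [pack_digit (fun s hs => hF _ _ (Nat.div_lt_of_lt_mul hs) (Nat.mod_lt _ hM0)) hidx]
  congr 1
  · rw [mul_comm, Nat.mul_add_div hM0, Nat.div_eq_of_lt hjv, add_zero]
  · rw [mul_comm, Nat.mul_add_mod, Nat.mod_eq_of_lt hjv]

theorem Params.birdT {a ρ D y : Tm} {av ρv Dv yv : ℕ} (ha : PEv C a Γ av 1)
    (hρ : PEv C ρ Γ ρv 1) (hD : PEv C D Γ Dv 1) (hy : PEv C y Γ yv 1)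
    (hM : 0 < n + 2 * (n / k) - Dv) :
    PEv C (Tm.birdT a ρ D y) Γ (birdN (2 * n + 4) (n + 2 * (n / k) - Dv)
      (ent C.x n k L av ρv yv) (n + 2 * (n / k) - Dv - 1) 0 0) 500 := by
  have hA : ∀ i j, ent C.x n k L av ρv yv i j < 2 ^ (2 * n + 4) := ent_lt _ _ _ _ _ _ _
  -- Step `t` has entries of `(t + 1) * (2 * n + 4)` bits, so a single base with one width per
  -- dimension serves for all tables up to the last step.
  have hlt : ∀ t, t < n + 2 * (n / k) - Dv → ∀ i j, birdN (2 * n + 4) (n + 2 * (n / k) - Dv)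
      (ent C.x n k L av ρv yv) t i j < 2 ^ ((n + 2 * (n / k) - Dv) * (2 * n + 4)) :=
    fun t ht i j => (birdN_lt hA t i j).trans_le
      (Nat.pow_le_pow_right (by norm_num) (Nat.mul_le_mul_right _ ht))
  have h0 : ∀ {Γ}, PEv C (.lit 0) Γ 0 1 := PEv.of_le (Nat.zero_le _)
  have h1 := P.W_const
  have h2 := P.W_table
  have hle : n + 2 * (n / k) - Dv ≤ 2 * n := P.dim_le
  have hw : (n + 2 * (n / k) - Dv) * (2 * n + 4) ≤ 2 * n * (2 * n + 4) := Nat.mul_le_mul_right _ hle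
  refine (P.entryT (h := 420) (F := birdN (2 * n + 4) (n + 2 * (n / k) - Dv)
      (ent C.x n k L av ρv yv) (n + 2 * (n / k) - Dv - 1)) (hD.weaken (by norm_num)) ?_
      (fun i j _ _ => hlt _ (by omega) i j) (h0.weaken (by norm_num)) (h0.weaken (by norm_num))
      hM hM).weaken (by norm_num)
  refine (PEv.foldT (h₁ := 20) (h₂ := 200) (h₃ := 400) (F := fun t =>
    pack (2 ^ ((n + 2 * (n / k) - Dv) * (2 * n + 4)))
      ((n + 2 * (n / k) - Dv) * (n + 2 * (n / k) - Dv)) fun s =>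
        birdN (2 * n + 4) (n + 2 * (n / k) - Dv) (ent C.x n k L av ρv yv) t
          (s / (n + 2 * (n / k) - Dv)) (s % (n + 2 * (n / k) - Dv)))
    (((P.dimT hD).sub (PEv.of_le (c := 1) (by omega))).weaken (by norm_num)) ?_ (by omega) ?_).weaken
    (by norm_num)
  · refine (P.tableT (h' := 121) hD le_rfl (fun i j _ _ => hlt 0 hM i j) ?_).weaken (by norm_num)
    intro iv jv hi hj Γ' hΓ i j hi' hj'
    exact P.entT (ha.mono hΓ) (hρ.mono hΓ) (hy.mono hΓ) hi' hj' (by omega) (by omega) le_rfl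
  · intro t ht Γ' hΓ s X _ hX
    refine (P.tableT (h' := 250) (hD.mono hΓ) le_rfl (fun i j _ _ => hlt (t + 1) (by omega) i j)
      ?_).weaken (by norm_num)
    intro iv jv hi hj Γ₁ hΓ₁ i j hi' hj'
    refine (PEv.xorT (h := 200) (P.dimT ((hD.mono hΓ).mono hΓ₁)) (by omega) (fun l hl Γ₂ hΓ₂ u hu => ?_)).weaken
      (by norm_num)
    have hΓ' := hΓ.trans (hΓ₁.trans hΓ₂)
    have hX' := hX.mono (hΓ₁.trans hΓ₂)
    have hi₂ := hi'.mono hΓ₂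
    have hj₂ := hj'.mono hΓ₂
    have e1 := P.entryT (hD.mono hΓ') hX' (fun i j _ _ => hlt t (by omega) i j) hi₂ hu hi hl
    have e2 := P.entryT (hD.mono hΓ') hX' (fun i j _ _ => hlt t (by omega) i j) hu hu hl hl
    have e3 := P.entT (ha.mono hΓ') (hρ.mono hΓ') (hy.mono hΓ') hu hj₂ (by omega) (by omega) le_rfl
    have e4 := P.entT (ha.mono hΓ') (hρ.mono hΓ') (hy.mono hΓ') hi₂ hj₂ (by omega) (by omega) le_rfl
    have hlt' : ∀ i j, birdN (2 * n + 4) (n + 2 * (n / k) - Dv) (ent C.x n k L av ρv yv) t i j <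
      2 ^ ((n + 2 * (n / k) - Dv) * (2 * n + 4)) := hlt t (by omega)
    refine ((hi₂.blt hu).cond (fun _ => PEv.xor
      (PEv.clmulT (h := 121) (P.widthT.weaken (by norm_num)) (e1.weaken (by norm_num)) e3
        (hlt' _ _) (by omega))
      (PEv.clmulT (h := 121) (P.widthT.weaken (by norm_num)) (e2.weaken (by norm_num)) e4
        (hlt' _ _) (by omega))) (fun _ => h0)).weaken (by norm_num)

end

set_option exponentiation.threshold 600

/-! ### The parameters of the algorithm -/

/-- Vertices are selected with probability `numer k / denom k`. -/
def numer (k : ℕ) : ℕ := 3 + 8 * if k = 3 then 1 else 0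

/-- The probability is 3/(2k), except that it is 11/20 for k = 3. There 3/(2k) = 1/2 would only give
a base of about 1.499. -/
def denom (k : ℕ) : ℕ := 2 * k + 14 * if k = 3 then 1 else 0

theorem numer_pos (k : ℕ) : 0 < numer k := by unfold numer; omega

theorem numer_le (k : ℕ) : numer k ≤ 11 := by unfold numer; split_ifs <;> omega

theorem denom_le (k : ℕ) : denom k ≤ 2 * k + 14 := by unfold denom; split_ifs <;> omega

theorem numer_lt_denom {k : ℕ} (hk : 2 ≤ k) : numer k < denom k := by
  unfold numer denom; split_ifs <;> omega

/-- The weight of the subsets with at most two elements of a `k`-element set, where a set with `j`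
elements has weight `(2 * numer k) ^ j * (denom k - numer k) ^ (k - j)`. -/
def smallWeight (k : ℕ) : ℕ :=
  (denom k - numer k) ^ k + 2 * k * numer k * (denom k - numer k) ^ (k - 1) +
    2 * k * (k - 1) * (numer k * numer k) * (denom k - numer k) ^ (k - 2)

theorem smallWeight_eq (k : ℕ) : smallWeight k = ∑ j ∈ Finset.range 3,
    (2 * numer k) ^ j * (denom k - numer k) ^ (k - j) * k.choose j := by
  have h : 2 * k.choose 2 = k * (k - 1) := by
    rw [Nat.choose_two_right, Nat.mul_div_cancel' (Nat.even_mul_pred_self k).two_dvd]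
  rw [Finset.sum_range_succ, Finset.sum_range_succ, Finset.sum_range_one, smallWeight]
  simp only [pow_zero, Nat.sub_zero, Nat.choose_zero_right, pow_one, Nat.choose_one_right]
  rw [show (2 * numer k) ^ 2 * (denom k - numer k) ^ (k - 2) * k.choose 2 =
    2 * (numer k * numer k) * (denom k - numer k) ^ (k - 2) * (2 * k.choose 2) by ring, h]
  ring

/-- Completing the sum to all subsets gives `(numer k + denom k) ^ k` by the binomial theorem. -/
theorem smallWeight_le {k : ℕ} (hk : 2 ≤ k) : smallWeight k ≤ (2 * denom k) ^ k := by
  rw [smallWeight_eq k]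
  calc _ ≤ ∑ j ∈ Finset.range (k + 1),
      (2 * numer k) ^ j * (denom k - numer k) ^ (k - j) * k.choose j :=
        Finset.sum_le_sum_of_subset (Finset.range_mono (by omega))
    _ = (2 * numer k + (denom k - numer k)) ^ k := (add_pow _ _ _).symm
    _ ≤ (2 * denom k) ^ k := Nat.pow_le_pow_left (by have := numer_lt_denom hk; omega) _

theorem smallWeight_pos {k : ℕ} (hk : 2 ≤ k) : 0 < smallWeight k := by
  have : 0 < (denom k - numer k) ^ k := Nat.pow_pos (by have := numer_lt_denom hk; omega)
  unfold smallWeight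
  omega

/-- The threshold for the selection of vertices. -/
def thresh (n k : ℕ) : ℕ := numer k * 2 ^ (n + 3) / denom k

/-- The number of trials with selected sets of size `D`. -/
def reps (n k D : ℕ) : ℕ := (4 * n + 1) * 2 ^ D * denom k ^ n / smallWeight k ^ (n / k)

/-- A bound for the number of determinants that are computed. -/
def work (n k : ℕ) : ℕ := (4 * n + 1) * 2 ^ n * denom k ^ n / smallWeight k ^ (n / k)

/-- The factor `2 ^ D` in the number of trials balances the `2 ^ (n - D)` determinants of a trial,
so the bound does not depend on `D`. -/
theorem reps_mul_le {n k D : ℕ} (hk : 2 ≤ k) (hD : D ≤ n) :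
    reps n k D * 2 ^ (n - D) ≤ work n k := by
  have hg : 0 < smallWeight k ^ (n / k) := Nat.pow_pos (smallWeight_pos hk)
  rw [work, Nat.le_div_iff_mul_le hg]
  calc reps n k D * 2 ^ (n - D) * smallWeight k ^ (n / k)
      = reps n k D * smallWeight k ^ (n / k) * 2 ^ (n - D) := by ring
    _ ≤ (4 * n + 1) * 2 ^ D * denom k ^ n * 2 ^ (n - D) :=
        Nat.mul_le_mul_right _ (Nat.div_mul_le_self _ _)
    _ = (4 * n + 1) * (2 ^ D * 2 ^ (n - D)) * denom k ^ n := by ring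
    _ = (4 * n + 1) * 2 ^ n * denom k ^ n := by rw [← pow_add, Nat.add_sub_cancel' hD]

/-- The number shown by `N` coins, after `fl` coins have been flipped. -/
def coinVal (r : ℕ → Bool) (fl N : ℕ) : ℕ := ∑ i ∈ Finset.range N, (r (fl + i)).toNat * 2 ^ i

theorem coinVal_lt (r : ℕ → Bool) (fl N : ℕ) : coinVal r fl N < 2 ^ N :=
  pack_lt (b := 2) fun _ _ => Bool.toNat_lt _

/-- The number of coins for a trial. -/
def coinsPerTrial (n L : ℕ) : ℕ := (n + 3) * n + (n + 2) * (L * (2 * n))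

/-- The number of coins flipped before the trials with parameter `D`. -/
def coinsBefore (n k L D : ℕ) : ℕ := ∑ D' ∈ Finset.range D, reps n k D' * coinsPerTrial n L

/-- Trial number `i` with parameter `D` is successful. -/
def Hit (r : ℕ → Bool) (x : List ℕ) (n k L D i : ℕ) : Prop :=
  trial x n k L (thresh n k) D
    (coinVal r (coinsBefore n k L D + i * coinsPerTrial n L) (coinsPerTrial n L)) ≠ 0

/-- Some trial is successful. -/
def SomeHit (r : ℕ → Bool) (x : List ℕ) (n k L : ℕ) : Prop :=
  n % k = 0 ∧ 0 < n ∧ ∃ D < 2 * (n / k) + 1, ∃ i < reps n k D, Hit r x n k L D i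

/-! ### The main program -/

namespace Tm

def numerT : Tm := add (lit 3) (mul (lit 8) (op .eq kT (lit 3)))

def denomT : Tm := add (mul (lit 2) kT) (mul (lit 14) (op .eq kT (lit 3)))

def smallWeightT : Tm :=
  add (add (powT (sub denomT numerT) kT)
    (mul (mul (mul (lit 2) kT) numerT) (powT (sub denomT numerT) (sub kT (lit 1)))))
    (mul (mul (mul (mul (lit 2) kT) (sub kT (lit 1))) (mul numerT numerT))
      (powT (sub denomT numerT) (sub kT (lit 2))))

def threshT : Tm := div (mul numerT (twoPow (add nT (lit 3)))) denomT

def repsT (D : Tm) : Tm :=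
  div (mul (mul (add (mul (lit 4) nT) (lit 1)) (twoPow D)) (powT denomT nT))
    (powT smallWeightT (div nT kT))

def coinsT : Tm :=
  foldT (add (mul (add nT (lit 3)) nT) (mul (add nT (lit 2)) (mul lT (mul (lit 2) nT)))) (lit 0)
    fun i a => add a (mul coin (twoPow i))

def trialT (a D ρ : Tm) : Tm :=
  ifT (op .eq (sub nT (rnkT a ρ nT)) D)
    (foldT (twoPow (sub nT D)) (lit 0) fun y c => op .xor c (birdT a ρ D y)) (lit 0)

/-- A size not divisible by `k` is rejected at once. For `n = 0` the answer is "No" although the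
empty cover exists; the permitted error probability is then 1. -/
def mainT : Tm :=
  ifT (op .lt (mod nT kT) (op .lt (lit 0) nT))
    (letT threshT fun a => foldT (add (mul (lit 2) (div nT kT)) (lit 1)) (lit 0) fun D b =>
      foldT (repsT D) b fun _ c => letT coinsT fun ρ => ifT (trialT a D ρ) (lit 1) c) (lit 0)

end Tm

/-- For loops of exponential length: the factor `Q` bounds the total work of the loop and enters
only once, while all overheads go into the power of `W`. -/
theorem fold_bound {C : Ctx} {S₁ S₂ N S Q h : ℕ} (hQ : 1 ≤ Q) (h₁ : S₁ ≤ C.W ^ h)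
    (h₂ : S₂ ≤ C.W ^ h) (h₃ : N * S ≤ Q * C.W ^ h) (hN : N ≤ Q) :
    S₁ + S₂ + N * (S + 3) + 3 ≤ Q * C.W ^ (h + 2) := by
  have h1 := C.step_bound h 3 6 (by norm_num) (by norm_num)
  calc S₁ + S₂ + N * (S + 3) + 3 = S₁ + S₂ + N * S + N * 3 + 3 := by ring
    _ ≤ 1 * C.W ^ h + 1 * C.W ^ h + Q * C.W ^ h + Q * 3 + 1 * 3 := by omega
    _ ≤ Q * C.W ^ h + Q * C.W ^ h + Q * C.W ^ h + Q * 3 + Q * 3 := by gcongr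
    _ = Q * (3 * C.W ^ h + 6) := by ring
    _ ≤ Q * C.W ^ (h + 2) := Nat.mul_le_mul_left _ h1

/-! ### Evaluation and cost of the main program -/

section
variable {C : Ctx} {n k L : ℕ} (P : Params C n k L) {Γ : List ℕ}
include P

theorem Params.numerT : PEv C Tm.numerT Γ (numer k) 9 := by
  have h1 := P.W_const
  have h3 : PEv C (Tm.op .eq Tm.kT (.lit 3)) Γ (if k = 3 then 1 else 0) 5 :=
    P.kT.beq (PEv.of_le (by omega))
  have h4 : (if k = 3 then 1 else 0) ≤ 1 := by split_ifs <;> omega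
  exact (PEv.of_le (by omega)).add ((PEv.of_le (by omega)).mul h3 (C.lt_of_le (by omega)))
    (C.lt_of_le (by omega))

theorem Params.denomT : PEv C Tm.denomT Γ (denom k) 9 := by
  have h1 := P.W_const
  have h2 := P.W_reps
  have h3 : PEv C (Tm.op .eq Tm.kT (.lit 3)) Γ (if k = 3 then 1 else 0) 5 :=
    P.kT.beq (PEv.of_le (by omega))
  have h4 : (if k = 3 then 1 else 0) ≤ 1 := by split_ifs <;> omega
  have h5 : 2 * k ≤ 300 * k * k := by nlinarith [P.two_le]
  exact ((PEv.of_le (by omega)).mul P.kT (C.lt_of_le (by omega))).add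
    ((PEv.of_le (by omega)).mul h3 (C.lt_of_le (by omega))) (C.lt_of_le (by omega))

/-- The exponent `n + k` covers the powers of `denom k` in `reps` as well as the k-th powers in
`smallWeight`. -/
theorem Params.pow_denom_lt {e : ℕ} (he : e ≤ n + k) : (2 * denom k) ^ e < 2 ^ C.W := by
  have h1 := P.W_reps
  calc (2 * denom k) ^ e ≤ (2 ^ (4 * k + 28)) ^ e := Nat.pow_le_pow_left
        (by have := denom_le k; exact (show 2 * denom k ≤ 4 * k + 28 by omega).trans
              Nat.lt_two_pow_self.le) _
    _ = 2 ^ ((4 * k + 28) * e) := by rw [pow_mul]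
    _ < 2 ^ C.W := Nat.pow_lt_pow_right (by norm_num)
        (by have := Nat.mul_le_mul_left (4 * k + 28) he; omega)

theorem Params.smallWeightT : PEv C Tm.smallWeightT Γ (smallWeight k) 40 := by
  have h1 := P.W_const
  have h2 := P.W_reps
  have hk := P.two_le
  have hk2 : ∀ {Γ}, PEv C (Tm.mul (.lit 2) Tm.kT) Γ (2 * k) 5 :=
    (PEv.of_le (by omega)).mul P.kT (C.lt_of_le (by nlinarith))
  have hlt : smallWeight k < 2 ^ C.W :=
    (smallWeight_le hk).trans_lt (P.pow_denom_lt (by omega))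
  have hpos : 0 < denom k - numer k := by have := numer_lt_denom hk; omega
  have hpow : ∀ e ≤ k, (denom k - numer k) ^ e < 2 ^ C.W := fun e he =>
    (Nat.pow_le_pow_left (by omega) e).trans_lt (P.pow_denom_lt (e := e) (by omega))
  have hsub := P.denomT.sub P.numerT (Γ := Γ)
  have ha := numer_le k
  have haa : numer k * numer k ≤ 121 := Nat.mul_le_mul ha ha
  have hka : 2 * k * numer k ≤ 2 * k * 11 := Nat.mul_le_mul_left _ ha
  have hkk : 2 * k * (k - 1) ≤ 2 * k * k := Nat.mul_le_mul_left _ (by omega)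
  have hkaa : 2 * k * (k - 1) * (numer k * numer k) ≤ 2 * k * k * 121 := Nat.mul_le_mul hkk haa
  have hk3 : k ≤ k * k := Nat.le_mul_self k
  rw [smallWeight] at hlt
  exact (((hsub.powT P.kT hpos (by omega) (hpow _ le_rfl)).add
    (((hk2.mul P.numerT (C.lt_of_le (by nlinarith))).mul
      (hsub.powT (P.kT.sub (PEv.of_le (c := 1) (by omega))) hpos (by omega) (hpow _ (by omega)))
      (by omega))) (by omega)).add
    (((hk2.mul (P.kT.sub (PEv.of_le (c := 1) (by omega))) (C.lt_of_le (by nlinarith))).mul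
      (P.numerT.mul P.numerT (C.lt_of_le (by omega))) (C.lt_of_le (by nlinarith))).mul
      (hsub.powT (P.kT.sub (PEv.of_le (c := 2) (by omega))) hpos (by omega) (hpow _ (by omega)))
      (by omega)) hlt).weaken (by norm_num)

theorem Params.threshT : PEv C Tm.threshT Γ (thresh n k) 40 := by
  have h1 := P.W_const
  have ha := numer_le k
  have h3 : numer k * 2 ^ (n + 3) < 2 ^ (n + 7) := by
    calc numer k * 2 ^ (n + 3) < 2 ^ 4 * 2 ^ (n + 3) :=
          Nat.mul_lt_mul_of_pos_right (by omega) (by positivity)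
      _ = 2 ^ (n + 7) := by rw [← pow_add]; congr 1; omega
  exact ((P.numerT.mul ((P.nT.add (PEv.of_le (by omega)) (C.lt_of_le (by omega))).twoPow (by omega))
    (C.lt_of_lt_pow h3 (by omega))).div P.denomT).weaken (by norm_num)

theorem Params.repsT {D : Tm} {Dv : ℕ} (hD : PEv C D Γ Dv 1) (hDn : Dv ≤ n) :
    PEv C (Tm.repsT D) Γ (reps n k Dv) 70 := by
  have h1 := P.W_const
  have h2 := P.W_reps
  have hk := P.two_le
  have hd := denom_le k
  have hpow : denom k ^ n ≤ 2 ^ ((2 * k + 14) * n) := by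
    rw [pow_mul]
    exact Nat.pow_le_pow_left (hd.trans Nat.lt_two_pow_self.le) _
  have h4 : 4 * n + 1 < 2 ^ (4 * n + 1) := Nat.lt_two_pow_self
  have h5 : (4 * n + 1) * 2 ^ Dv < 2 ^ (4 * n + 1 + Dv) := by
    rw [pow_add]; exact Nat.mul_lt_mul_of_pos_right h4 (by positivity)
  have h6 : (4 * n + 1) * 2 ^ Dv * denom k ^ n < 2 ^ (4 * n + 1 + Dv + (2 * k + 14) * n) := by
    rw [pow_add]
    exact Nat.mul_lt_mul_of_lt_of_le h5 hpow (by positivity)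
  have h7 : (2 * k + 14) * n ≤ (4 * k + 28) * (n + k) :=
    Nat.mul_le_mul (by omega) (by omega)
  have h9 : smallWeight k ^ (n / k) < 2 ^ C.W := by
    refine (Nat.pow_le_pow_left (smallWeight_le hk) _).trans_lt ?_
    rw [← pow_mul]
    exact P.pow_denom_lt ((Nat.mul_div_le n k).trans (by omega))
  exact (((((PEv.of_le (by omega)).mul P.nT (C.lt_of_le (by omega))).add (PEv.of_le (by omega))
    (C.lt_of_le (by omega))).mul (hD.twoPow (by omega)) (C.lt_of_lt_pow h5 (by omega))).mul
    (P.denomT.powT P.nT (by have := numer_lt_denom hk; omega) (by omega)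
      (C.lt_of_lt_pow (Nat.pow_le_pow_left (show denom k ≤ 2 * denom k by omega) n |>.trans_lt
        (P.pow_denom_lt (by omega)) |>.trans_le le_rfl) le_rfl))
    (C.lt_of_lt_pow h6 (by omega))).div
    (P.smallWeightT.powT (P.nT.div P.kT) (smallWeight_pos hk)
      ((Nat.div_le_self _ _).trans (by omega)) h9) |>.weaken (by norm_num)

theorem Params.coinsT (fl : ℕ) : Ev C Tm.coinsT Γ fl (coinVal C.r fl (coinsPerTrial n L))
    (fl + coinsPerTrial n L) (C.W ^ 60) 60 := by
  have h1 := P.W_const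
  have h2 := P.W_coins
  have h3 := P.W_table
  have hn : PEv C (Tm.add (Tm.mul (Tm.add Tm.nT (.lit 3)) Tm.nT)
      (Tm.mul (Tm.add Tm.nT (.lit 2)) (Tm.mul Tm.lT (Tm.mul (.lit 2) Tm.nT)))) Γ
      (coinsPerTrial n L) 50 := by
    have h4 : L * (2 * n) ≤ (n + 2) * (L * (2 * n)) := Nat.le_mul_of_pos_left _ (by omega)
    exact (((P.nT.add (PEv.of_le (by omega)) (C.lt_of_le (by omega))).mul P.nT
      (C.lt_of_le (by omega))).add ((P.nT.add (PEv.of_le (by omega)) (C.lt_of_le (by omega))).mul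
      (P.lT.mul ((PEv.of_le (by omega)).mul P.nT (C.lt_of_le (by omega))) (C.lt_of_le (by omega)))
      (C.lt_of_le (by omega))) (C.lt_of_le (by omega))).weaken (by norm_num)
  have hle : coinsPerTrial n L + 5 ≤ C.W := by unfold coinsPerTrial; omega
  refine (Ev.foldT (F := fun N => coinVal C.r fl N) (fl := fun N => fl + N) (h := 50)
    (S := C.W ^ 50) (hn fl)
    ((PEv.of_le (c := 0) (by omega)).weaken (h' := 50) (by omega) fl)
    (fun j hj Γ' hΓ i a hi ha => ?_)).weaken ?_ (by norm_num)
  · have hb : (C.r (fl + j)).toNat * 2 ^ j < 2 ^ (j + 1) := by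
      rw [pow_succ']; exact Nat.mul_lt_mul_of_pos_right (Bool.toNat_lt _) (by positivity)
    have hs : coinVal C.r fl j + (C.r (fl + j)).toNat * 2 ^ j = coinVal C.r fl (j + 1) := by
      rw [coinVal, coinVal, Finset.sum_range_succ]
    have := Ev.op (C := C) (Γ := Γ') .add (ha.weaken (h' := 20) (by norm_num) (fl + j))
      (Ev.op .mul ((Ev.coin (fl + j)).weaken (h' := 18) le_rfl (by norm_num))
        ((hi.twoPow (by omega)).weaken (h' := 18) (by norm_num) (fl + j + 1))
        (C.lt_of_lt_pow hb (by omega)))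
      (by
        simp only [BinOp.eval]
        rw [hs]
        exact C.lt_of_lt_pow (coinVal_lt _ _ _) (by omega))
    simp only [BinOp.eval] at this
    rw [hs] at this
    refine this.weaken ?_ (by norm_num)
    have h4 : C.W ^ 18 ≤ C.W ^ 20 := Nat.pow_le_pow_right C.one_le_W (by norm_num)
    have h5 := C.step_bound 20 2 4 (by norm_num) (by norm_num)
    have h6 : C.W ^ (20 + 2) ≤ C.W ^ 50 := Nat.pow_le_pow_right C.one_le_W (by norm_num)
    omega
  · exact (C.fold_le 50 (by omega)).trans (Nat.pow_le_pow_right C.one_le_W (by norm_num))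

theorem Params.trialT {a D ρ : Tm} {av Dv ρv fl : ℕ} (ha : PEv C a Γ av 1) (hD : PEv C D Γ Dv 1)
    (hρ : PEv C ρ Γ ρv 1) (hDn : Dv ≤ n) (hM : 0 < n + 2 * (n / k) - Dv) :
    Ev C (Tm.trialT a D ρ) Γ fl (trial C.x n k L av Dv ρv) fl (2 ^ (n - Dv) * C.W ^ 510) 510 := by
  have h1 := P.W_const
  have hc := (P.nT.sub (P.rnkT (ha.weaken (h' := 3) (by norm_num)) (hρ.weaken (by norm_num)) P.nT
    le_rfl (by norm_num))).beq (hD.weaken (h' := 3) (by norm_num))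
  have h0 : PEv C (.lit 0) Γ 0 1 := PEv.of_le (Nat.zero_le _)
  have hone : 1 ≤ 2 ^ (n - Dv) := Nat.one_le_two_pow
  -- The only exponential factor in the cost of a trial is the length `2 ^ (n - Dv)` of this loop
  -- over all sets outside the selection.
  have hloop := Ev.foldT (F := fun N => xorSum N fun y =>
      birdN (2 * n + 4) (n + 2 * (n / k) - Dv) (ent C.x n k L av ρv y)
        (n + 2 * (n / k) - Dv - 1) 0 0) (fl := fun _ => fl)
    ((((P.nT (Γ := Γ)).sub hD).twoPow (by omega)).weaken (h' := 502) (by norm_num) fl)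
    (h0.weaken (h' := 502) (by norm_num) fl)
    (fun y _ Γ' hΓ i c hi hc => ((hc.xor (P.birdT (ha.mono hΓ) (hρ.mono hΓ) (hD.mono hΓ) hi
      hM)).weaken (h' := 502) (by norm_num) fl))
  have hb := fold_bound (C := C) (S₁ := C.W ^ 502) (S₂ := C.W ^ 502) (S := C.W ^ 502)
    (N := 2 ^ (n - Dv)) (Q := 2 ^ (n - Dv)) (h := 502) hone le_rfl le_rfl le_rfl le_rfl
  refine (Ev.ifT (S₁ := C.W ^ 506) (S₂ := 2 ^ (n - Dv) * C.W ^ 506) (h := 506)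
    (hc.weaken (h' := 506) (by norm_num) fl) (fun h => ?_) (fun h => ?_)).weaken ?_ (by norm_num)
  · have hp : n - rnk (Sel n av ρv) n = Dv := by by_contra hp; simp [hp] at h
    rw [trial, if_pos hp]
    exact hloop.weaken (hb.trans (Nat.mul_le_mul_left _
      (Nat.pow_le_pow_right C.one_le_W (by norm_num)))) (by norm_num)
  · have hp : ¬ n - rnk (Sel n av ρv) n = Dv := by intro hp; simp [hp] at h
    rw [trial, if_neg hp]
    exact (h0 fl).weaken (by
      have h2 : C.W ^ 1 ≤ C.W ^ 506 := Nat.pow_le_pow_right C.one_le_W (by norm_num)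
      have h3 := Nat.mul_le_mul_right (C.W ^ 506) hone
      omega) (by norm_num)
  · have h2 := C.step_bound 506 2 1 (by norm_num) (by norm_num)
    calc C.W ^ 506 + 2 ^ (n - Dv) * C.W ^ 506 + 1
        ≤ 2 ^ (n - Dv) * C.W ^ 506 + 2 ^ (n - Dv) * C.W ^ 506 + 2 ^ (n - Dv) * 1 := by
          gcongr
          · exact Nat.le_mul_of_pos_left _ hone
          · omega
      _ = 2 ^ (n - Dv) * (2 * C.W ^ 506 + 1) := by ring
      _ ≤ 2 ^ (n - Dv) * C.W ^ 510 := Nat.mul_le_mul_left _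
          (h2.trans (Nat.pow_le_pow_right C.one_le_W (by norm_num)))

open Classical in
theorem Params.mainT {w : ℕ} (hwork : n % k = 0 → work n k ≤ w) : Ev C Tm.mainT Γ 0 (if SomeHit C.r C.x n k L then 1 else 0)
    (if n % k = 0 ∧ 0 < n then coinsBefore n k L (2 * (n / k) + 1) else 0)
    ((w + 1) * C.W ^ 560) 560 := by
  have h1 := P.W_const
  have hk := P.two_le
  have h0 : ∀ {Γ}, PEv C (.lit 0) Γ 0 1 := PEv.of_le (Nat.zero_le _)
  have hlit1 : ∀ {Γ}, PEv C (.lit 1) Γ 1 1 := PEv.of_le C.one_le_W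
  have hm : 2 * (n / k) ≤ n := by
    have := Nat.div_le_div_left (a := n) hk (by norm_num)
    omega
  have hc := ((P.nT (Γ := Γ)).mod P.kT).blt (h0.blt P.nT)
  -- The inner comparison returns 0 or 1, so one comparison with the remainder tests both
  -- conditions.
  have hc' : n % k < (if 0 < n then 1 else 0) ↔ n % k = 0 ∧ 0 < n := by
    split_ifs <;> omega
  simp only [hc'] at hc
  have hQ : 1 ≤ w + 1 := by omega
  refine (Ev.ifT (S₁ := C.W ^ 550) (S₂ := (w + 1) * C.W ^ 550) (h := 550)
    (hc.weaken (h' := 550) (by norm_num) 0) (fun h => ?_) (fun h => ?_)).weaken ?_ (by norm_num)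
  · have hp : n % k = 0 ∧ 0 < n := by by_contra hp; simp [hp] at h
    rw [if_pos hp]
    refine (Ev.letT (S₁ := C.W ^ 540) (S₂ := (w + 1) * C.W ^ 540) (h := 546)
      (P.threshT.weaken (h' := 540) (by norm_num) 0 |>.weaken le_rfl (by norm_num))
      (v := if SomeHit C.r C.x n k L then 1 else 0)
      fun Γ₀ hΓ₀ a ha => ?_).weaken ?_ (by norm_num)
    · have hF : (if SomeHit C.r C.x n k L then 1 else 0) = if ∃ D < 2 * (n / k) + 1,
          ∃ i < reps n k D, Hit C.r C.x n k L D i then 1 else 0 := by simp [SomeHit, hp]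
      rw [hF]
      have hfold := Ev.foldT (C := C) (Γ := Γ₀) (S₁ := C.W ^ 520) (S₂ := C.W ^ 520)
        (S := (w + 1) * C.W ^ 520) (h := 530)
        (n := Tm.add (Tm.mul (.lit 2) (Tm.div Tm.nT Tm.kT)) (.lit 1)) (init := .lit 0)
        (body := fun D b => Tm.foldT (Tm.repsT D) b fun _ c => Tm.letT Tm.coinsT fun ρ =>
          Tm.ifT (Tm.trialT a D ρ) (.lit 1) c)
        (fl := fun D => coinsBefore n k L D) (N := 2 * (n / k) + 1)
        (F := fun N => if ∃ D < N, ∃ i < reps n k D, Hit C.r C.x n k L D i then 1 else 0)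
        (((((PEv.of_le (by omega)).mul (P.nT.div P.kT) (C.lt_of_le (by omega))).add hlit1
          (C.lt_of_le (by omega))).weaken (h' := 520) (by norm_num) _).weaken le_rfl (by norm_num))
        ((h0.congr (by simp)).weaken (h' := 520) (by norm_num) _ |>.weaken le_rfl (by norm_num))
        (fun D hD Γ₁ hΓ₁ Dt b hDt hb => ?_)
      · simp only [coinsBefore, Finset.sum_range_zero] at hfold ⊢
        refine hfold.weaken ?_ (by norm_num)
        have h3 := C.fold_le 520 (N := 2 * (n / k) + 1) (by omega)
        calc C.W ^ 520 + C.W ^ 520 + (2 * (n / k) + 1) * ((w + 1) * C.W ^ 520 + 3) + 3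
            ≤ (w + 1) * C.W ^ 520 + (w + 1) * C.W ^ 520 +
              (2 * (n / k) + 1) * ((w + 1) * C.W ^ 520 + (w + 1) * 3) +
              (w + 1) * 3 := by
              gcongr
              · exact Nat.le_mul_of_pos_left _ hQ
              · exact Nat.le_mul_of_pos_left _ hQ
              · omega
              · omega
          _ = (w + 1) * (C.W ^ 520 + C.W ^ 520 + (2 * (n / k) + 1) * (C.W ^ 520 + 3) + 3) := by
              ring
          _ ≤ (w + 1) * C.W ^ 540 := Nat.mul_le_mul_left _
              (h3.trans (Nat.pow_le_pow_right C.one_le_W (by norm_num)))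
      · have hDn : D ≤ n := by omega
        have hw := (reps_mul_le hk hDn).trans (hwork hp.1)
        have hM : 0 < n + 2 * (n / k) - D := by omega
        have hone : 1 ≤ 2 ^ (n - D) := Nat.one_le_two_pow
        have hr : reps n k D ≤ w := (Nat.le_mul_of_pos_right _ hone).trans hw
        have hfold := Ev.foldT (C := C) (Γ := Γ₁) (S₁ := C.W ^ 516) (S₂ := C.W ^ 516)
          (S := 2 ^ (n - D) * C.W ^ 516) (h := 520)
          (n := Tm.repsT Dt) (init := b)
          (body := fun _ c => Tm.letT Tm.coinsT fun ρ => Tm.ifT (Tm.trialT a Dt ρ) (.lit 1) c)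
          (fl := fun i => coinsBefore n k L D + i * coinsPerTrial n L) (N := reps n k D)
          -- The accumulator of the inner loop is the truth value of a success so far: for a smaller
          -- `D`, or among the first `N` trials for the present one.
          (F := fun N => if (∃ D' < D, ∃ i < reps n k D', Hit C.r C.x n k L D' i) ∨
            ∃ i < N, Hit C.r C.x n k L D i then 1 else 0)
          ((P.repsT hDt hDn).weaken (h' := 516) (by norm_num) _ |>.weaken le_rfl (by norm_num))
          ((hb.congr (by simp)).weaken (h' := 516) (by norm_num) _ |>.weaken le_rfl (by norm_num))
          (fun i hi Γ₂ hΓ₂ _ c _ hc => ?_)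
        · have hfl : coinsBefore n k L (D + 1) =
              coinsBefore n k L D + reps n k D * coinsPerTrial n L := by
            simp only [coinsBefore, Finset.sum_range_succ]
          have hF : (∃ D' < D + 1, ∃ i < reps n k D', Hit C.r C.x n k L D' i) ↔
              (∃ D' < D, ∃ i < reps n k D', Hit C.r C.x n k L D' i) ∨
                ∃ i < reps n k D, Hit C.r C.x n k L D i := by
            simp only [Nat.lt_succ_iff_lt_or_eq]
            constructor
            · rintro ⟨D', h | rfl, h'⟩
              exacts [Or.inl ⟨D', h, h'⟩, Or.inr h']
            · rintro (⟨D', h, h'⟩ | h)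
              exacts [⟨D', Or.inl h, h'⟩, ⟨D, Or.inr rfl, h⟩]
          simp only [hfl, hF]
          simp only [zero_mul, add_zero] at hfold
          refine hfold.weaken ((fold_bound hQ le_rfl le_rfl ?_ (by omega)).trans ?_) (by norm_num)
          · rw [← mul_assoc]
            exact Nat.mul_le_mul_right _ (by omega)
          · exact Nat.mul_le_mul_left _ (Nat.pow_le_pow_right C.one_le_W (by norm_num))
        · have hfl : coinsBefore n k L D + (i + 1) * coinsPerTrial n L =
              coinsBefore n k L D + i * coinsPerTrial n L + coinsPerTrial n L := by ring
          rw [hfl]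
          refine (Ev.letT (S₁ := C.W ^ 60) (S₂ := 2 ^ (n - D) * C.W ^ 512) (h := 512)
            ((P.coinsT _).weaken le_rfl (by norm_num)) fun Γ₃ hΓ₃ ρ hρ => ?_).weaken ?_
            (by norm_num)
          · have hΓ := hΓ₁.trans (hΓ₂.trans hΓ₃)
            refine (Ev.ifT (S₁ := 2 ^ (n - D) * C.W ^ 510) (S₂ := C.W ^ 510) (h := 510)
              (P.trialT (ha.mono hΓ) (hDt.mono (hΓ₂.trans hΓ₃)) hρ hDn hM)
              (fun h => ?_) (fun h => ?_)).weaken ?_ (by norm_num)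
            · have hit : Hit C.r C.x n k L D i := h
              refine ((hlit1.congr ?_).weaken (by norm_num) _)
              rw [if_pos]
              exact Or.inr ⟨i, by omega, hit⟩
            · have hit : ¬ Hit C.r C.x n k L D i := fun h' => h' h
              refine (((hc.mono hΓ₃).congr ?_).weaken (by norm_num) _)
              have : (∃ i' < i + 1, Hit C.r C.x n k L D i') ↔ ∃ i' < i, Hit C.r C.x n k L D i' := by
                constructor
                · rintro ⟨i', h1, h2⟩
                  refine ⟨i', lt_of_le_of_ne (by omega) ?_, h2⟩
                  rintro rfl
                  exact hit h2
                · rintro ⟨i', h1, h2⟩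
                  exact ⟨i', by omega, h2⟩
              simp only [this]
            · have h2 := C.step_bound 510 2 1 (by norm_num) (by norm_num)
              calc 2 ^ (n - D) * C.W ^ 510 + C.W ^ 510 + 1
                  ≤ 2 ^ (n - D) * C.W ^ 510 + 2 ^ (n - D) * C.W ^ 510 + 2 ^ (n - D) * 1 := by
                    gcongr
                    · exact Nat.le_mul_of_pos_left _ hone
                    · omega
                _ = 2 ^ (n - D) * (2 * C.W ^ 510 + 1) := by ring
                _ ≤ 2 ^ (n - D) * C.W ^ 512 := Nat.mul_le_mul_left _ h2
          · have h2 := C.step_bound 512 2 1 (by norm_num) (by norm_num)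
            have h3 : C.W ^ 60 ≤ C.W ^ 512 := Nat.pow_le_pow_right C.one_le_W (by norm_num)
            calc C.W ^ 60 + 2 ^ (n - D) * C.W ^ 512 + 1
                ≤ 2 ^ (n - D) * C.W ^ 512 + 2 ^ (n - D) * C.W ^ 512 + 2 ^ (n - D) * 1 := by
                  gcongr
                  · exact h3.trans (Nat.le_mul_of_pos_left _ hone)
                  · omega
              _ = 2 ^ (n - D) * (2 * C.W ^ 512 + 1) := by ring
              _ ≤ 2 ^ (n - D) * C.W ^ 516 := Nat.mul_le_mul_left _
                  (h2.trans (Nat.pow_le_pow_right C.one_le_W (by norm_num)))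
    · have h2 := C.step_bound 540 2 1 (by norm_num) (by norm_num)
      calc C.W ^ 540 + (w + 1) * C.W ^ 540 + 1
          ≤ (w + 1) * C.W ^ 540 + (w + 1) * C.W ^ 540 + (w + 1) * 1 := by
            gcongr
            · exact Nat.le_mul_of_pos_left _ hQ
            · omega
        _ = (w + 1) * (2 * C.W ^ 540 + 1) := by ring
        _ ≤ (w + 1) * C.W ^ 550 := Nat.mul_le_mul_left _
            (h2.trans (Nat.pow_le_pow_right C.one_le_W (by norm_num)))
  · have hp : ¬ (n % k = 0 ∧ 0 < n) := by intro hp; simp [hp] at h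
    rw [if_neg hp, if_neg (fun h : SomeHit C.r C.x n k L => hp ⟨h.1, h.2.1⟩)]
    exact (h0.weaken (h' := 550) (by norm_num) 0).weaken (Nat.le_mul_of_pos_left _ hQ) le_rfl
  · have h2 := C.step_bound 550 2 1 (by norm_num) (by norm_num)
    calc C.W ^ 550 + (w + 1) * C.W ^ 550 + 1
        ≤ (w + 1) * C.W ^ 550 + (w + 1) * C.W ^ 550 + (w + 1) * 1 := by
          gcongr
          · exact Nat.le_mul_of_pos_left _ hQ
          · omega
      _ = (w + 1) * (2 * C.W ^ 550 + 1) := by ring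
      _ ≤ (w + 1) * C.W ^ 560 := Nat.mul_le_mul_left _
          (h2.trans (Nat.pow_le_pow_right C.one_le_W (by norm_num)))

end

/-! ### The program -/

/-- The algorithm for Exact Cover by `k`-Sets. -/
def coverProg : Prog := .seq (Tm.mainT 0) (.set 1 (.const 0) (Tm.rd 0))

/-- A bound for the number of bits of all numbers in a computation. -/
def wordBound (z : ℕ) : ℕ :=
  600 + (3 * z + 20) + (3 + z * z + z) + ((z + 3) * z + (z + 2) * (z * (2 * z)) + z + 5) +
    (2 * z * (2 * z + 4) * (2 * z * (2 * z)) + 2 * z * (2 * z + 4) + (2 * z + 4) + 1) +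
    ((4 * z + 28) * (z + z) + 6 * z + 300 * z * z + 300)

/-! ### Reading the input word -/

section encode
variable {k n : ℕ} (H : UniformHypergraph k n)

/-- The vertices of an edge in increasing order. -/
def edgeWord (e : Finset (Fin n)) : List ℕ := List.map (fun v : Fin n => (v : ℕ)) (e.sort (· ≤ ·))

theorem length_flatMap_edgeWord {l : List (Finset (Fin n))} (hl : ∀ e ∈ l, e.card = k) :
    (l.flatMap edgeWord).length = l.length * k := by
  induction l with
  | nil => simp
  | cons e l ih =>
    rw [List.flatMap_cons, List.length_append, ih fun e he => hl e (List.mem_cons_of_mem _ he)]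
    simp only [edgeWord, List.length_map, Finset.length_sort, List.length_cons, hl e (by simp)]
    ring

theorem getD_flatMap_edgeWord {l : List (Finset (Fin n))} (hl : ∀ e ∈ l, e.card = k) {i q : ℕ}
    (hi : i < l.length) (hq : q < k) :
    (l.flatMap edgeWord).getD (i * k + q) 0 = (edgeWord l[i]).getD q 0 := by
  induction l generalizing i with
  | nil => simp at hi
  | cons e l ih =>
    have hlen : (edgeWord e).length = k := by simp [edgeWord, hl e (by simp)]
    rw [List.flatMap_cons]
    rcases i with - | i
    · rw [zero_mul, zero_add, List.getD_append _ _ _ _ (by omega)]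
      rfl
    · rw [List.getD_append_right _ _ _ _ (by rw [hlen, add_mul]; omega), hlen,
        show (i + 1) * k + q - k = i * k + q by rw [add_mul]; omega,
        ih (fun e he => hl e (List.mem_cons_of_mem _ he)) (by simpa using hi)]
      rfl

theorem UniformHypergraph.encode_eq : H.encode = n :: k :: H.edges.length ::
    H.edges.flatMap edgeWord := by
  unfold UniformHypergraph.encode
  congr 4
  funext e
  simp [edgeWord, List.map_eq_flatMap]

theorem UniformHypergraph.length_encode : H.encode.length = 3 + H.edges.length * k := by
  rw [H.encode_eq]
  simp only [List.length_cons, length_flatMap_edgeWord H.card_eq]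
  ring

theorem UniformHypergraph.getD_encode_le (i : ℕ) :
    H.encode.getD i 0 ≤ n + k + H.edges.length := by
  by_cases hi : i < H.encode.length
  · rw [List.getD_eq_getElem _ _ hi]
    have : H.encode[i] ∈ H.encode := List.getElem_mem hi
    generalize H.encode[i] = v at this
    rw [H.encode_eq] at this
    simp only [List.mem_cons, List.mem_flatMap, edgeWord, List.mem_map] at this
    obtain h | h | h | ⟨e, -, u, -, h⟩ := this
    · omega
    · omega
    · omega
    · have := u.2
      omega
  · rw [List.getD_eq_default _ _ (not_lt.mp hi)]
    omega

/-- The encoding lists each edge without repetition, so multiplicities are 0 or 1. The offset 3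
skips the header of the word. -/
theorem UniformHypergraph.memE_encode {i : ℕ} (hi : i < H.edges.length) (u : Fin n) :
    memE H.encode k i u = if u ∈ H.edges[i] then 1 else 0 := by
  have hcard : H.edges[i].card = k := H.card_eq _ (List.getElem_mem hi)
  have hlen : (H.edges[i].sort (· ≤ ·)).length = k := by simp [hcard]
  have h1 : ∀ q < k, H.encode.getD (3 + i * k + q) 0 = (edgeWord H.edges[i]).getD q 0 := by
    intro q hq
    rw [H.encode_eq, ← getD_flatMap_edgeWord H.card_eq hi hq, show 3 + i * k + q =
      i * k + q + 1 + 1 + 1 by ring]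
    simp only [List.getD_cons_succ]
  unfold memE
  rw [Finset.sum_congr rfl fun q hq => by rw [h1 q (Finset.mem_range.mp hq)]]
  have h2 : ∀ l : List (Fin n), l.Nodup → (∑ q ∈ Finset.range l.length,
      if (List.map (fun v : Fin n => (v : ℕ)) l).getD q 0 = u then 1 else 0) = if u ∈ l then 1 else 0 := by
    intro l hl
    induction l with
    | nil => simp
    | cons a l ih =>
      rw [List.length_cons, Finset.sum_range_succ']
      simp only [List.map_cons, List.getD_cons_succ, List.getD_cons_zero]
      rw [ih hl.of_cons]
      have ha : a ∉ l := (List.nodup_cons.mp hl).1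
      by_cases hau : a = u
      · subst hau
        simp [ha]
      · have : (a : ℕ) ≠ u := fun h => hau (Fin.ext h)
        simp [this, Ne.symm hau]
  have h3 := h2 _ (Finset.sort_nodup H.edges[i] (· ≤ ·))
  rw [hlen] at h3
  simpa [edgeWord] using h3

/-- The context of a run on the input `H`. -/
def UniformHypergraph.ctx (r : ℕ → Bool) : Ctx where
  r := r
  x := H.encode
  W := wordBound (n + k + H.edges.length)
  -- The number of registers that `Params.mainT` requires.
  J := 560
  x_lt i := by
    refine lt_of_le_of_lt ?_ Nat.lt_two_pow_self
    refine (H.getD_encode_le i).trans ?_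
    unfold wordBound
    omega
  length_le := by
    rw [H.length_encode]
    have : H.edges.length * k ≤ (n + k + H.edges.length) * (n + k + H.edges.length) :=
      Nat.mul_le_mul (by omega) (by omega)
    unfold wordBound
    omega
  J_le := by unfold wordBound; omega
  le_W := by unfold wordBound; omega

theorem UniformHypergraph.params (hk : 2 ≤ k) (r : ℕ → Bool) :
    Params (H.ctx r) n k H.edges.length := by
  have hn : n ≤ n + k + H.edges.length := by omega
  have hk' : k ≤ n + k + H.edges.length := by omega
  have hL : H.edges.length ≤ n + k + H.edges.length := by omega
  have hz : H.edges.length + n + k ≤ n + k + H.edges.length := by omega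
  refine ⟨rfl, rfl, rfl, hk, ?_, ?_, ?_, ?_, ?_⟩ <;> simp only [UniformHypergraph.ctx] <;>
    generalize n + k + H.edges.length = z at * <;> unfold wordBound
  · omega
  · have : H.edges.length * k ≤ z * z := by gcongr
    omega
  · have h1 : (n + 3) * n + (n + 2) * (H.edges.length * (2 * n)) + n + 5 ≤
      (z + 3) * z + (z + 2) * (z * (2 * z)) + z + 5 := by gcongr
    omega
  · have h1 : 2 * n * (2 * n + 4) * (2 * n * (2 * n)) + 2 * n * (2 * n + 4) + (2 * n + 4) + 1 ≤
      2 * z * (2 * z + 4) * (2 * z * (2 * z)) + 2 * z * (2 * z + 4) + (2 * z + 4) + 1 := by gcongr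
    omega
  · have h1 : (4 * k + 28) * (n + k) ≤ (4 * z + 28) * (z + z) := by gcongr
    have h2 : 300 * k * k ≤ 300 * z * z := by gcongr
    omega

theorem UniformHypergraph.st_initial (r : ℕ → Bool) :
    (H.ctx r).St (fun _ => 0) (initial H.encode).mem where
  inp i := by simp [initial, UniformHypergraph.ctx]
  reg j := by simp [initial]
  zero a i h0 _ := by simp [initial, h0]
  lt j := by positivity
  top _ _ := rfl

end encode

/-! ### Running the program on an instance -/

theorem Mem.bits_update_le (μ : Mem) (q : ℕ × ℕ) (v : ℕ) :
    Mem.bits (μ.update q v) ≤ Mem.bits μ + (1 + q.2.size + v.size) := by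
  classical
  have hsub : (μ.update q v).support ⊆ insert q (μ.support.erase q) := by
    intro p hp
    rw [Finsupp.mem_support_iff] at hp
    by_cases hpq : p = q
    · simp [hpq]
    · simp only [Finsupp.coe_update, Function.update_of_ne hpq] at hp
      simp [hpq, hp]
  unfold Mem.bits Finsupp.sum
  calc _ ≤ ∑ p ∈ insert q (μ.support.erase q), (1 + p.2.size + (μ.update q v p).size) :=
        Finset.sum_le_sum_of_subset hsub
    _ = (1 + q.2.size + v.size) +
        ∑ p ∈ μ.support.erase q, (1 + p.2.size + (μ.update q v p).size) := by
        rw [Finset.sum_insert (Finset.notMem_erase _ _)]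
        simp
    _ = (1 + q.2.size + v.size) + ∑ p ∈ μ.support.erase q, (1 + p.2.size + (μ p).size) := by
        congr 1
        refine Finset.sum_congr rfl fun p hp => ?_
        rw [Finsupp.coe_update, Function.update_of_ne (Finset.ne_of_mem_erase hp)]
    _ ≤ _ := by
        rw [add_comm]
        exact Nat.add_le_add_right (Finset.sum_le_sum_of_subset (Finset.erase_subset _ _)) _

open Classical in
/-- The program halts with the correct answer within the time and space bounds. -/
theorem exec_coverProg {k n : ℕ} (H : UniformHypergraph k n) (hk : 2 ≤ k) (r : ℕ → Bool) {w : ℕ}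
    (hw : n % k = 0 → work n k ≤ w) :
    ∃ σ' t s, Exec r coverProg (initial H.encode) σ' t s ∧
      σ'.mem (1, 0) = (if SomeHit r H.encode n k H.edges.length then 1 else 0) ∧
      t ≤ (w + 1) * (wordBound (n + k + H.edges.length) ^ 560 *
        (40 * (wordBound (n + k + H.edges.length) + 1) ^ 2)) ∧
      s ≤ (wordBound (n + k + H.edges.length) + wordBound (n + k + H.edges.length)) *
        (1 + wordBound (n + k + H.edges.length) + wordBound (n + k + H.edges.length)) + 2 := by
  have hev := (H.params hk r).mainT (Γ := []) hw
  obtain ⟨σ', t, s, ρ, h1, h2, -, h4, -, h6, h7⟩ := hev.2 [] List.prefix_rfl le_rfl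
    (initial H.encode) (fun _ => 0) (H.st_initial r) (fun j v h => by simp at h) rfl
  simp only [List.length_nil] at h1 h4
  have hval : (Tm.rd 0).eval σ'.mem = if SomeHit r H.encode n k H.edges.length then 1 else 0 := by
    simp only [Expr.eval, h2.reg, h4]
    rfl
  have hsize : (if SomeHit r H.encode n k H.edges.length then 1 else 0).size ≤ 1 := by
    split_ifs <;> simp
  refine ⟨_, _, _, Exec.seq h1 (Exec.set 1 (.const 0) (Tm.rd 0) σ'), ?_, ?_, ?_⟩
  · change (σ'.mem.update (1, 0) ((Tm.rd 0).eval σ'.mem)) (1, 0) = _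
    rw [hval]
    simp
  · have hc := Ctx.cost_reg h2 (show 0 < (H.ctx r).J by simp [UniformHypergraph.ctx])
    have hunit : (H.ctx r).unit = 20 * (wordBound (n + k + H.edges.length) + 1) ^ 2 := rfl
    rw [hval]
    simp only [Expr.cost, Expr.eval, Nat.size_zero] at hc ⊢
    change _ ≤ 2 + 3 * wordBound (n + k + H.edges.length) at hc
    rw [hunit] at h6
    change t ≤ (w + 1) * wordBound (n + k + H.edges.length) ^ 560 * _ at h6
    have hW0 : 0 < wordBound (n + k + H.edges.length) := by unfold wordBound; omega
    generalize wordBound (n + k + H.edges.length) = W at *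
    have hW : 2 + 3 * W + 4 ≤ 20 * (W + 1) ^ 2 := by nlinarith
    have hpow : 1 ≤ W ^ 560 := Nat.one_le_pow _ _ (by omega)
    have h8 : 1 * (20 * (W + 1) ^ 2) ≤ (w + 1) * W ^ 560 * (20 * (W + 1) ^ 2) :=
      Nat.mul_le_mul_right _ (Nat.one_le_iff_ne_zero.mpr (by positivity))
    -- The bound is twice the cost of `Tm.mainT`; the second half pays for writing the answer.
    have h9 : (w + 1) * (W ^ 560 * (40 * (W + 1) ^ 2)) =
        (w + 1) * W ^ 560 * (20 * (W + 1) ^ 2) + (w + 1) * W ^ 560 * (20 * (W + 1) ^ 2) := by ring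
    rw [h9]
    clear h9 hunit
    generalize 20 * (W + 1) ^ 2 = A at *
    generalize (w + 1) * W ^ 560 * A = B at *
    omega
  · refine max_le (h7.trans (Nat.le_add_right _ _)) (max_le (h2.bits_le.trans (Nat.le_add_right _ _)) ?_)
    -- The answer is at most 1 and goes to cell 0, which adds at most two bits to the space.
    refine (Mem.bits_update_le _ _ _).trans ?_
    rw [hval]
    have := h2.bits_le
    change _ ≤ (wordBound (n + k + H.edges.length) + wordBound (n + k + H.edges.length)) *
        (1 + wordBound (n + k + H.edges.length) + wordBound (n + k + H.edges.length)) at this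
    simp only [Expr.eval, Nat.size_zero]
    omega

/-! ### Natural numbers as polynomials over the field with two elements -/

open Polynomial in
/-- The polynomial whose coefficients are the binary digits of `a`. -/
noncomputable def toPoly (a : ℕ) : (ZMod 2)[X] :=
  ∑ i ∈ Finset.range a, if a.testBit i then X ^ i else 0

-- The sum defining `toPoly a` reaches all binary digits, since `a < 2 ^ a`.
open Polynomial in
theorem coeff_toPoly (a i : ℕ) : (toPoly a).coeff i = if a.testBit i then 1 else 0 := by
  rw [toPoly, finsetSum_coeff]
  have h : ∀ j, (if a.testBit j then (X : (ZMod 2)[X]) ^ j else 0).coeff i =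
      if i = j then (if a.testBit i then 1 else 0) else 0 := by
    intro j
    by_cases hij : i = j
    · subst hij
      by_cases hb : a.testBit i <;> simp [hb]
    · by_cases hb : a.testBit j <;> simp [hb, hij, coeff_X_pow]
  simp only [h]
  rw [Finset.sum_ite_eq]
  by_cases hi : i < a
  · simp [hi]
  · have : a.testBit i = false :=
      Nat.testBit_lt_two_pow ((not_lt.mp hi).trans_lt Nat.lt_two_pow_self)
    simp [this]

theorem toPoly_zero : toPoly 0 = 0 := by simp [toPoly]

theorem toPoly_one : toPoly 1 = 1 := by simp [toPoly]

theorem toPoly_xor (a b : ℕ) : toPoly (a ^^^ b) = toPoly a + toPoly b := by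
  ext i
  rw [Polynomial.coeff_add, coeff_toPoly, coeff_toPoly, coeff_toPoly, Nat.testBit_xor]
  cases a.testBit i <;> cases b.testBit i <;> decide

theorem toPoly_injective : Function.Injective toPoly := by
  intro a b h
  refine Nat.eq_of_testBit_eq fun i => ?_
  have := congrArg (fun p => Polynomial.coeff p i) h
  simp only [coeff_toPoly] at this
  revert this
  cases a.testBit i <;> cases b.testBit i <;> decide

theorem toPoly_mul_two_pow (a j : ℕ) : toPoly (a * 2 ^ j) = toPoly a * Polynomial.X ^ j := by
  ext i
  rw [Polynomial.coeff_mul_X_pow', coeff_toPoly, coeff_toPoly, mul_comm, Nat.testBit_two_pow_mul]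
  by_cases h : j ≤ i <;> simp [h]

theorem toPoly_xorSum (N : ℕ) (f : ℕ → ℕ) :
    toPoly (xorSum N f) = ∑ i ∈ Finset.range N, toPoly (f i) := by
  induction N with
  | zero => simp [xorSum, toPoly_zero]
  | succ N ih => rw [xorSum, toPoly_xor, ih, Finset.sum_range_succ]

open Polynomial in
theorem toPoly_eq_sum {w b : ℕ} (hb : b < 2 ^ w) :
    toPoly b = ∑ j ∈ Finset.range w, if b.testBit j then X ^ j else 0 := by
  ext i
  rw [coeff_toPoly, finsetSum_coeff]
  have h : ∀ j, (if b.testBit j then (X : (ZMod 2)[X]) ^ j else 0).coeff i =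
      if i = j then (if b.testBit i then 1 else 0) else 0 := by
    intro j
    by_cases hij : i = j
    · subst hij
      by_cases hb : b.testBit i <;> simp [hb]
    · by_cases hb : b.testBit j <;> simp [hb, hij, coeff_X_pow]
  simp only [h]
  rw [Finset.sum_ite_eq]
  by_cases hi : i < w
  · simp [hi]
  · have : b.testBit i = false :=
      Nat.testBit_lt_two_pow (hb.trans_le (Nat.pow_le_pow_right (by norm_num) (not_lt.mp hi)))
    simp [this]

/-- Each binary digit of `b` contributes a shift of `a`, which is a product with a power of the
variable, and the shifts are added without carry. -/
theorem toPoly_clmul {w a b : ℕ} (hb : b < 2 ^ w) :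
    toPoly (clmul w a b) = toPoly a * toPoly b := by
  rw [clmul, toPoly_xorSum, toPoly_eq_sum hb, Finset.mul_sum]
  refine Finset.sum_congr rfl fun j _ => ?_
  have h : b.testBit j = decide (b / 2 ^ j % 2 = 1) := by
    rw [Nat.testBit_eq_decide_div_mod_eq]
  rcases Nat.mod_two_eq_zero_or_one (b / 2 ^ j) with h0 | h1
  · simp [h, h0, toPoly_zero]
  · simp [h, h1, toPoly_mul_two_pow]

/-! ### Bird's algorithm -/

section bird
variable {R : Type*} [CommRing R]

/-- Bird's iteration over a ring of characteristic two. -/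
def birdR (M : ℕ) (A : ℕ → ℕ → R) : ℕ → ℕ → ℕ → R
  | 0, i, j => A i j
  | t + 1, i, j => ∑ l ∈ Finset.range M, if i < l then
      birdR M A t i l * A l j + birdR M A t l l * A i j else 0

/-- Row `i` of the iteration only uses the rows below it, so away from row and column 0 the
iteration is that of the minor. This makes induction on the dimension possible. -/
theorem birdR_shift (M : ℕ) (A : ℕ → ℕ → R) (t : ℕ) : ∀ i j,
    birdR (M + 1) A t (i + 1) (j + 1) = birdR M (fun i j => A (i + 1) (j + 1)) t i j := by
  induction t with
  | zero => intro i j; rfl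
  | succ t ih =>
    intro i j
    rw [birdR, birdR, Finset.sum_range_succ']
    simp only [ih, Nat.not_lt_zero, if_false, add_zero, add_lt_add_iff_right]

/-- The matrix of the first `M` rows and columns. -/
def toMat (M : ℕ) (A : ℕ → ℕ → R) : Matrix (Fin M) (Fin M) R := Matrix.of fun i j => A i j

open PowerSeries in
/-- `1 + X A` over the power series. -/
noncomputable def oneAddX (M : ℕ) (A : ℕ → ℕ → R) : Matrix (Fin M) (Fin M) R⟦X⟧ :=
  Matrix.of fun i j => (if i = j then 1 else 0) + X * C (A i j)

open PowerSeries in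
/-- The generating series of the diagonal sums in Bird's iteration is `det (1 + X A)`. -/
theorem det_oneAddX [CharP R 2] [IsDomain R] (M : ℕ) : ∀ A : ℕ → ℕ → R,
    (oneAddX M A).det = 1 + X * mk fun t => ∑ l ∈ Finset.range M, birdR M A t l l := by
  have htwo : ∀ x : R⟦X⟧, x + x = 0 := by
    intro x
    ext
    simp [CharTwo.add_self_eq_zero]
  induction M with
  | zero =>
    intro A
    have : (mk fun t => ∑ l ∈ Finset.range 0, birdR 0 A t l l) = 0 := by ext; simp
    rw [this]
    simp
  | succ M ih =>
    intro A
    set A' : ℕ → ℕ → R := fun i j => A (i + 1) (j + 1) with hA'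
    set c := (oneAddX M A').det with hc
    have hcA := ih A'
    rw [← hc] at hcA
    -- the first row of the iteration, as a vector of power series
    set ξ : ℕ → R⟦X⟧ := fun j => mk fun t => birdR (M + 1) A t 0 j with hξ
    -- The diagonal sums that multiply `A 0 j` range over the indices above 0, and their generating
    -- series is `c` by the induction hypothesis for the minor.
    have hrec : ∀ j, ξ j = C (A 0 j) * c + X * ∑ l ∈ Finset.range M, ξ (l + 1) * C (A (l + 1) j) := by
      intro j
      ext t
      rw [hcA]
      rcases t with - | t
      · simp [hξ, birdR]
      · rw [map_add, coeff_C_mul, coeff_succ_X_mul, map_sum, map_add, coeff_succ_X_mul]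
        simp only [hξ, coeff_mk, coeff_mul_C, birdR, coeff_one, Nat.succ_ne_zero, if_false, zero_add]
        rw [Finset.sum_range_succ']
        simp only [Nat.lt_irrefl, if_false, add_zero, Nat.succ_pos, if_true,
          Finset.sum_add_distrib, birdR_shift, ← Finset.sum_mul]
        rw [add_comm, mul_comm]
    -- Combine the rows with coefficients `c` and `X * ξ (l + 1)`, and put the result in place of
    -- the first row. By the recursion all its entries but the first vanish; the determinant was
    -- multiplied by `c`, and expanding along the new row leaves the minor.
    have hdet : c * (oneAddX (M + 1) A).det = (c + X * ξ 0) * c := by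
      set v : Fin (M + 1) → R⟦X⟧ := Fin.cons c fun l => X * ξ (l + 1) with hv
      have hrow : ∀ j : Fin (M + 1), (∑ k, v k • (oneAddX (M + 1) A) k) j =
          if j = 0 then c + X * ξ 0 else 0 := by
        intro j
        rw [Finset.sum_apply, Fin.sum_univ_succ]
        simp only [Pi.smul_apply, smul_eq_mul, hv, Fin.cons_zero, Fin.cons_succ, oneAddX,
          Matrix.of_apply, Fin.val_zero, Fin.val_succ]
        refine Fin.cases ?_ (fun j => ?_) j
        · simp only [if_true, Fin.val_zero, Fin.succ_ne_zero, if_false, zero_add]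
          rw [hrec 0, ← Fin.sum_univ_eq_sum_range fun l => ξ (l + 1) * C (A (l + 1) 0)]
          simp only [mul_add, Finset.mul_sum, mul_one]
          rw [add_assoc]
          congr 2
          · ring
          · exact Finset.sum_congr rfl fun l _ => by ring
        · simp only [(Fin.succ_ne_zero j).symm, Fin.succ_ne_zero j, if_false, zero_add, Fin.val_succ,
            Fin.succ_inj, mul_add, Finset.sum_add_distrib, mul_ite, mul_one, mul_zero,
            Finset.sum_ite_eq', Finset.mem_univ, if_true]
          have h := hrec (j + 1)
          rw [← Fin.sum_univ_eq_sum_range fun l => ξ (l + 1) * C (A (l + 1) (j + 1))] at h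
          have h' : c * (X * C (A 0 (j + 1))) +
              ∑ l : Fin M, X * ξ (l + 1) * (X * C (A (l + 1) (j + 1))) = X * ξ (j + 1) := by
            rw [h, mul_add, Finset.mul_sum, Finset.mul_sum]
            congr 1
            · ring
            · exact Finset.sum_congr rfl fun l _ => by ring
          -- The contribution of the identity matrix equals the rest by the recursion, and the two
          -- cancel in characteristic two.
          rw [add_left_comm, h', htwo]
      have h1 := Matrix.det_updateRow_sum (oneAddX (M + 1) A) 0 v
      rw [smul_eq_mul, show v 0 = c from rfl] at h1
      rw [← h1, Matrix.det_succ_row_zero, Fin.sum_univ_succ]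
      simp only [Matrix.updateRow_self, hrow, Fin.succ_ne_zero, if_false, if_true, mul_zero,
        zero_mul, Finset.sum_const_zero, add_zero, Fin.val_zero, pow_zero, one_mul]
      congr 1
      rw [hc]
      congr 1
      ext i j
      simp [oneAddX, hA', Matrix.submatrix, Matrix.updateRow_ne]
    -- The constant coefficient of `c` is 1, so `c` can be cancelled from the identity.
    have hc0 : c ≠ 0 := by
      intro h0
      have h1 := congrArg (constantCoeff (R := R)) (hcA.symm.trans h0)
      simp at h1
    have h2 : (oneAddX (M + 1) A).det = c + X * ξ 0 := by
      refine mul_left_cancel₀ hc0 (hdet.trans (mul_comm _ _))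
    rw [h2, hcA, add_assoc, ← mul_add]
    congr 2
    ext t
    simp only [hξ, map_add, coeff_mk]
    rw [Finset.sum_range_succ']
    simp only [birdR_shift, hA']

-- The matrix has polynomial entries, which makes the known facts on the degree and top coefficient
-- of such determinants available.
open Polynomial in
theorem coeff_det_oneAddX (M : ℕ) (A : ℕ → ℕ → R) (t : ℕ) :
    PowerSeries.coeff t (oneAddX M A).det =
      (((X : R[X]) • (toMat M A).map C + (1 : Matrix (Fin M) (Fin M) R).map C).det).coeff t := by
  have h : oneAddX M A = (coeToPowerSeries.ringHom (R := R)).mapMatrix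
      ((X : R[X]) • (toMat M A).map C + (1 : Matrix (Fin M) (Fin M) R).map C) := by
    ext1 i j
    simp only [oneAddX, toMat, Matrix.of_apply, RingHom.mapMatrix_apply, Matrix.map_apply,
      Matrix.add_apply, Matrix.smul_apply, smul_eq_mul, map_add, map_mul,
      coeToPowerSeries.ringHom_apply, coe_X, coe_C, Matrix.one_apply]
    rw [add_comm]
    congr 1
    split_ifs <;> simp
  rw [h, ← RingHom.map_det, coeToPowerSeries.ringHom_apply, coeff_coe]

/-- Bird's algorithm computes the determinant. -/
theorem birdR_eq_det [CharP R 2] [IsDomain R] {M : ℕ} (hM : 0 < M) (A : ℕ → ℕ → R) :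
    birdR M A (M - 1) 0 0 = (toMat M A).det := by
  obtain ⟨M, rfl⟩ := Nat.exists_eq_succ_of_ne_zero hM.ne'
  have h1 : (PowerSeries.coeff (M + 1) (oneAddX (M + 1) A).det) = (toMat (M + 1) A).det := by
    rw [coeff_det_oneAddX]
    simpa using Polynomial.coeff_det_X_add_C_card (toMat (M + 1) A) 1
  -- The top coefficient of `det (1 + X A)` is a diagonal sum of the iteration. All its terms except
  -- the first form the coefficient of degree `M + 1` for the `M`-dimensional minor, which vanishes
  -- for reasons of degree.
  have h2 : (PowerSeries.coeff (M + 1) (oneAddX M fun i j => A (i + 1) (j + 1)).det) = 0 := by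
    rw [coeff_det_oneAddX]
    refine Polynomial.coeff_eq_zero_of_natDegree_lt ?_
    refine lt_of_le_of_lt (Polynomial.natDegree_det_X_add_C_le _ _) ?_
    simp
  rw [det_oneAddX, map_add, PowerSeries.coeff_succ_X_mul, PowerSeries.coeff_mk] at h1 h2
  simp only [PowerSeries.coeff_one, Nat.succ_ne_zero, if_false, zero_add] at h1 h2
  rw [Finset.sum_range_succ'] at h1
  simp only [birdR_shift, h2, zero_add] at h1
  simpa using h1

theorem toPoly_birdN {w M : ℕ} {A : ℕ → ℕ → ℕ} (hA : ∀ i j, A i j < 2 ^ w) (t : ℕ) : ∀ i j,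
    toPoly (birdN w M A t i j) = birdR M (fun i j => toPoly (A i j)) t i j := by
  induction t with
  | zero => intro i j; rfl
  | succ t ih =>
    intro i j
    rw [birdN, birdR, toPoly_xorSum]
    refine Finset.sum_congr rfl fun l _ => ?_
    split_ifs
    · rw [toPoly_xor, toPoly_clmul (hA _ _), toPoly_clmul (hA _ _), ih, ih]
    · exact toPoly_zero

end bird

/-! ### Sums of determinants in characteristic two -/

section det
variable {R : Type*} [CommRing R] [CharP R 2] {I E Y : Type*} [Fintype I] [DecidableEq I]
  [Fintype E] [DecidableEq E]

open Classical in
/-- The matrix with zero diagonal whose entry at `i ≠ j` adds up the weights of all `e` that are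
related to `i` and `j` by `m` and satisfy `p`. -/
noncomputable def pairMat (m : E → I → I → Prop) (p : E → Prop) (z : E → I → R) : Matrix I I R :=
  Matrix.of fun i j => if i = j then 0 else ∑ e, if m e i j ∧ p e then z e i * z e j else 0

open Classical in
/-- The contribution of a permutation and a choice of an `e` for every index. -/
noncomputable def pairTerm (m : E → I → I → Prop) (Q : (I → E) → Prop) (z : E → I → R)
    (a : Equiv.Perm I × (I → E)) : R :=
  if (∀ i, a.1 i ≠ i ∧ m (a.2 i) (a.1 i) i) ∧ Q a.2 then
    ∏ i, z (a.2 i) (a.1 i) * z (a.2 i) i else 0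

-- Signs disappear in characteristic two. Expanding each entry as a sum over edges replaces a
-- permutation by a permutation with a choice of an edge for every index; the zero diagonal excludes
-- fixed points.
open Classical in
omit [DecidableEq E] in
theorem det_pairMat (m : E → I → I → Prop) (p : E → Prop) (z : E → I → R) :
    (pairMat m p z).det = ∑ a, pairTerm m (fun f => ∀ i, p (f i)) z a := by
  rw [Matrix.det_apply', Fintype.sum_prod_type]
  refine Finset.sum_congr rfl fun σ _ => ?_
  have hsign : ((Equiv.Perm.sign σ : ℤ) : R) = 1 := by
    rcases Int.units_eq_one_or (Equiv.Perm.sign σ) with h | h <;> simp [h, CharTwo.neg_eq]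
  rw [hsign, one_mul]
  have h : ∀ i, pairMat m p z (σ i) i = ∑ e, if (σ i ≠ i ∧ m e (σ i) i) ∧ p e then
      z e (σ i) * z e i else 0 := by
    intro i
    by_cases hi : σ i = i <;> simp [pairMat, hi]
  simp only [h]
  rw [Finset.prod_univ_sum, Fintype.piFinset_univ]
  refine Finset.sum_congr rfl fun f _ => ?_
  rw [Finset.prod_ite_zero]
  simp [pairTerm, forall_and]

-- The condition involving `y` depends only on the choice of edges, so summing over `y` first turns
-- it into the condition `Q`.
open Classical in
omit [DecidableEq E] in
theorem sum_det_pairMat (m : E → I → I → Prop) (T : Finset Y) (p : Y → E → Prop)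
    (Q : (I → E) → Prop) (z : E → I → R)
    (hQ : ∀ f : I → E, ∑ y ∈ T, (if ∀ i, p y (f i) then 1 else 0 : R) = if Q f then 1 else 0) :
    ∑ y ∈ T, (pairMat m (p y) z).det = ∑ a, pairTerm m Q z a := by
  simp only [det_pairMat]
  rw [Finset.sum_comm]
  refine Finset.sum_congr rfl fun a _ => ?_
  have h := hQ a.2
  by_cases hm : ∀ i, a.1 i ≠ i ∧ m (a.2 i) (a.1 i) i
  · have h1 : ∀ q : Prop, ((∀ i, a.1 i ≠ i ∧ m (a.2 i) (a.1 i) i) ∧ q) = q := fun q =>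
      propext (and_iff_right hm)
    simp only [pairTerm, h1]
    have h2 := congrArg (fun x => (∏ i, z (a.2 i) (a.1 i) * z (a.2 i) i) * x) h
    simpa only [Finset.mul_sum, mul_ite, mul_one, mul_zero] using h2
  · have h1 : ∀ q : Prop, ((∀ i, a.1 i ≠ i ∧ m (a.2 i) (a.1 i) i) ∧ q) = False := fun q =>
      eq_false fun h => hm h.1
    simp only [pairTerm, h1, if_false, Finset.sum_const_zero]

omit [Fintype E] [DecidableEq E] in
/-- Only symmetric contributions survive. -/
theorem exists_symmetric_of_sum_ne_zero [Finite E] [Fintype (Equiv.Perm I × (I → E))]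
    {m : E → I → I → Prop} {Q : (I → E) → Prop}
    {z : E → I → R} (hm : ∀ e i j, m e i j → m e j i)
    (hQ : ∀ (f : I → E) (σ : Equiv.Perm I), Q f → Q (f ∘ σ))
    (h : ∑ a, pairTerm m Q z a ≠ 0) :
    ∃ (σ : Equiv.Perm I) (f : I → E), (∀ i, σ i ≠ i) ∧ (∀ i, m (f i) (σ i) i) ∧ Q f ∧
      (∀ i, σ (σ i) = i) ∧ ∀ i, f (σ i) = f i := by
  classical
  by_contra hcon
  apply h
  -- Reversing all arcs, each keeping its edge, preserves the contribution because it is symmetric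
  -- in the two ends of an arc. A reversed pair is counted twice, that is, not at all.
  refine Finset.sum_involution (fun a _ => (a.1⁻¹, a.2 ∘ (a.1⁻¹ : Equiv.Perm I))) ?_ ?_ ?_ ?_
  · rintro ⟨σ, f⟩ -
    have heq : pairTerm m Q z (σ⁻¹, f ∘ (σ⁻¹ : Equiv.Perm I)) = pairTerm m Q z (σ, f) := by
      have hc : ((∀ i, σ⁻¹ i ≠ i ∧ m ((f ∘ (σ⁻¹ : Equiv.Perm I)) i) (σ⁻¹ i) i) ∧
          Q (f ∘ (σ⁻¹ : Equiv.Perm I))) ↔ ((∀ i, σ i ≠ i ∧ m (f i) (σ i) i) ∧ Q f) := by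
        constructor
        · rintro ⟨h1, h2⟩
          refine ⟨fun i => ?_, ?_⟩
          · have := h1 (σ i)
            simp only [Function.comp, Equiv.Perm.inv_def, Equiv.symm_apply_apply] at this
            exact ⟨this.1.symm, hm _ _ _ this.2⟩
          · have := hQ _ σ h2
            rwa [Function.comp_assoc, ← Equiv.Perm.coe_mul, inv_mul_cancel, Equiv.Perm.coe_one,
              Function.comp_id] at this
        · rintro ⟨h1, h2⟩
          refine ⟨fun i => ?_, hQ _ _ h2⟩
          have := h1 (σ⁻¹ i)
          rw [← Equiv.Perm.mul_apply, mul_inv_cancel, Equiv.Perm.one_apply] at this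
          exact ⟨this.1.symm, hm _ _ _ this.2⟩
      unfold pairTerm
      simp only [hc]
      split_ifs
      · rw [← Equiv.prod_comp σ]
        refine Finset.prod_congr rfl fun i _ => ?_
        simp only [Function.comp, Equiv.Perm.inv_def, Equiv.symm_apply_apply]
        exact mul_comm _ _
      · rfl
    rw [heq]
    exact CharTwo.add_self_eq_zero _
  · rintro ⟨σ, f⟩ - hne heq
    apply hcon
    rw [pairTerm] at hne
    have hc := (ite_ne_right_iff.mp hne).1
    simp only [Prod.mk.injEq] at heq
    refine ⟨σ, f, fun i => (hc.1 i).1, fun i => (hc.1 i).2, hc.2, fun i => ?_, fun i => ?_⟩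
    · nth_rewrite 1 [← heq.1]
      simp
    · nth_rewrite 1 [← heq.2]
      simp
  · intros
    exact Finset.mem_univ _
  · rintro ⟨σ, f⟩ -
    simp only [inv_inv, Prod.mk.injEq, true_and]
    funext i
    simp

end det

/-! ### Parity of the number of avoiding sets -/

section rank
variable (S : ℕ → Prop) [DecidablePred S]

theorem rnk_succ (v : ℕ) : rnk S (v + 1) = rnk S v + if S v then 0 else 1 :=
  Finset.sum_range_succ _ _

theorem rnk_mono {u v : ℕ} (h : u ≤ v) : rnk S u ≤ rnk S v :=
  Finset.sum_le_sum_of_subset (Finset.range_mono h)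

theorem rnk_lt {u v : ℕ} (h : u < v) (hu : ¬ S u) : rnk S u < rnk S v := by
  refine lt_of_lt_of_le ?_ (rnk_mono S h)
  rw [Nat.succ_eq_add_one, rnk_succ]
  simp [hu]

theorem rnk_inj {u v : ℕ} (hu : ¬ S u) (hv : ¬ S v) (h : rnk S u = rnk S v) : u = v := by
  rcases lt_trichotomy u v with h1 | h1 | h1
  · have := rnk_lt S h1 hu; omega
  · exact h1
  · have := rnk_lt S h1 hv; omega

/-- With `rnk_inj`, the ranks number the vertices outside `S` bijectively, so that the numbers below
`2 ^ rnk S n` code the sets of such vertices. -/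
theorem exists_rnk_eq {n j : ℕ} (hj : j < rnk S n) : ∃ u < n, ¬ S u ∧ rnk S u = j := by
  induction n with
  | zero => simp [rnk] at hj
  | succ n ih =>
    by_cases h : j < rnk S n
    · obtain ⟨u, h1, h2⟩ := ih h
      exact ⟨u, by omega, h2⟩
    · rw [rnk_succ] at hj
      by_cases hs : S n
      · simp [hs] at hj; omega
      · refine ⟨n, by omega, hs, ?_⟩
        simp [hs] at hj
        omega

/-- The set number `y` avoids all elements of `U` outside `S`. -/
def Avoids (n : ℕ) (y : ℕ) (U : ℕ → Prop) : Prop :=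
  ∀ u < n, ¬ S u → U u → y / 2 ^ rnk S u % 2 = 0

-- If `U` misses a vertex `v` outside `S`, toggling `v` pairs off the avoiding sets; otherwise only
-- the empty set avoids `U`. This is inclusion-exclusion modulo two.
open Classical in
theorem sum_avoids {R : Type*} [CommRing R] [CharP R 2] (n : ℕ) (U : ℕ → Prop) :
    ∑ y ∈ Finset.range (2 ^ rnk S n), (if Avoids S n y U then 1 else 0 : R) =
      if ∀ u < n, ¬ S u → U u then 1 else 0 := by
  have hbit : ∀ y j : ℕ, y / 2 ^ j % 2 = 0 ↔ y.testBit j = false := by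
    intro y j
    rw [Nat.testBit_eq_decide_div_mod_eq, decide_eq_false_iff_not]
    omega
  by_cases h : ∀ u < n, ¬ S u → U u
  · rw [if_pos h, Finset.sum_eq_single 0]
    · simp [Avoids]
    · intro y hy hy0
      rw [if_neg]
      intro hav
      apply hy0
      refine Nat.zero_of_testBit_eq_false fun j => ?_
      by_cases hj : j < rnk S n
      · obtain ⟨u, h1, h2, rfl⟩ := exists_rnk_eq S hj
        exact (hbit _ _).mp (hav u h1 h2 (h u h1 h2))
      · exact Nat.testBit_lt_two_pow ((Finset.mem_range.mp hy).trans_le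
          (Nat.pow_le_pow_right (by norm_num) (not_lt.mp hj)))
    · intro h0
      exact absurd (Finset.mem_range.mpr (by positivity)) h0
  · rw [if_neg h]
    push Not at h
    obtain ⟨v, hv, hSv, hUv⟩ := h
    have hlt := rnk_lt S hv hSv
    have hav : ∀ y, Avoids S n y U → Avoids S n (y ^^^ 2 ^ rnk S v) U := by
      intro y hy u hu hSu hUu
      have := hy u hu hSu hUu
      rw [hbit] at this ⊢
      rw [Nat.testBit_xor, this, Nat.testBit_two_pow]
      have : rnk S v ≠ rnk S u := fun heq => hUv (rnk_inj S hSv hSu heq ▸ hUu)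
      simp [this]
    have hxx : ∀ y : ℕ, y ^^^ 2 ^ rnk S v ^^^ 2 ^ rnk S v = y := fun y => by
      rw [Nat.xor_assoc, Nat.xor_self, Nat.xor_zero]
    refine Finset.sum_involution (fun y _ => y ^^^ 2 ^ rnk S v) ?_ ?_ ?_ ?_
    · intro y _
      have : Avoids S n (y ^^^ 2 ^ rnk S v) U ↔ Avoids S n y U :=
        ⟨fun h => hxx y ▸ hav _ h, hav y⟩
      simp only [this]
      exact CharTwo.add_self_eq_zero _
    · intro y _ _ heq
      have h0 : 2 ^ rnk S v = 0 := by
        have := congrArg (fun x => y ^^^ x) heq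
        simp only [← Nat.xor_assoc, Nat.xor_self, Nat.zero_xor] at this
        exact this
      exact absurd h0 (by positivity)
    · intro y hy
      exact Finset.mem_range.mpr (Nat.xor_lt_two_pow (Finset.mem_range.mp hy)
        (Nat.pow_lt_pow_right (by norm_num) hlt))
    · intro y _
      exact hxx y

end rank

/-! ### Exact covers and symmetric contributions -/

section cover
variable {n k m L : ℕ} {I : Type*} [Fintype I] [DecidableEq I]

/-- Inside `S`, the set `e` consists of the vertices with the numbers `i` and `j`. -/
def Meets {n : ℕ} (S : ℕ → Prop) (e : Finset (Fin n)) (i j : ℕ) : Prop :=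
  ∀ u : Fin n, S u → (u ∈ e ↔ (u : ℕ) = i ∨ (u : ℕ) = j)

/-- The sets `es (f i)` cover the complement of `S`. -/
def CoversCompl {n : ℕ} {E : Type*} (S : ℕ → Prop) (es : E → Finset (Fin n)) (f : I → E) : Prop :=
  ∀ u < n, ¬ S u → ∃ i, ∃ v ∈ es (f i), (v : ℕ) = u

/-- Every vertex lies in the edges of some `i` and of `σ i`, hence is counted at least twice; in
total the 2m edges of size k have 2n incidences. So every vertex is counted exactly twice, by one
pair `i`, `σ i`, and distinct edges are disjoint. -/
theorem exactCover_of_symmetric (H : UniformHypergraph k n) {S : ℕ → Prop} {val : I → ℕ}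
    (hval : ∀ u : Fin n, S u → ∃ i, val i = u) (hI : Fintype.card I = 2 * m) (hn : n = k * m)
    {σ : Equiv.Perm I} {f : I → Fin H.edges.length} (hσ : ∀ i, σ i ≠ i)
    (hf : ∀ i, Meets S H.edges[f i] (val (σ i)) (val i))
    (hc : CoversCompl S (fun e : Fin H.edges.length => H.edges[e]) f)
    (hfσ : ∀ i, f (σ i) = f i) : H.HasExactCover := by
  classical
  set g : I → Finset (Fin n) := fun i => H.edges[f i] with hg
  have hcov : ∀ u : Fin n, ∃ i, u ∈ g i := by
    intro u
    by_cases hu : S u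
    · obtain ⟨i, hi⟩ := hval u hu
      exact ⟨i, (hf i u hu).mpr (Or.inr hi.symm)⟩
    · obtain ⟨i, v, hv, hvu⟩ := hc u u.2 hu
      obtain rfl := Fin.ext hvu
      exact ⟨i, hv⟩
  have hgσ : ∀ i, g (σ i) = g i := fun i => by simp only [hg, hfσ]
  have hpair : ∀ u i, u ∈ g i → {i, σ i} ⊆ ({i | u ∈ g i} : Finset I) := by
    intro u i hi j hj
    simp only [Finset.mem_insert, Finset.mem_singleton] at hj
    rcases hj with rfl | rfl
    · simpa using hi
    · simpa [hgσ] using hi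
  have hle : ∀ u ∈ (Finset.univ : Finset (Fin n)), 2 ≤ ({i | u ∈ g i} : Finset I).card := by
    intro u _
    obtain ⟨i, hi⟩ := hcov u
    calc 2 = ({i, σ i} : Finset I).card := (Finset.card_pair (hσ i).symm).symm
      _ ≤ _ := Finset.card_le_card (hpair u i hi)
  have hsum : ∑ u : Fin n, 2 = ∑ u : Fin n, ({i | u ∈ g i} : Finset I).card := by
    have h1 : ∑ u : Fin n, ({i | u ∈ g i} : Finset I).card = ∑ i : I, (g i).card := by
      have := Finset.sum_card_bipartiteAbove_eq_sum_card_bipartiteBelow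
        (s := (Finset.univ : Finset (Fin n))) (t := (Finset.univ : Finset I)) fun u i => u ∈ g i
      simpa [Finset.bipartiteAbove, Finset.bipartiteBelow] using this
    have h2 : ∀ i, (g i).card = k := fun i => H.card_eq _ (List.getElem_mem _)
    rw [h1]
    simp only [h2, Finset.sum_const, Finset.card_univ, hI, Fintype.card_fin, smul_eq_mul, hn]
    ring
  have heq := (Finset.sum_eq_sum_iff_of_le hle).mp hsum
  have huniq : ∀ u i j, u ∈ g i → u ∈ g j → g i = g j := by
    intro u i j hi hj
    have h1 : ({i, σ i} : Finset I) = ({i | u ∈ g i} : Finset I) :=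
      Finset.eq_of_subset_of_card_le (hpair u i hi)
        (by rw [← heq u (Finset.mem_univ u), Finset.card_pair (hσ i).symm])
    have h2 : j ∈ ({i, σ i} : Finset I) := by
      rw [h1]
      simpa using hj
    simp only [Finset.mem_insert, Finset.mem_singleton] at h2
    rcases h2 with rfl | rfl
    · rfl
    · exact (hgσ i).symm
  refine ⟨Finset.univ.image g, ?_, ?_, ?_⟩
  · intro e he
    obtain ⟨i, -, rfl⟩ := Finset.mem_image.mp he
    exact List.getElem_mem _
  · intro v
    obtain ⟨i, hi⟩ := hcov v
    exact ⟨g i, Finset.mem_image_of_mem _ (Finset.mem_univ _), hi⟩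
  · intro e₁ h₁ e₂ h₂ hne
    obtain ⟨i, -, rfl⟩ := Finset.mem_image.mp h₁
    obtain ⟨j, -, rfl⟩ := Finset.mem_image.mp h₂
    rw [Finset.disjoint_left]
    intro u hu hu'
    exact hne (huniq u i j hu hu')

theorem exists_partner {J : Type*} [DecidableEq J] {f : I → J}
    (hf : ∀ i, ({j | f j = f i} : Finset I).card = 2) :
    ∃ σ : Equiv.Perm I, (∀ i, σ i ≠ i) ∧ (∀ i, f (σ i) = f i) ∧
      ∀ i j, f j = f i → j ≠ i → j = σ i := by
  have h : ∀ i, ∃ j, j ≠ i ∧ f j = f i ∧ ∀ j', f j' = f i → j' ≠ i → j' = j := by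
    intro i
    obtain ⟨a, b, hab, heq⟩ := Finset.card_eq_two.mp (hf i)
    have hmem : ∀ j, f j = f i ↔ j = a ∨ j = b := by
      intro j
      have := Finset.ext_iff.mp heq j
      simpa using this
    rcases (hmem i).mp rfl with rfl | rfl
    · refine ⟨b, hab.symm, (hmem b).mpr (Or.inr rfl), fun j' h1 h2 => ?_⟩
      exact ((hmem j').mp h1).resolve_left h2
    · refine ⟨a, hab, (hmem a).mpr (Or.inl rfl), fun j' h1 h2 => ?_⟩
      exact ((hmem j').mp h1).resolve_right h2
  choose τ h1 h2 h3 using h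
  have hinv : Function.Involutive τ := fun i => (h3 (τ i) i (h2 i).symm (h1 i).symm).symm
  exact ⟨hinv.toPerm, h1, h2, h3⟩

/-- The index type of the matrices: the selected vertices and `d` further indices. -/
abbrev Idx (n : ℕ) (S : ℕ → Prop) (d : ℕ) : Type := {u : Fin n // S u} ⊕ Fin d

/-- The number of an index. -/
def Idx.val {n : ℕ} {S : ℕ → Prop} {d : ℕ} : Idx n S d → ℕ
  | .inl u => u.1
  | .inr j => n + j

theorem Idx.val_injective {n : ℕ} {S : ℕ → Prop} {d : ℕ} :
    Function.Injective (Idx.val (n := n) (S := S) (d := d)) := by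
  rintro (u | i) (v | j) h <;> simp only [Idx.val] at h
  · exact congrArg _ (Subtype.ext (Fin.ext h))
  · have := u.1.2; omega
  · have := v.1.2; omega
  · exact congrArg _ (Fin.ext (by omega))

/-- Every member of the cover receives its vertices in `S` and as many dummies as it lacks to have
two indices. The weight of an edge at an index is 1 if the edge is the member assigned to this index
and 0 otherwise. Then only the permutation exchanging the two indices of each member contributes. -/
theorem exists_weights_sum_eq_one {R : Type*} [CommRing R] (H : UniformHypergraph k n)
    {S : ℕ → Prop} [DecidablePred S]
    {𝒮 : Finset (Finset (Fin n))} (h𝒮 : ∀ e ∈ 𝒮, e ∈ H.edges) (hcov : ∀ v : Fin n, ∃ e ∈ 𝒮, v ∈ e)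
    (hdisj : ∀ e₁ ∈ 𝒮, ∀ e₂ ∈ 𝒮, e₁ ≠ e₂ → Disjoint e₁ e₂)
    (hsmall : ∀ e ∈ 𝒮, (e.filter fun v : Fin n => S v).card ≤ 2) {d : ℕ}
    (hd : Fintype.card {u : Fin n // S u} + d = 2 * 𝒮.card) :
    ∃ z : Fin H.edges.length → Idx n S d → R,
      ∑ a, pairTerm (fun e i j => Meets S H.edges[e] (Idx.val i) (Idx.val j))
        (CoversCompl S fun e : Fin H.edges.length => H.edges[e]) z a = 1 := by
  classical
  choose c hc𝒮 hc using hcov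
  have hcu : ∀ v, ∀ e ∈ 𝒮, v ∈ e → c v = e := by
    intro v e he hv
    by_contra hne
    exact Finset.disjoint_left.mp (hdisj _ (hc𝒮 v) _ he hne) (hc v) hv
  have hcount : ∀ e ∈ 𝒮, (∑ u : {u : Fin n // S u}, if c u = e then 1 else 0) =
      (e.filter fun v : Fin n => S v).card := by
    intro e he
    rw [← Finset.sum_subtype (Finset.univ.filter fun u : Fin n => S u) (by simp)
      fun u => if c u = e then 1 else 0, ← Finset.sum_filter, Finset.filter_filter,
      Finset.card_eq_sum_ones]
    refine Finset.sum_congr ?_ fun _ _ => rfl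
    ext u
    simp only [Finset.mem_filter, Finset.mem_univ, true_and]
    constructor
    · rintro ⟨h1, rfl⟩
      exact ⟨hc u, h1⟩
    · rintro ⟨h1, h2⟩
      exact ⟨h2, hcu u e he h1⟩
  -- distribute the further indices
  have hcard : Fintype.card (Σ e : 𝒮, Fin (2 - (e.1.filter fun v : Fin n => S v).card)) =
      Fintype.card (Fin d) := by
    have h1 : ∑ e : 𝒮, (e.1.filter fun v : Fin n => S v).card = Fintype.card {u : Fin n // S u} := by
      rw [Finset.sum_coe_sort 𝒮 fun e => (e.filter fun v : Fin n => S v).card,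
        ← Finset.sum_congr rfl hcount, Finset.sum_comm]
      simp [hc𝒮]
    have h2 : ∑ e : 𝒮, ((2 - (e.1.filter fun v : Fin n => S v).card) + (e.1.filter fun v : Fin n => S v).card) =
        2 * 𝒮.card := by
      rw [Finset.sum_congr rfl fun (e : 𝒮) _ => Nat.sub_add_cancel (hsmall e.1 e.2)]
      simp [mul_comm]
    rw [Finset.sum_add_distrib, h1] at h2
    simp only [Fintype.card_sigma, Fintype.card_fin]
    omega
  obtain ⟨φ⟩ : Nonempty (Fin d ≃ Σ e : 𝒮, Fin (2 - (e.1.filter fun v : Fin n => S v).card)) :=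
    Fintype.card_eq.mp hcard.symm
  set f : Idx n S d → 𝒮 := Sum.elim (fun u => ⟨c u, hc𝒮 u⟩) fun j => (φ j).1 with hf
  have hfib : ∀ e : 𝒮, ({j | f j = e} : Finset (Idx n S d)).card = 2 := by
    intro e
    rw [Finset.card_filter, Fintype.sum_sum_type]
    have h1 : (∑ u : {u : Fin n // S u}, if f (Sum.inl u) = e then 1 else 0) =
        (e.1.filter fun v : Fin n => S v).card := by
      rw [← hcount e.1 e.2]
      refine Finset.sum_congr rfl fun u _ => ?_
      simp [hf, Subtype.ext_iff]
    have h2 : (∑ j : Fin d, if f (Sum.inr j) = e then 1 else 0) =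
        2 - (e.1.filter fun v : Fin n => S v).card := by
      simp only [hf, Sum.elim_inr]
      rw [Equiv.sum_comp φ fun p => if p.1 = e then 1 else 0, Fintype.sum_sigma]
      rw [Finset.sum_eq_single e]
      · simp
      · intro e' _ hne
        simp [hne]
      · simp
    rw [h1, h2]
    exact Nat.add_sub_cancel' (hsmall e.1 e.2)
  obtain ⟨σ, hσ1, hσ2, hσ3⟩ := exists_partner fun i => hfib (f i)
  have hidx : ∀ e : 𝒮, ∃ i : Fin H.edges.length, H.edges[i] = e.1 := by
    intro e
    obtain ⟨i, hi, h⟩ := List.getElem_of_mem (h𝒮 e.1 e.2)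
    exact ⟨⟨i, hi⟩, h⟩
  choose idx hidx using hidx
  -- Edges may be repeated in the input; `idx` fixes one occurrence of every member.
  have hinj : Function.Injective idx := fun e e' h => Subtype.ext (by rw [← hidx, h, hidx])
  refine ⟨fun e i => if e = idx (f i) then 1 else 0, ?_⟩
  rw [Finset.sum_eq_single (σ, idx ∘ f)]
  · rw [pairTerm, if_pos]
    · simp [hσ2]
    · refine ⟨fun i => ⟨hσ1 i, fun u hu => ?_⟩, fun u hu _ => ?_⟩
      · simp only [Function.comp]
        rw [Fin.getElem_fin, ← Fin.getElem_fin, hidx]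
        have h1 : u ∈ (f i).1 ↔ f (Sum.inl ⟨u, hu⟩) = f i := by
          simp only [hf, Sum.elim_inl, Subtype.ext_iff]
          constructor
          · exact hcu u _ (f i).2
          · intro h
            rw [← h]
            exact hc u
        have h2 : ∀ j : Idx n S d, (u : ℕ) = j.val ↔ Sum.inl ⟨u, hu⟩ = j := fun j =>
          ⟨fun h => Idx.val_injective (n := n) (S := S) (d := d) h, fun h => h ▸ rfl⟩
        rw [h1, h2, h2]
        constructor
        · intro h
          by_cases hi : (Sum.inl ⟨u, hu⟩ : Idx n S d) = i
          · exact Or.inr hi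
          · exact Or.inl (hσ3 i _ h hi)
        · rintro (h | h)
          · rw [h, hσ2]
          · rw [h]
      -- Also a member disjoint from `S` has two indices, both dummies, and is therefore chosen by
      -- `f`.
      · have h1 := hfib ⟨c ⟨u, hu⟩, hc𝒮 _⟩
        obtain ⟨i, hi⟩ := Finset.card_pos.mp (by rw [h1]; norm_num)
        simp only [Finset.mem_filter, Finset.mem_univ, true_and] at hi
        refine ⟨i, ⟨u, hu⟩, ?_, rfl⟩
        simp only [Function.comp]
        rw [Fin.getElem_fin, ← Fin.getElem_fin, hidx, hi]
        exact hc _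
  · rintro ⟨σ', f'⟩ - hne
    rw [pairTerm]
    split_ifs with hcond
    · by_contra hprod
      apply hne
      have h1 : ∀ i, f' i = idx (f (σ' i)) ∧ f' i = idx (f i) := by
        intro i
        by_contra hi
        refine hprod (Finset.prod_eq_zero (Finset.mem_univ i) ?_)
        rcases not_and_or.mp hi with h | h
        · rw [if_neg h, zero_mul]
        · rw [if_neg h, mul_zero]
      have hf' : f' = idx ∘ f := funext fun i => (h1 i).2
      have hσ' : σ' = σ := by
        ext1 i
        exact hσ3 i _ (hinj ((h1 i).1.symm.trans (h1 i).2)) (hcond.1 i).1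
      rw [hf', hσ']
    · rfl
  · intro h
    exact absurd (Finset.mem_univ _) h

end cover

/-! ### Trials as sums of contributions -/

section trial
variable {k n : ℕ} (H : UniformHypergraph k n)

/-- Inside `S` the tested equation compares the multiplicity of a vertex with the number of its
occurrences among `i` and `j`, which for `i ≠ j` is again 0 or 1. Outside `S` it forbids vertices of
the set `y`. -/
theorem fits_iff {S : ℕ → Prop} [DecidablePred S] {y i j : ℕ} (hij : i ≠ j)
    (e : Fin H.edges.length) :
    Fits n S (memE H.encode k e) y i j ↔ Meets S H.edges[e] i j ∧
      Avoids S n y fun u => ∃ v ∈ H.edges[e], (v : ℕ) = u := by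
  have hmem : ∀ u : Fin n, memE H.encode k e u = if u ∈ H.edges[e] then 1 else 0 :=
    fun u => H.memE_encode e.2 u
  have hex : ∀ u : Fin n, (∃ v ∈ H.edges[e], (v : ℕ) = u) ↔ u ∈ H.edges[e] := fun u =>
    ⟨fun ⟨v, hv, h⟩ => Fin.ext h ▸ hv, fun h => ⟨u, h, rfl⟩⟩
  constructor
  · intro h
    refine ⟨fun u hu => ?_, fun u hu hSu hex' => ?_⟩
    · have := h u u.2
      rw [if_pos hu, if_pos hu, hmem] at this
      by_cases h1 : u ∈ H.edges[e] <;> by_cases h2 : (u : ℕ) = i <;>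
        by_cases h3 : (u : ℕ) = j <;> simp_all
    · have := h u hu
      rw [if_neg hSu, if_neg hSu, hmem ⟨u, hu⟩, if_pos ((hex ⟨u, hu⟩).mp hex'), one_mul] at this
      exact this
  · rintro ⟨h1, h2⟩ u hu
    by_cases hSu : S u
    · rw [if_pos hSu, if_pos hSu, hmem ⟨u, hu⟩]
      have := h1 ⟨u, hu⟩ hSu
      by_cases h2 : u = i <;> by_cases h3 : u = j <;> simp_all
    · rw [if_neg hSu, if_neg hSu, hmem ⟨u, hu⟩]
      by_cases h3 : (⟨u, hu⟩ : Fin n) ∈ H.edges[e]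
      · rw [h2 u hu hSu ((hex ⟨u, hu⟩).mpr h3), mul_zero]
      · rw [if_neg h3, zero_mul]

theorem act_congr {S S' : ℕ → Prop} (hS : ∀ v < n, S' v ↔ S v) (i : ℕ) : Act n S' i ↔ Act n S i :=
  forall_congr' fun h => hS i h

theorem rnk_congr {S S' : ℕ → Prop} [DecidablePred S] [DecidablePred S']
    (hS : ∀ v < n, S' v ↔ S v) {v : ℕ} (hv : v ≤ n) : rnk S' v = rnk S v :=
  Finset.sum_congr rfl fun u hu => by
    simp only [hS u ((Finset.mem_range.mp hu).trans_le hv)]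

theorem fits_congr {S S' : ℕ → Prop} [DecidablePred S] [DecidablePred S']
    (hS : ∀ v < n, S' v ↔ S v) (μ : ℕ → ℕ) (y i j : ℕ) : Fits n S' μ y i j ↔ Fits n S μ y i j := by
  refine forall_congr' fun u => forall_congr' fun hu => ?_
  simp only [hS u hu, rnk_congr hS hu.le]

theorem Idx.act {S : ℕ → Prop} {d : ℕ} (i : Idx n S d) : Act n S i.val := by
  rcases i with u | j
  · exact fun _ => u.2
  · exact fun h => absurd h (by simp [Idx.val])

theorem Idx.val_lt {S : ℕ → Prop} {d : ℕ} (i : Idx n S d) : i.val < n + d := by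
  rcases i with u | j
  · exact u.1.2.trans_le (Nat.le_add_right _ _)
  · exact Nat.add_lt_add_left j.2 _

/-- The indices are the active numbers. -/
noncomputable def Idx.equiv (n : ℕ) (S : ℕ → Prop) (d : ℕ) :
    Idx n S d ≃ {i : Fin (n + d) // Act n S i} :=
  Equiv.ofBijective (fun i => ⟨⟨i.val, i.val_lt⟩, i.act⟩) ⟨fun i j h => Idx.val_injective
    (congrArg (fun x : {i : Fin (n + d) // Act n S i} => (x.1 : ℕ)) h), fun ⟨i, hi⟩ => by
      by_cases h : (i : ℕ) < n
      · exact ⟨.inl ⟨⟨i, h⟩, hi h⟩, rfl⟩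
      · refine ⟨.inr ⟨i - n, by omega⟩, Subtype.ext (Fin.ext ?_)⟩
        simp only [Idx.val]
        omega⟩

section
variable {S : ℕ → Prop} [DecidablePred S] {a ρ : ℕ} (hS : ∀ v < n, Sel n a ρ v ↔ S v)
include hS

-- The rows of unselected vertices are rows of the identity, so the matrix is block triangular with
-- an identity block. The program can thus use plain numbers as indices without listing the selected
-- vertices.
open Classical in
theorem det_toMat_ent (y d : ℕ) :
    (toMat (n + d) fun i j => toPoly (ent H.encode n k H.edges.length a ρ y i j)).det =
      (pairMat (I := Idx n S d)
        (fun (e : Fin H.edges.length) i j => Meets S H.edges[e] i.val j.val)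
        (fun e => Avoids S n y fun u => ∃ v ∈ H.edges[e], (v : ℕ) = u)
        fun e i => toPoly (wt n ρ e i.val)).det := by
  rw [Matrix.twoBlockTriangular_det _ fun i : Fin (n + d) => Act n S i]
  · have h1 : (Matrix.toSquareBlockProp (toMat (n + d) fun i j =>
        toPoly (ent H.encode n k H.edges.length a ρ y i j))
        fun i => ¬ Act n S i) = 1 := by
      ext1 i j
      change toPoly (ent H.encode n k H.edges.length a ρ y i.1 j.1) = _
      unfold ent
      have hi : ¬ Act n (Sel n a ρ) i.1 := fun h => i.2 ((act_congr hS _).mp h)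
      by_cases hij : i = j
      · subst hij
        simp [hi, toPoly_one]
      · rw [if_neg fun h => hij (Subtype.ext (Fin.ext h)), if_neg hi, toPoly_zero,
          Matrix.one_apply_ne hij]
    rw [h1, Matrix.det_one, mul_one, ← Matrix.det_submatrix_equiv_self (Idx.equiv n S d)]
    congr 1
    ext1 i j
    change toPoly (ent H.encode n k H.edges.length a ρ y i.val j.val) = pairMat _ _ _ i j
    have hi := (act_congr hS _).mpr i.act
    have hj := (act_congr hS _).mpr j.act
    simp only [pairMat, Matrix.of_apply, ent]
    rw [if_pos hi, if_pos hi, if_pos hj]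
    by_cases hij : i = j
    · rw [if_pos hij, if_pos (congrArg Idx.val hij), toPoly_zero]
    · have hij' : i.val ≠ j.val := fun h => hij (Idx.val_injective h)
      rw [if_neg hij, if_neg hij', toPoly_xorSum, Finset.sum_range]
      refine Finset.sum_congr rfl fun e _ => ?_
      have := (fits_congr hS (memE H.encode k e) y i.val j.val).trans (fits_iff H hij' e)
      by_cases h : Fits n (Sel n a ρ) (memE H.encode k e) y i.val j.val
      · rw [if_pos h, if_pos (this.mp h), toPoly_clmul (show wt n ρ e j.val < 2 ^ (n + 2) from Nat.mod_lt _ (by positivity))]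
      · rw [if_neg h, if_neg fun h' => h (this.mpr h'), toPoly_zero]
  · intro i hi j hj
    have hi' : ¬ Act n (Sel n a ρ) i := fun h => hi ((act_congr hS _).mp h)
    simp only [toMat, Matrix.of_apply, ent]
    rw [if_neg fun h => hi (by rw [h]; exact hj), if_neg hi', toPoly_zero]

omit hS in
theorem card_subtype_eq (n : ℕ) (S : ℕ → Prop) [DecidablePred S] :
    Fintype.card {u : Fin n // S u} + rnk S n = n := by
  have h : ∑ u : Fin n, ((if S u then 1 else 0) + if S u then 0 else 1) = n := by
    rw [Finset.sum_congr rfl fun (u : Fin n) _ =>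
      show ((if S u then 1 else 0) + if S u then 0 else 1) = 1 by split_ifs <;> rfl]
    simp
  rw [Finset.sum_add_distrib] at h
  rw [rnk, Finset.sum_range, Fintype.card_subtype, Finset.card_filter]
  exact h

/-- A trial with a selection of the right size is a sum of contributions. -/
theorem toPoly_trial {m D : ℕ} (hn0 : 0 < n) (hk : 0 < k) (hn : n = k * m) (hD : D ≤ 2 * m)
    (hsel : Fintype.card {u : Fin n // S u} = D) :
    toPoly (trial H.encode n k H.edges.length a D ρ) =
      ∑ b, pairTerm (I := Idx n S (2 * m - D))
        (fun (e : Fin H.edges.length) i j => Meets S H.edges[e] i.val j.val)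
        (CoversCompl S fun e : Fin H.edges.length => H.edges[e])
        (fun e i => toPoly (wt n ρ e i.val)) b := by
  classical
  have hm : n / k = m := by rw [hn]; exact Nat.mul_div_cancel_left _ hk
  have hcard := card_subtype_eq n S
  have hrnk := rnk_congr hS le_rfl
  -- The dimension leaves room for all vertices and for `2 * m - D` dummies.
  have hdim : n + 2 * m - D = n + (2 * m - D) := by omega
  rw [trial, if_pos (by omega), toPoly_xorSum, hm, hdim, show n - D = rnk S n by omega]
  have h1 : ∀ y, toPoly (birdN (2 * n + 4) (n + (2 * m - D))
      (ent H.encode n k H.edges.length a ρ y) (n + (2 * m - D) - 1) 0 0) = _ := fun y => by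
    rw [toPoly_birdN (ent_lt _ _ _ _ _ _ _), birdR_eq_det (by omega), det_toMat_ent H hS]
  rw [Finset.sum_congr rfl fun y _ => h1 y]
  refine sum_det_pairMat _ _ _ _ _ fun f => ?_
  have h2 := sum_avoids S (R := Polynomial (ZMod 2)) n
    fun u => ∃ i, ∃ v ∈ H.edges[f i], (v : ℕ) = u
  rw [CoversCompl]
  convert h2 using 5
  exact ⟨fun h u hu hS ⟨i, hi⟩ => h i u hu hS hi, fun h i u hu hS hi => h u hu hS ⟨i, hi⟩⟩

end

/-- Trials are only successful if there is an exact cover. -/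
theorem hasExactCover_of_trial_ne_zero {m a D ρ : ℕ} (hn0 : 0 < n) (hk : 0 < k) (hn : n = k * m)
    (hD : D ≤ 2 * m) (h : trial H.encode n k H.edges.length a D ρ ≠ 0) : H.HasExactCover := by
  classical
  have hcard := card_subtype_eq n (Sel n a ρ)
  have hsel : Fintype.card {u : Fin n // Sel n a ρ u} = D := by
    by_contra hne
    rw [trial, if_neg (by omega)] at h
    exact h rfl
  have h1 : toPoly (trial H.encode n k H.edges.length a D ρ) ≠ 0 := fun h0 =>
    h (toPoly_injective (h0.trans toPoly_zero.symm))
  rw [toPoly_trial H (fun _ _ => Iff.rfl) hn0 hk hn hD hsel] at h1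
  have hsym : ∀ (e : Fin H.edges.length) (i j : Idx n (Sel n a ρ) (2 * m - D)),
      Meets (Sel n a ρ) H.edges[e] i.val j.val → Meets (Sel n a ρ) H.edges[e] j.val i.val :=
    fun e i j h u hu => by rw [h u hu, or_comm]
  have hperm : ∀ (f : Idx n (Sel n a ρ) (2 * m - D) → Fin H.edges.length) (σ : Equiv.Perm _),
      CoversCompl (Sel n a ρ) (fun e : Fin H.edges.length => H.edges[e]) f →
      CoversCompl (Sel n a ρ) (fun e : Fin H.edges.length => H.edges[e]) (f ∘ σ) := by
    intro f σ h u hu hS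
    obtain ⟨i, hi⟩ := h u hu hS
    refine ⟨σ⁻¹ i, ?_⟩
    simpa using hi
  obtain ⟨σ, f, h2, h3, h4, -, h6⟩ := exists_symmetric_of_sum_ne_zero hsym hperm h1
  refine exactCover_of_symmetric H (S := Sel n a ρ) (val := Idx.val)
    (fun u hu => ⟨.inl ⟨u, hu⟩, rfl⟩) ?_ hn h2 h3 h4 h6
  rw [Fintype.card_sum, hsel, Fintype.card_fin]
  omega

theorem hasExactCover_of_someHit {r : ℕ → Bool} (hk : 0 < k)
    (h : SomeHit r H.encode n k H.edges.length) : H.HasExactCover := by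
  obtain ⟨h1, h2, D, hD, i, -, hi⟩ := h
  exact hasExactCover_of_trial_ne_zero H h2 hk (Nat.mul_div_cancel' (Nat.dvd_of_mod_eq_zero h1)).symm
    (by omega) hi

end trial

/-! ### Counting numbers by their digits -/

theorem sum_range_mul {R : Type*} [AddCommMonoid R] (a b : ℕ) (f : ℕ → R) :
    ∑ ρ ∈ Finset.range (a * b), f ρ =
      ∑ i ∈ Finset.range a, ∑ j ∈ Finset.range b, f (i + a * j) := by
  induction b with
  | zero => simp
  | succ b ih =>
    rw [Nat.mul_succ, Finset.sum_range_add, ih, ← Finset.sum_add_distrib]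
    refine Finset.sum_congr rfl fun i _ => ?_
    rw [Finset.sum_range_succ, add_comm (a * b)]

theorem digit_add_mul {b i s : ℕ} (x y : ℕ) (h : i < s) :
    (x + b ^ s * y) / b ^ i % b = x / b ^ i % b := by
  rcases Nat.eq_zero_or_pos b with rfl | hb
  · rcases Nat.eq_zero_or_pos i with rfl | hi
    · simp [h.ne']
    · simp [hi.ne']
  · rw [show b ^ s * y = b ^ i * (b * (b ^ (s - i - 1) * y)) by
      rw [← mul_assoc, ← mul_assoc, ← pow_succ, ← pow_add]; congr 2; omega,
      Nat.add_mul_div_left _ _ (by positivity), Nat.add_mul_mod_self_left]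

/-- Independence of the random digits, in terms of counting: the digits of a uniform number below `b
^ n` are independent and uniform. -/
theorem card_digits (b : ℕ) (n : ℕ) (P : ℕ → ℕ → Prop) [∀ v, DecidablePred (P v)] :
    ((Finset.range (b ^ n)).filter fun ρ => ∀ v < n, P v (ρ / b ^ v % b)).card =
      ∏ v ∈ Finset.range n, ((Finset.range b).filter (P v)).card := by
  induction n with
  | zero => simp
  | succ n ih =>
    rw [Finset.prod_range_succ, ← ih, Finset.card_filter, pow_succ, sum_range_mul,
      Finset.card_filter, Finset.card_filter, Finset.sum_mul_sum]
    refine Finset.sum_congr rfl fun i hi => Finset.sum_congr rfl fun j hj => ?_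
    rw [Finset.mem_range] at hi hj
    have h1 : (∀ v < n + 1, P v ((i + b ^ n * j) / b ^ v % b)) ↔
        (∀ v < n, P v (i / b ^ v % b)) ∧ P n j := by
      have hlast : (i + b ^ n * j) / b ^ n % b = j := by
        rw [Nat.add_mul_div_left _ _ (by omega), Nat.div_eq_of_lt hi, zero_add,
          Nat.mod_eq_of_lt hj]
      constructor
      · intro h
        refine ⟨fun v hv => ?_, ?_⟩
        · rw [← digit_add_mul i j hv]
          exact h v (by omega)
        · rw [← hlast]
          exact h n (by omega)
      · rintro ⟨h1, h2⟩ v hv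
        rcases Nat.lt_succ_iff_lt_or_eq.mp hv with hv | rfl
        · rw [digit_add_mul i j hv]
          exact h1 v hv
        · rwa [hlast]
    rw [if_congr h1 rfl rfl, ite_and]
    split_ifs <;> simp

/-! ### Most weights lead to success -/

/-- Used for evaluation homomorphisms: the sum with indeterminates as weights specializes to the sum
with any given weights. -/
theorem map_sum_pairTerm {R R' : Type*} [CommRing R] [CommRing R'] {I E : Type*} [Fintype I]
    [DecidableEq I]
    [Fintype (Equiv.Perm I × (I → E))] (φ : R →+* R') (m : E → I → I → Prop) (Q : (I → E) → Prop)
    (z : E → I → R) :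
    φ (∑ a, pairTerm m Q z a) = ∑ a, pairTerm m Q (fun e i => φ (z e i)) a := by
  rw [map_sum]
  refine Finset.sum_congr rfl fun a _ => ?_
  unfold pairTerm
  split_ifs
  · rw [map_prod]
    simp only [map_mul]
  · exact map_zero φ

theorem totalDegree_sum_pairTerm_le {R : Type*} [CommRing R] {I E : Type*} [Fintype I]
    [DecidableEq I]
    [Fintype (Equiv.Perm I × (I → E))] {N : ℕ} (m : E → I → I → Prop) (Q : (I → E) → Prop)
    (idx : E → I → Fin N) :
    (∑ a, pairTerm m Q (fun e i => (MvPolynomial.X (idx e i) : MvPolynomial (Fin N) R)) a).totalDegree ≤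
      2 * Fintype.card I := by
  refine MvPolynomial.totalDegree_finsetSum_le fun a _ => ?_
  have hX : ∀ s, (MvPolynomial.X s : MvPolynomial (Fin N) R).totalDegree ≤ 1 := fun s => by
    rcases subsingleton_or_nontrivial R with h | h
    · simp [Subsingleton.elim (MvPolynomial.X s : MvPolynomial (Fin N) R) 0]
    · exact (MvPolynomial.totalDegree_X s).le
  unfold pairTerm
  split_ifs
  · refine (MvPolynomial.totalDegree_finsetProd _ _).trans ?_
    refine (Finset.sum_le_card_nsmul _ _ 2 fun i _ => ?_).trans_eq (by simp [mul_comm])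
    exact (MvPolynomial.totalDegree_mul _ _).trans (Nat.add_le_add (hX _) (hX _))
  · simp

/-- The Schwartz-Zippel lemma for the `2 ^ w` polynomials coded by the numbers below `2 ^ w`. A
number below `(2 ^ w) ^ N` is determined by its digits, so zeros can be counted by the numbers
themselves. -/
theorem two_mul_card_zeros_le {N w : ℕ} {p : MvPolynomial (Fin N) (Polynomial (ZMod 2))}
    (hp : p ≠ 0) (hdeg : 2 * p.totalDegree ≤ 2 ^ w) [DecidableEq (Polynomial (ZMod 2))] :
    2 * ((Finset.range ((2 ^ w) ^ N)).filter fun ρ =>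
      MvPolynomial.eval (fun j : Fin N => toPoly (ρ / (2 ^ w) ^ (j : ℕ) % 2 ^ w)) p = 0).card ≤
      (2 ^ w) ^ N := by
  set S : Finset (Polynomial (ZMod 2)) := (Finset.range (2 ^ w)).image toPoly with hS
  have hScard : S.card = 2 ^ w := by
    rw [hS, Finset.card_image_of_injective _ toPoly_injective, Finset.card_range]
  have h1 := MvPolynomial.schwartz_zippel_totalDegree hp S
  rw [hScard] at h1
  set Z := (Fintype.piFinset fun _ : Fin N => S).filter fun f => MvPolynomial.eval f p = 0 with hZ
  have h2 : ((Finset.range ((2 ^ w) ^ N)).filter fun ρ =>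
      MvPolynomial.eval (fun j : Fin N => toPoly (ρ / (2 ^ w) ^ (j : ℕ) % 2 ^ w)) p = 0).card ≤
      Z.card := by
    refine Finset.card_le_card_of_injOn
      (fun ρ j => toPoly (ρ / (2 ^ w) ^ (j : ℕ) % 2 ^ w)) ?_ ?_
    · intro ρ hρ
      simp only [Finset.coe_filter, Finset.mem_range, Set.mem_ofPred_eq] at hρ
      simp only [hZ, Finset.coe_filter, Fintype.mem_piFinset, Set.mem_ofPred_eq]
      exact ⟨fun j => Finset.mem_image_of_mem _
        (Finset.mem_range.mpr (Nat.mod_lt _ (by positivity))), hρ.2⟩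
    · intro ρ hρ ρ' hρ' h
      simp only [Finset.coe_filter, Finset.mem_range, Set.mem_ofPred_eq] at hρ hρ'
      have h3 : finFunctionFinEquiv.symm (⟨ρ, hρ.1⟩ : Fin ((2 ^ w) ^ N)) =
          finFunctionFinEquiv.symm ⟨ρ', hρ'.1⟩ := by
        funext j
        exact Fin.ext (toPoly_injective (congrFun h j))
      exact congrArg Fin.val (finFunctionFinEquiv.symm.injective h3)
  have h4 : (2 * Z.card : ℚ≥0) ≤ (2 ^ w) ^ N := by
    have h5 : (p.totalDegree : ℚ≥0) / ((2 ^ w : ℕ) : ℚ≥0) ≤ 1 / 2 := by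
      rw [div_le_div_iff₀ (by positivity) (by norm_num), one_mul, mul_comm]
      exact_mod_cast hdeg
    have h6 := h1.trans h5
    rw [div_le_div_iff₀ (by positivity) (by norm_num), one_mul, mul_comm] at h6
    exact_mod_cast h6
  have h5 : 2 * Z.card ≤ (2 ^ w) ^ N := by exact_mod_cast h4
  omega

/-- The sum of contributions as a polynomial in the weights. -/
theorem exists_mvPolynomial {k n m d : ℕ} (H : UniformHypergraph k n) (hn0 : 0 < n) (hd : d ≤ n)
    {S : ℕ → Prop} [DecidablePred S]
    {𝒮 : Finset (Finset (Fin n))} (h𝒮 : ∀ e ∈ 𝒮, e ∈ H.edges) (hcov : ∀ v : Fin n, ∃ e ∈ 𝒮, v ∈ e)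
    (hdisj : ∀ e₁ ∈ 𝒮, ∀ e₂ ∈ 𝒮, e₁ ≠ e₂ → Disjoint e₁ e₂) (hcard : 𝒮.card = m)
    (hsmall : ∀ e ∈ 𝒮, (e.filter fun v : Fin n => S v).card ≤ 2)
    (hsel : Fintype.card {u : Fin n // S u} + d = 2 * m) :
    ∃ p : MvPolynomial (Fin (H.edges.length * (2 * n))) (Polynomial (ZMod 2)), p ≠ 0 ∧
      p.totalDegree ≤ 4 * m ∧ ∀ g : ℕ → Polynomial (ZMod 2),
        MvPolynomial.eval (fun j : Fin (H.edges.length * (2 * n)) => g j) p =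
          ∑ b, pairTerm (I := Idx n S d)
            (fun (e : Fin H.edges.length) i j => Meets S H.edges[e] i.val j.val)
            (CoversCompl S fun e : Fin H.edges.length => H.edges[e])
            (fun e i => g (e * (2 * n) + i.val)) b := by
  have hval : ∀ i : Idx n S d, i.val < 2 * n := fun i => i.val_lt.trans_le (by omega)
  have hidx : ∀ (e : Fin H.edges.length) (i : Idx n S d),
      (e : ℕ) * (2 * n) + i.val < H.edges.length * (2 * n) := by
    intro e i
    calc (e : ℕ) * (2 * n) + i.val < e * (2 * n) + 2 * n := Nat.add_lt_add_left (hval i) _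
      _ = (e + 1) * (2 * n) := by ring
      _ ≤ H.edges.length * (2 * n) := Nat.mul_le_mul_right _ e.2
  have hinj : Function.Injective fun q : Fin H.edges.length × Idx n S d =>
      (q.1 : ℕ) * (2 * n) + q.2.val := by
    rintro ⟨e, i⟩ ⟨e', i'⟩ h
    have h4 : (e : ℕ) = e' := by
      have := congrArg (· / (2 * n)) h
      simp only [mul_comm _ (2 * n), Nat.mul_add_div (show 2 * n > 0 by omega),
        Nat.div_eq_of_lt (hval i), Nat.div_eq_of_lt (hval i'), add_zero] at this
      exact this
    simp only [h4, add_right_inj] at h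
    exact Prod.ext (Fin.ext h4) (Idx.val_injective h)
  set M : Fin H.edges.length → Idx n S d → Idx n S d → Prop := fun e i j =>
    Meets S H.edges[e] i.val j.val
  set Q : (Idx n S d → Fin H.edges.length) → Prop :=
    CoversCompl S fun e : Fin H.edges.length => H.edges[e]
  have heval := fun g : ℕ → Polynomial (ZMod 2) =>
    map_sum_pairTerm (MvPolynomial.eval fun j : Fin (H.edges.length * (2 * n)) => g j) M Q
      fun e i => MvPolynomial.X ⟨e * (2 * n) + i.val, hidx e i⟩
  simp only [MvPolynomial.eval_X] at heval
  refine ⟨_, ?_, ?_, heval⟩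
  · intro h0
    obtain ⟨z, hz⟩ := exists_weights_sum_eq_one (R := Polynomial (ZMod 2)) H (S := S) h𝒮 hcov hdisj
      hsmall (d := d) (by rw [hcard, hsel])
    -- The variables of distinct pairs are distinct, so the isolating weights are the values of the
    -- variables at some point, where the polynomial is 1.
    have h1 := heval (Function.extend (fun q : Fin H.edges.length × Idx n S d =>
      (q.1 : ℕ) * (2 * n) + q.2.val) (fun q : Fin H.edges.length × Idx n S d => z q.1 q.2) 0)
    rw [h0, map_zero] at h1
    have h2 : ∀ (e : Fin H.edges.length) (i : Idx n S d), Function.extend (fun q : Fin H.edges.length × Idx n S d =>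
        (q.1 : ℕ) * (2 * n) + q.2.val) (fun q => z q.1 q.2) 0 (e * (2 * n) + i.val) = z e i :=
      fun e i => hinj.extend_apply _ _ (e, i)
    simp only [h2] at h1
    exact zero_ne_one (h1.trans hz)
  · refine (totalDegree_sum_pairTerm_le M Q fun e i => ⟨_, hidx e i⟩).trans ?_
    have hle : Fintype.card (Idx n S d) = Fintype.card {u : Fin n // S u} + d := by
      rw [Fintype.card_sum, Fintype.card_fin]
    omega

/-- The low part `ρ₁` of the random number fixes the selection, the high part `ρ₂` consists of the
weights. The degree is at most 4m, and 8m ≤ 4n ≤ 2^(n+2), so weights of `n + 2` bits suffice. -/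
theorem two_mul_card_trial_eq_zero_le {k n m a D ρ₁ : ℕ} (H : UniformHypergraph k n) (hn0 : 0 < n)
    (hk : 2 ≤ k) (hn : n = k * m) (hD : D ≤ 2 * m) (hρ₁ : ρ₁ < 2 ^ ((n + 3) * n))
    {S : ℕ → Prop} [DecidablePred S] (hS : ∀ v < n, Sel n a ρ₁ v ↔ S v)
    {𝒮 : Finset (Finset (Fin n))} (h𝒮 : ∀ e ∈ 𝒮, e ∈ H.edges) (hcov : ∀ v : Fin n, ∃ e ∈ 𝒮, v ∈ e)
    (hdisj : ∀ e₁ ∈ 𝒮, ∀ e₂ ∈ 𝒮, e₁ ≠ e₂ → Disjoint e₁ e₂) (hcard : 𝒮.card = m)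
    (hsmall : ∀ e ∈ 𝒮, (e.filter fun v : Fin n => S v).card ≤ 2)
    (hsel : Fintype.card {u : Fin n // S u} = D) :
    2 * ((Finset.range (2 ^ ((n + 2) * (H.edges.length * (2 * n))))).filter fun ρ₂ =>
      trial H.encode n k H.edges.length a D (ρ₁ + 2 ^ ((n + 3) * n) * ρ₂) = 0).card ≤
      2 ^ ((n + 2) * (H.edges.length * (2 * n))) := by
  classical
  have hkm : 2 * m ≤ n := by rw [hn]; exact Nat.mul_le_mul_right _ hk
  obtain ⟨p, hp0, hdeg, hp⟩ := exists_mvPolynomial H hn0 (d := 2 * m - D) (by omega) h𝒮 hcov hdisj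
    hcard hsmall (by omega)
  have h2 : n < 2 ^ n := Nat.lt_two_pow_self
  have h1 := two_mul_card_zeros_le (w := n + 2) hp0 (by rw [pow_add]; omega)
  rw [← pow_mul] at h1
  refine le_of_eq_of_le ?_ h1
  congr 2
  refine Finset.filter_congr fun ρ₂ _ => ?_
  have hselv : ∀ v < n, Sel n a (ρ₁ + 2 ^ ((n + 3) * n) * ρ₂) v ↔ S v := by
    intro v hv
    rw [← hS v hv, Sel, Sel, pow_mul, pow_mul, digit_add_mul _ _ hv]
  have hwt : ∀ e i, wt n (ρ₁ + 2 ^ ((n + 3) * n) * ρ₂) e i =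
      ρ₂ / (2 ^ (n + 2)) ^ (e * (2 * n) + i) % 2 ^ (n + 2) := by
    intro e i
    rw [wt, pow_add, ← Nat.div_div_eq_div_mul, Nat.add_mul_div_left _ _ (by positivity),
      Nat.div_eq_of_lt hρ₁, zero_add, pow_mul]
  have h3 := toPoly_trial H hselv hn0 (by omega) hn hD hsel
  have h4 := hp fun j => toPoly (ρ₂ / (2 ^ (n + 2)) ^ j % 2 ^ (n + 2))
  simp only [hwt] at h3
  rw [h4, ← h3]
  constructor
  · intro h
    rw [h, toPoly_zero]
  · intro h
    exact toPoly_injective (h.trans toPoly_zero.symm)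

/-! ### The selections that lead to success -/

section good
variable {n k : ℕ} {𝒮 : Finset (Finset (Fin n))}

/-- The sets of vertices that contain at most two elements of every member of `𝒮`. -/
def good (𝒮 : Finset (Finset (Fin n))) : Finset (Finset (Fin n)) :=
  Finset.univ.filter fun U => ∀ e ∈ 𝒮, (e ∩ U).card ≤ 2

theorem card_eq_sum_inter (hcov : ∀ v : Fin n, ∃ e ∈ 𝒮, v ∈ e)
    (hdisj : ∀ e₁ ∈ 𝒮, ∀ e₂ ∈ 𝒮, e₁ ≠ e₂ → Disjoint e₁ e₂) (U : Finset (Fin n)) :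
    U.card = ∑ e : 𝒮, (e.1 ∩ U).card := by
  rw [Finset.sum_coe_sort 𝒮 fun e => (e ∩ U).card, ← Finset.card_biUnion]
  · congr 1
    ext v
    obtain ⟨e, he, hv⟩ := hcov v
    simp only [Finset.mem_biUnion, Finset.mem_inter]
    exact ⟨fun h => ⟨e, he, hv, h⟩, fun ⟨_, _, _, h⟩ => h⟩
  · intro e he e' he' hne
    exact (hdisj e he e' he' hne).mono Finset.inter_subset_left Finset.inter_subset_left

theorem mul_card_eq (hcov : ∀ v : Fin n, ∃ e ∈ 𝒮, v ∈ e)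
    (hdisj : ∀ e₁ ∈ 𝒮, ∀ e₂ ∈ 𝒮, e₁ ≠ e₂ → Disjoint e₁ e₂) (hk : ∀ e ∈ 𝒮, e.card = k) :
    n = k * 𝒮.card := by
  have h := card_eq_sum_inter hcov hdisj Finset.univ
  simp only [Finset.inter_univ, Finset.card_univ, Fintype.card_fin] at h
  rw [Finset.sum_congr rfl fun (e : 𝒮) _ => hk e.1 e.2] at h
  refine h.trans ?_
  simp [mul_comm]

theorem card_le_of_mem_good (hcov : ∀ v : Fin n, ∃ e ∈ 𝒮, v ∈ e)
    (hdisj : ∀ e₁ ∈ 𝒮, ∀ e₂ ∈ 𝒮, e₁ ≠ e₂ → Disjoint e₁ e₂) {U : Finset (Fin n)} (hU : U ∈ good 𝒮) :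
    U.card ≤ 2 * 𝒮.card := by
  rw [card_eq_sum_inter hcov hdisj U]
  refine (Finset.sum_le_card_nsmul _ _ 2 fun e _ => ?_).trans_eq (by simp [mul_comm])
  exact (Finset.mem_filter.mp hU).2 e.1 e.2

theorem sum_card_le_two {R : Type*} [CommSemiring R] (hk : 2 ≤ k) {e : Finset (Fin n)}
    (he : e.card = k) (x y : R) :
    ∑ T ∈ e.powerset.filter (fun T => T.card ≤ 2), x ^ T.card * y ^ (k - T.card) =
      ∑ j ∈ Finset.range 3, x ^ j * y ^ (k - j) * k.choose j := by
  rw [Finset.sum_filter, Finset.sum_powerset_apply_card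
    (fun j => if j ≤ 2 then x ^ j * y ^ (k - j) else 0), he]
  refine (Finset.sum_subset (Finset.range_mono (by omega)) fun j _ hj => ?_).symm.trans
    (Finset.sum_congr rfl fun j hj => ?_)
  · rw [Finset.mem_range] at hj
    rw [if_neg (by omega), smul_zero]
  · rw [Finset.mem_range] at hj
    rw [if_pos (by omega), nsmul_eq_mul, mul_comm]

/-- The members of a cover partition the vertices, so a good set is an independent choice of at most
two vertices in every member, and the weight is multiplicative. -/
theorem sum_good {R : Type*} [CommSemiring R] (hk : 2 ≤ k) (hcov : ∀ v : Fin n, ∃ e ∈ 𝒮, v ∈ e)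
    (hdisj : ∀ e₁ ∈ 𝒮, ∀ e₂ ∈ 𝒮, e₁ ≠ e₂ → Disjoint e₁ e₂) (h𝒮 : ∀ e ∈ 𝒮, e.card = k) (x y : R) :
    ∑ U ∈ good 𝒮, x ^ U.card * y ^ (n - U.card) =
      (∑ j ∈ Finset.range 3, x ^ j * y ^ (k - j) * k.choose j) ^ 𝒮.card := by
  have h1 : (∑ j ∈ Finset.range 3, x ^ j * y ^ (k - j) * k.choose j) ^ 𝒮.card =
      ∏ e : 𝒮, ∑ T ∈ e.1.powerset.filter (fun T => T.card ≤ 2),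
        x ^ T.card * y ^ (k - T.card) := by
    rw [Finset.prod_congr rfl fun (e : 𝒮) _ => sum_card_le_two hk (h𝒮 e.1 e.2) x y]
    simp
  rw [h1, Finset.prod_univ_sum]
  have hinter : ∀ T ∈ Fintype.piFinset fun e : 𝒮 => e.1.powerset.filter fun T => T.card ≤ 2,
      ∀ e : 𝒮, e.1 ∩ Finset.univ.biUnion T = T e := by
    intro T hT e
    rw [Fintype.mem_piFinset] at hT
    simp only [Finset.mem_filter, Finset.mem_powerset] at hT
    ext v
    simp only [Finset.mem_inter, Finset.mem_biUnion, Finset.mem_univ, true_and]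
    constructor
    · rintro ⟨h2, e', h3⟩
      by_cases hee : e = e'
      · exact hee ▸ h3
      · exact absurd ((hT e').1 h3)
          (Finset.disjoint_left.mp (hdisj _ e.2 _ e'.2 fun h => hee (Subtype.ext h)) h2)
    · intro h2
      exact ⟨(hT e).1 h2, e, h2⟩
  refine Finset.sum_nbij' (fun U e => e.1 ∩ U) (fun T => Finset.univ.biUnion T) ?_ ?_ ?_ ?_ ?_
  · intro U hU
    rw [Fintype.mem_piFinset]
    intro e
    simp only [Finset.mem_filter, Finset.mem_powerset]
    exact ⟨Finset.inter_subset_left, (Finset.mem_filter.mp hU).2 e.1 e.2⟩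
  · intro T hT
    refine Finset.mem_filter.mpr ⟨Finset.mem_univ _, fun e he => ?_⟩
    rw [hinter T hT ⟨e, he⟩]
    exact (Finset.mem_filter.mp (Fintype.mem_piFinset.mp hT ⟨e, he⟩)).2
  · intro U _
    ext v
    obtain ⟨e, he, hv⟩ := hcov v
    simp only [Finset.mem_biUnion, Finset.mem_univ, true_and, Finset.mem_inter]
    exact ⟨fun ⟨_, _, h⟩ => h, fun h => ⟨⟨e, he⟩, hv, h⟩⟩
  · intro T hT
    funext e
    exact hinter T hT e
  · intro U _
    have hle : ∀ e : 𝒮, (e.1 ∩ U).card ≤ k := fun e =>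
      (Finset.card_le_card Finset.inter_subset_left).trans_eq (h𝒮 e.1 e.2)
    rw [Finset.prod_mul_distrib, Finset.prod_pow_eq_pow_sum, Finset.prod_pow_eq_pow_sum,
      ← card_eq_sum_inter hcov hdisj U]
    congr 2
    have h2 : ∑ e : 𝒮, ((k - (e.1 ∩ U).card) + (e.1 ∩ U).card) = n := by
      rw [Finset.sum_congr rfl fun (e : 𝒮) _ => Nat.sub_add_cancel (hle e)]
      refine Eq.trans ?_ (mul_card_eq hcov hdisj h𝒮).symm
      simp [mul_comm]
    rw [Finset.sum_add_distrib, ← card_eq_sum_inter hcov hdisj U] at h2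
    exact (Nat.eq_sub_of_add_eq h2).symm

/-- The number of sets of vertices of size `D` that contain at most two elements of every member
of `𝒮`. -/
def goodCount (𝒮 : Finset (Finset (Fin n))) (D : ℕ) : ℕ := ((good 𝒮).filter fun U => U.card = D).card

theorem sum_goodCount {R : Type*} [CommSemiring R] (hcov : ∀ v : Fin n, ∃ e ∈ 𝒮, v ∈ e)
    (hdisj : ∀ e₁ ∈ 𝒮, ∀ e₂ ∈ 𝒮, e₁ ≠ e₂ → Disjoint e₁ e₂) (f : ℕ → R) :
    ∑ D ∈ Finset.range (2 * 𝒮.card + 1), goodCount 𝒮 D * f D = ∑ U ∈ good 𝒮, f U.card := by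
  rw [← Finset.sum_fiberwise_of_maps_to (s := good 𝒮) (t := Finset.range (2 * 𝒮.card + 1))
    (g := Finset.card) (fun U hU => Finset.mem_range.mpr
      (Nat.lt_succ_of_le (card_le_of_mem_good hcov hdisj hU)))]
  refine Finset.sum_congr rfl fun D _ => ?_
  rw [Finset.sum_congr rfl fun U hU => by rw [(Finset.mem_filter.mp hU).2], Finset.sum_const,
    nsmul_eq_mul, goodCount]

/-- The number of random numbers that lead to a given selection. -/
theorem card_selection {n t : ℕ} (ht : t ≤ 2 ^ (n + 3)) (U : Finset (Fin n)) :
    ((Finset.range (2 ^ ((n + 3) * n))).filter fun ρ => ∀ v : Fin n, Sel n t ρ v ↔ v ∈ U).card =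
      t ^ U.card * (2 ^ (n + 3) - t) ^ (n - U.card) := by
  classical
  have h1 := card_digits (2 ^ (n + 3)) n fun v x => x < t ↔ ∃ w ∈ U, (w : ℕ) = v
  rw [← pow_mul] at h1
  have h2 : ((Finset.range (2 ^ ((n + 3) * n))).filter fun ρ => ∀ v : Fin n, Sel n t ρ v ↔ v ∈ U) =
      (Finset.range (2 ^ ((n + 3) * n))).filter fun ρ => ∀ v < n,
        (ρ / (2 ^ (n + 3)) ^ v % 2 ^ (n + 3) < t ↔ ∃ w ∈ U, (w : ℕ) = v) := by
    refine Finset.filter_congr fun ρ _ => ?_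
    simp only [Sel, pow_mul]
    constructor
    · intro h v hv
      rw [h ⟨v, hv⟩]
      exact ⟨fun h => ⟨_, h, rfl⟩, fun ⟨w, hw, h⟩ => by rwa [← show w = ⟨v, hv⟩ from Fin.ext h]⟩
    · intro h v
      rw [h v v.2]
      exact ⟨fun ⟨w, hw, h⟩ => by rwa [← show w = v from Fin.ext h], fun h => ⟨_, h, rfl⟩⟩
  rw [h2, h1, Finset.prod_range]
  have h3 : ∀ v : Fin n, ((Finset.range (2 ^ (n + 3))).filter fun x =>
      x < t ↔ ∃ w ∈ U, (w : ℕ) = v).card = if v ∈ U then t else 2 ^ (n + 3) - t := by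
    intro v
    have h4 : (∃ w ∈ U, (w : ℕ) = v) ↔ v ∈ U :=
      ⟨fun ⟨w, hw, h⟩ => by rwa [← show w = v from Fin.ext h], fun h => ⟨_, h, rfl⟩⟩
    have h5 : (Finset.range (2 ^ (n + 3))).filter (fun x => x < t) = Finset.range t := by
      ext x
      simp only [Finset.mem_filter, Finset.mem_range]
      omega
    simp only [h4]
    split_ifs with hv
    · simp only [hv, iff_true]
      rw [h5, Finset.card_range]
    · simp only [hv, iff_false]
      rw [Finset.filter_not, h5, Finset.card_sdiff_of_subset (Finset.range_mono ht),
        Finset.card_range, Finset.card_range]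
  rw [Finset.prod_congr rfl fun v _ => h3 v, Finset.prod_ite, Finset.prod_const, Finset.prod_const]
  congr 2
  · simp
  · rw [Finset.filter_not, Finset.card_sdiff_of_subset (Finset.filter_subset _ _)]
    simp

/-- The number of successful random numbers for a trial. -/
theorem le_card_trial_ne_zero {m t D : ℕ} (H : UniformHypergraph k n) (hn0 : 0 < n)
    (hk : 2 ≤ k) (hn : n = k * m) (hD : D ≤ 2 * m) (ht : t ≤ 2 ^ (n + 3))
    (h𝒮 : ∀ e ∈ 𝒮, e ∈ H.edges) (hcov : ∀ v : Fin n, ∃ e ∈ 𝒮, v ∈ e)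
    (hdisj : ∀ e₁ ∈ 𝒮, ∀ e₂ ∈ 𝒮, e₁ ≠ e₂ → Disjoint e₁ e₂) (hcard : 𝒮.card = m) :
    goodCount 𝒮 D * (t ^ D * (2 ^ (n + 3) - t) ^ (n - D)) *
      2 ^ ((n + 2) * (H.edges.length * (2 * n))) ≤
    2 * ((Finset.range (2 ^ coinsPerTrial n H.edges.length)).filter fun ρ =>
      trial H.encode n k H.edges.length t D ρ ≠ 0).card := by
  classical
  set B := (n + 2) * (H.edges.length * (2 * n)) with hB
  rw [coinsPerTrial, ← hB, pow_add _ _ B, Finset.card_filter, sum_range_mul, Finset.mul_sum]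
  set s := (good 𝒮).filter fun U => U.card = D with hs
  set sel : Finset (Fin n) → Finset ℕ := fun U =>
    (Finset.range (2 ^ ((n + 3) * n))).filter fun ρ => ∀ v : Fin n, Sel n t ρ v ↔ v ∈ U with hsel
  -- Different good sets are selected by different numbers, so their contributions add up.
  have hdisj' : Set.PairwiseDisjoint (s : Set (Finset (Fin n))) sel := by
    intro U _ U' _ hne
    refine Finset.disjoint_left.mpr fun ρ h1 h2 => hne ?_
    ext v
    rw [← (Finset.mem_filter.mp h1).2 v, (Finset.mem_filter.mp h2).2 v]
  have hsub : s.biUnion sel ⊆ Finset.range (2 ^ ((n + 3) * n)) :=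
    Finset.biUnion_subset.mpr fun U _ => Finset.filter_subset _ _
  calc goodCount 𝒮 D * (t ^ D * (2 ^ (n + 3) - t) ^ (n - D)) * 2 ^ B
      = ∑ ρ₁ ∈ s.biUnion sel, 2 ^ B := by
        rw [Finset.sum_const, smul_eq_mul, Finset.card_biUnion hdisj', Finset.sum_congr rfl
          fun U hU => by rw [card_selection ht U, (Finset.mem_filter.mp hU).2], Finset.sum_const,
          smul_eq_mul, goodCount]
    _ ≤ ∑ ρ₁ ∈ s.biUnion sel, 2 * ∑ ρ₂ ∈ Finset.range (2 ^ B),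
          (if trial H.encode n k H.edges.length t D (ρ₁ + 2 ^ ((n + 3) * n) * ρ₂) ≠ 0
            then 1 else 0) := by
        refine Finset.sum_le_sum fun ρ₁ hρ₁ => ?_
        obtain ⟨U, hU, hρU⟩ := Finset.mem_biUnion.mp hρ₁
        obtain ⟨hU, hUD⟩ := Finset.mem_filter.mp hU
        have hUgood := (Finset.mem_filter.mp hU).2
        have hselU := (Finset.mem_filter.mp hρU).2
        have h1 := two_mul_card_trial_eq_zero_le (a := t) (D := D) H hn0 hk hn hD
          (Finset.mem_range.mp (Finset.mem_filter.mp hρU).1) (S := Sel n t ρ₁)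
          (fun _ _ => Iff.rfl) h𝒮 hcov hdisj hcard (fun e he => ?_) ?_
        · rw [← Finset.card_filter]
          have h2 := Finset.card_filter_add_card_filter_not (s := Finset.range (2 ^ B)) fun ρ₂ =>
            trial H.encode n k H.edges.length t D (ρ₁ + 2 ^ ((n + 3) * n) * ρ₂) = 0
          rw [Finset.card_range] at h2
          rw [← hB] at h1
          simp only [ne_eq]
          omega
        · refine le_trans (Finset.card_le_card fun v hv => ?_) (hUgood e he)
          rw [Finset.mem_filter] at hv
          exact Finset.mem_inter.mpr ⟨hv.1, (hselU v).mp hv.2⟩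
        · rw [Fintype.card_subtype, ← hUD]
          congr 1
          ext v
          simp [hselU]
    _ ≤ _ := Finset.sum_le_sum_of_subset hsub

end good

/-! ### The distribution of the random numbers -/

theorem testBit_coinVal (r : ℕ → Bool) (fl N : ℕ) {i : ℕ} (hi : i < N) :
    (coinVal r fl N).testBit i = r (fl + i) := by
  have h := pack_digit (b := 2) (N := N) (f := fun i => (r (fl + i)).toNat)
    (fun _ _ => Bool.toNat_lt _) hi
  rw [Nat.testBit_eq_decide_div_mod_eq, coinVal, ← pack, h]
  cases r (fl + i) <;> rfl

theorem coinVal_eq_digit (r : ℕ → Bool) {fl N M : ℕ} (h : fl + N ≤ M) :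
    coinVal r fl N = coinVal r 0 M / 2 ^ fl % 2 ^ N := by
  refine Nat.eq_of_testBit_eq fun i => ?_
  rw [Nat.testBit_mod_two_pow, Nat.testBit_div_two_pow]
  by_cases hi : i < N
  · rw [testBit_coinVal r fl N hi, testBit_coinVal r 0 M (by omega)]
    simp [hi, add_comm]
  · rw [Nat.testBit_lt_two_pow ((coinVal_lt r fl N).trans_le
      (Nat.pow_le_pow_right (by norm_num) (not_lt.mp hi)))]
    simp [hi]

/-- Only an upper bound is needed, so covering the event by cylinders of measure `2⁻¹ ^ N` suffices.
-/
theorem coinMeasure_coinVal_le (N : ℕ) (P : ℕ → Prop) [DecidablePred P] :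
    coinMeasure {r | P (coinVal r 0 N)} ≤ ((Finset.range (2 ^ N)).filter P).card * (2⁻¹ : ℝ≥0∞) ^ N := by
  have hsub : {r | P (coinVal r 0 N)} ⊆ ⋃ ρ ∈ (Finset.range (2 ^ N)).filter P,
      Set.pi (Finset.range N : Set ℕ) fun i => {ρ.testBit i} := by
    intro r hr
    refine Set.mem_biUnion (x := coinVal r 0 N)
      (Finset.mem_filter.mpr ⟨Finset.mem_range.mpr (coinVal_lt r 0 N), hr⟩) fun i hi => ?_
    rw [Set.mem_singleton_iff, testBit_coinVal r 0 N (Finset.mem_range.mp hi), zero_add]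
  refine (measure_mono hsub).trans ((measure_biUnion_finset_le _ _).trans ?_)
  rw [← nsmul_eq_mul]
  refine Finset.sum_le_card_nsmul _ _ _ fun ρ _ => ?_
  rw [coinMeasure, Measure.infinitePi_pi _ fun i _ => MeasurableSet.of_discrete]
  simp

theorem card_filter_and_mul (a b : ℕ) (P Q : ℕ → Prop) [DecidablePred P] [DecidablePred Q] :
    ((Finset.range (a * b)).filter fun ρ => P (ρ % a) ∧ Q (ρ / a)).card =
      ((Finset.range a).filter P).card * ((Finset.range b).filter Q).card := by
  rw [Finset.card_filter, sum_range_mul, Finset.card_filter, Finset.card_filter,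
    Finset.sum_mul_sum]
  refine Finset.sum_congr rfl fun i hi => Finset.sum_congr rfl fun j hj => ?_
  rw [Finset.mem_range] at hi
  rw [Nat.add_mul_mod_self_left, Nat.mod_eq_of_lt hi, Nat.add_mul_div_left _ _ (by omega),
    Nat.div_eq_of_lt hi, zero_add, ite_and]
  split_ifs <;> simp

theorem mod_two_pow_digit {x M fl N : ℕ} (h : fl + N ≤ M) :
    x % 2 ^ M / 2 ^ fl % 2 ^ N = x / 2 ^ fl % 2 ^ N := by
  refine Nat.eq_of_testBit_eq fun i => ?_
  rw [Nat.testBit_mod_two_pow, Nat.testBit_div_two_pow, Nat.testBit_mod_two_pow,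
    Nat.testBit_mod_two_pow, Nat.testBit_div_two_pow]
  by_cases hi : i < N
  · simp [hi, show i + fl < M by omega]
  · simp [hi]

/-- Blocks of digits: for every `D` there are `N D` blocks of `F` digits. -/
theorem card_blocks (F : ℕ) (N : ℕ → ℕ) (Z : ℕ → ℕ → Prop) [∀ D, DecidablePred (Z D)] (T : ℕ) :
    ((Finset.range (2 ^ ∑ D ∈ Finset.range T, N D * F)).filter fun ρ =>
      ∀ D < T, ∀ i < N D, Z D (ρ / 2 ^ ((∑ D' ∈ Finset.range D, N D' * F) + i * F) % 2 ^ F)).card =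
      ∏ D ∈ Finset.range T, ((Finset.range (2 ^ F)).filter (Z D)).card ^ N D := by
  classical
  induction T with
  | zero => simp
  | succ T ih =>
    have h1 := card_digits (2 ^ F) (N T) fun _ => Z T
    rw [Finset.prod_const, Finset.card_range] at h1
    rw [Finset.prod_range_succ, ← ih, ← h1, ← card_filter_and_mul, Finset.sum_range_succ, pow_add,
      ← pow_mul, mul_comm F (N T)]
    congr 1
    refine Finset.filter_congr fun ρ _ => ?_
    have hdiv : ∀ i, ρ / 2 ^ ((∑ D' ∈ Finset.range T, N D' * F) + i * F) =
        ρ / 2 ^ (∑ D' ∈ Finset.range T, N D' * F) / (2 ^ F) ^ i := by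
      intro i
      rw [Nat.div_div_eq_div_mul, ← pow_mul, ← pow_add, mul_comm F i]
    have hmod : ∀ D < T, ∀ i < N D, ρ % 2 ^ (∑ D' ∈ Finset.range T, N D' * F) /
        2 ^ ((∑ D' ∈ Finset.range D, N D' * F) + i * F) % 2 ^ F =
        ρ / 2 ^ ((∑ D' ∈ Finset.range D, N D' * F) + i * F) % 2 ^ F := by
      intro D hD i hi
      refine mod_two_pow_digit ?_
      calc (∑ D' ∈ Finset.range D, N D' * F) + i * F + F
          = (∑ D' ∈ Finset.range D, N D' * F) + (i + 1) * F := by ring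
        _ ≤ (∑ D' ∈ Finset.range D, N D' * F) + N D * F :=
          Nat.add_le_add_left (Nat.mul_le_mul_right _ hi) _
        _ = ∑ D' ∈ Finset.range (D + 1), N D' * F := (Finset.sum_range_succ _ _).symm
        _ ≤ _ := Finset.sum_le_sum_of_subset (Finset.range_mono hD)
    constructor
    · intro h
      refine ⟨fun D hD i hi => ?_, fun i hi => ?_⟩
      · rw [hmod D hD i hi]
        exact h D (by omega) i hi
      · rw [← hdiv]
        exact h T (by omega) i hi
    · rintro ⟨h2, h3⟩ D hD i hi
      rcases Nat.lt_succ_iff_lt_or_eq.mp hD with hD | rfl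
      · rw [← hmod D hD i hi]
        exact h2 D hD i hi
      · rw [hdiv]
        exact h3 i hi

/-- The probability that no trial is successful. -/
theorem coinMeasure_not_someHit_le {x : List ℕ} {n k L : ℕ} (hn0 : 0 < n) (hnk : n % k = 0) :
    coinMeasure {r | ¬ SomeHit r x n k L} ≤
      ∏ D ∈ Finset.range (2 * (n / k) + 1),
        (((Finset.range (2 ^ coinsPerTrial n L)).filter fun ρ =>
          trial x n k L (thresh n k) D ρ = 0).card * (2⁻¹ : ℝ≥0∞) ^ coinsPerTrial n L) ^
          reps n k D := by
  classical
  set F := coinsPerTrial n L with hF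
  set T := 2 * (n / k) + 1 with hT
  set M := ∑ D ∈ Finset.range T, reps n k D * F with hM
  -- All trials read disjoint blocks of digits of one random number with `M` bits, which yields the
  -- product by `card_blocks`.
  have hset : {r | ¬ SomeHit r x n k L} = {r | ∀ D < T, ∀ i < reps n k D,
      trial x n k L (thresh n k) D
        (coinVal r 0 M / 2 ^ ((∑ D' ∈ Finset.range D, reps n k D' * F) + i * F) % 2 ^ F) = 0} := by
    ext r
    simp only [SomeHit, Hit, Set.mem_ofPred_eq, not_and, not_exists, not_not, hnk, hn0, true_imp_iff,
      ← hF, coinsBefore]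
    refine forall_congr' fun D => forall_congr' fun hD => forall_congr' fun i =>
      forall_congr' fun hi => ?_
    rw [coinVal_eq_digit r (M := M)]
    calc (∑ D' ∈ Finset.range D, reps n k D' * F) + i * F + F
        = (∑ D' ∈ Finset.range D, reps n k D' * F) + (i + 1) * F := by ring
      _ ≤ (∑ D' ∈ Finset.range D, reps n k D' * F) + reps n k D * F :=
        Nat.add_le_add_left (Nat.mul_le_mul_right _ hi) _
      _ = ∑ D' ∈ Finset.range (D + 1), reps n k D' * F := (Finset.sum_range_succ _ _).symm
      _ ≤ _ := Finset.sum_le_sum_of_subset (Finset.range_mono hD)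
  rw [hset]
  refine (coinMeasure_coinVal_le M fun ρ => ∀ D < T, ∀ i < reps n k D,
    trial x n k L (thresh n k) D
      (ρ / 2 ^ ((∑ D' ∈ Finset.range D, reps n k D' * F) + i * F) % 2 ^ F) = 0).trans_eq ?_
  rw [card_blocks F (reps n k) (fun D ρ => trial x n k L (thresh n k) D ρ = 0) T]
  push_cast
  rw [hM, ← Finset.prod_pow_eq_pow_sum, ← Finset.prod_mul_distrib]
  refine Finset.prod_congr rfl fun D _ => ?_
  rw [mul_pow, ← pow_mul, mul_comm F]

/-! ### The probability of success -/

theorem thresh_le (n : ℕ) {k : ℕ} (hk : 2 ≤ k) : thresh n k ≤ 2 ^ (n + 3) := by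
  have h := numer_lt_denom hk
  refine Nat.div_le_of_le_mul ?_
  exact Nat.mul_le_mul_right _ h.le

theorem two_mul_denom_le {n k m D : ℕ} (hn : n = k * m) (hD : D ≤ 2 * m) :
    2 * (D * denom k) ≤ numer k * 2 ^ (n + 3) := by
  have h1 : n < 2 ^ n := Nat.lt_two_pow_self
  have h2 : D * denom k ≤ 2 * m * denom k := Nat.mul_le_mul_right _ hD
  rw [pow_add]
  unfold denom numer at *
  split_ifs at * with h3
  · subst h3
    omega
  · have h4 : 2 * m * (2 * k + 14 * 0) = 4 * n := by rw [hn]; ring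
    omega

/-- Rounding the probability of a selection loses at most a factor of two. -/
theorem pow_thresh_ge {n k m D : ℕ} (hk : 2 ≤ k) (hn : n = k * m) (hD : D ≤ 2 * m) :
    ((numer k : ℝ) / denom k) ^ D ≤ 2 * ((thresh n k : ℝ) / 2 ^ (n + 3)) ^ D := by
  have ha : (0 : ℝ) < numer k := by exact_mod_cast numer_pos k
  have hb : (0 : ℝ) < denom k := by exact_mod_cast (numer_pos k).trans (numer_lt_denom hk)
  have hW : (0 : ℝ) < 2 ^ (n + 3) := by positivity
  -- The relative error of rounding the probability down is at most `x`. As `D * x ≤ 1 / 2`,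
  -- Bernoulli's inequality bounds the loss in the `D`-th power.
  set x : ℝ := denom k / (numer k * 2 ^ (n + 3)) with hx
  have hx0 : 0 ≤ x := by positivity
  have hDx : D * x ≤ 1 / 2 := by
    rw [hx, ← mul_div_assoc, div_le_div_iff₀ (by positivity) (by norm_num), mul_comm, one_mul]
    exact_mod_cast two_mul_denom_le hn hD
  rcases Nat.eq_zero_or_pos D with rfl | hD0
  · norm_num
  have hx1 : x ≤ 1 / 2 := by
    refine le_trans ?_ hDx
    exact le_mul_of_one_le_left hx0 (by exact_mod_cast hD0)
  have hpow : 1 / 2 ≤ (1 - x) ^ D := by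
    have h := one_add_mul_le_pow (show (-2 : ℝ) ≤ -x by linarith) D
    rw [← sub_eq_add_neg] at h
    linarith
  have hfloor : (numer k : ℝ) * 2 ^ (n + 3) ≤ (thresh n k + 1) * denom k := by
    have h := Nat.lt_div_mul_add (a := numer k * 2 ^ (n + 3))
      ((numer_pos k).trans (numer_lt_denom hk))
    have h2 : numer k * 2 ^ (n + 3) ≤ (thresh n k + 1) * denom k := by
      rw [thresh, add_mul, one_mul]
      exact h.le
    exact_mod_cast h2
  have hbase : (numer k : ℝ) / denom k * (1 - x) ≤ thresh n k / 2 ^ (n + 3) := by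
    rw [show (numer k : ℝ) / denom k * (1 - x) =
      (numer k * 2 ^ (n + 3) - denom k) / (denom k * 2 ^ (n + 3)) by rw [hx]; field_simp,
      div_le_div_iff₀ (by positivity) hW]
    nlinarith
  calc ((numer k : ℝ) / denom k) ^ D
      ≤ ((numer k : ℝ) / denom k) ^ D * (2 * (1 - x) ^ D) :=
        le_mul_of_one_le_right (by positivity) (by linarith)
    _ = 2 * ((numer k : ℝ) / denom k * (1 - x)) ^ D := by rw [mul_pow]; ring
    _ ≤ _ := by
      refine mul_le_mul_of_nonneg_left (pow_le_pow_left₀ ?_ hbase D) (by norm_num)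
      exact mul_nonneg (by positivity) (by linarith)

section
variable {n k m : ℕ} (H : UniformHypergraph k n) {𝒮 : Finset (Finset (Fin n))}

/-- The factor 4 collects the factor 2 for rounding the selection probability and the factor 2 for
unlucky weights. Rounding down does not hurt the unselected vertices. -/
theorem success_ge {D : ℕ} (hn0 : 0 < n)
    (hk : 2 ≤ k) (hn : n = k * m) (hD : D ≤ 2 * m)
    (h𝒮 : ∀ e ∈ 𝒮, e ∈ H.edges) (hcov : ∀ v : Fin n, ∃ e ∈ 𝒮, v ∈ e)
    (hdisj : ∀ e₁ ∈ 𝒮, ∀ e₂ ∈ 𝒮, e₁ ≠ e₂ → Disjoint e₁ e₂) (hcard : 𝒮.card = m) :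
    goodCount 𝒮 D * ((numer k : ℝ) ^ D * ((denom k : ℝ) - numer k) ^ (n - D)) /
      (4 * (denom k : ℝ) ^ n) ≤
    (((Finset.range (2 ^ coinsPerTrial n H.edges.length)).filter fun ρ =>
      trial H.encode n k H.edges.length (thresh n k) D ρ ≠ 0).card : ℝ) /
      2 ^ coinsPerTrial n H.edges.length := by
  have hlt := numer_lt_denom hk
  have hb : (0 : ℝ) < denom k := by exact_mod_cast (numer_pos k).trans hlt
  have hab : (numer k : ℝ) ≤ denom k := by exact_mod_cast hlt.le
  have hDn : D ≤ n := by
    have : 2 * m ≤ k * m := Nat.mul_le_mul_right _ hk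
    omega
  have hW : (0 : ℝ) < 2 ^ (n + 3) := by positivity
  have ht := thresh_le n hk
  have h1 := le_card_trial_ne_zero (t := thresh n k) (D := D) H hn0 hk hn hD ht h𝒮 hcov hdisj hcard
  set s := ((Finset.range (2 ^ coinsPerTrial n H.edges.length)).filter fun ρ =>
      trial H.encode n k H.edges.length (thresh n k) D ρ ≠ 0).card with hs
  have h2 : (goodCount 𝒮 D : ℝ) * ((thresh n k : ℝ) ^ D * (2 ^ (n + 3) - thresh n k) ^ (n - D)) *
      2 ^ ((n + 2) * (H.edges.length * (2 * n))) ≤ 2 * s := by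
    have := (Nat.cast_le (α := ℝ)).mpr h1
    push_cast [Nat.cast_sub ht] at this
    exact this
  have h3 : (denom k : ℝ) ^ n = denom k ^ D * denom k ^ (n - D) := by
    rw [← pow_add, Nat.add_sub_cancel' hDn]
  have h4 : (2 : ℝ) ^ coinsPerTrial n H.edges.length = (2 ^ (n + 3)) ^ D *
      (2 ^ (n + 3)) ^ (n - D) * 2 ^ ((n + 2) * (H.edges.length * (2 * n))) := by
    rw [coinsPerTrial, pow_add _ ((n + 3) * n), pow_mul, ← pow_add _ D, Nat.add_sub_cancel' hDn]
  have h5 : ((denom k : ℝ) - numer k) / denom k ≤ (2 ^ (n + 3) - thresh n k) / 2 ^ (n + 3) := by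
    rw [div_le_div_iff₀ hb hW]
    have h6 : thresh n k * denom k ≤ numer k * 2 ^ (n + 3) := Nat.div_mul_le_self _ _
    have h7 : (thresh n k : ℝ) * denom k ≤ numer k * 2 ^ (n + 3) := by exact_mod_cast h6
    linarith
  have h6 := pow_thresh_ge hk hn hD
  have h7 : (((denom k : ℝ) - numer k) / denom k) ^ (n - D) ≤
      ((2 ^ (n + 3) - thresh n k) / 2 ^ (n + 3)) ^ (n - D) :=
    pow_le_pow_left₀ (div_nonneg (by linarith) hb.le) h5 _
  calc goodCount 𝒮 D * ((numer k : ℝ) ^ D * ((denom k : ℝ) - numer k) ^ (n - D)) /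
        (4 * (denom k : ℝ) ^ n)
      = 1 / 4 * goodCount 𝒮 D * (((numer k : ℝ) / denom k) ^ D *
          (((denom k : ℝ) - numer k) / denom k) ^ (n - D)) := by
        rw [h3, div_pow, div_pow]
        field_simp
    _ ≤ 1 / 4 * goodCount 𝒮 D * ((2 * ((thresh n k : ℝ) / 2 ^ (n + 3)) ^ D) *
          ((2 ^ (n + 3) - thresh n k) / 2 ^ (n + 3)) ^ (n - D)) := by
        refine mul_le_mul_of_nonneg_left (mul_le_mul h6 h7 ?_ (by positivity)) (by positivity)
        exact pow_nonneg (div_nonneg (by linarith) hb.le) _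
    _ = 1 / 2 * (goodCount 𝒮 D * ((thresh n k : ℝ) ^ D * (2 ^ (n + 3) - thresh n k) ^ (n - D)) *
          2 ^ ((n + 2) * (H.edges.length * (2 * n)))) / 2 ^ coinsPerTrial n H.edges.length := by
        rw [h4, div_pow, div_pow]
        field_simp
        ring
    _ ≤ 1 / 2 * (2 * s) / 2 ^ coinsPerTrial n H.edges.length := by gcongr
    _ = _ := by ring

/-- Without rounding, the factor `2 ^ D` in `reps` turns the sum into that of `sum_good`, and the
result is (4n+1)/4. Rounding each number of trials down loses at most 1/4, because the selection
probabilities of the good sets add up to at most 1. -/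
theorem le_sum_reps (hk : 2 ≤ k) (hn : n = k * m)
    (hcov : ∀ v : Fin n, ∃ e ∈ 𝒮, v ∈ e)
    (hdisj : ∀ e₁ ∈ 𝒮, ∀ e₂ ∈ 𝒮, e₁ ≠ e₂ → Disjoint e₁ e₂) (hcard : 𝒮.card = m)
    (h𝒮 : ∀ e ∈ 𝒮, e.card = k) :
    (n : ℝ) ≤ ∑ D ∈ Finset.range (2 * m + 1), reps n k D *
      (goodCount 𝒮 D * ((numer k : ℝ) ^ D * ((denom k : ℝ) - numer k) ^ (n - D)) /
        (4 * (denom k : ℝ) ^ n)) := by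
  have hlt := numer_lt_denom hk
  have hb : (0 : ℝ) < denom k := by exact_mod_cast (numer_pos k).trans hlt
  have hba : (0 : ℝ) ≤ (denom k : ℝ) - numer k := by
    rw [sub_nonneg]
    exact_mod_cast hlt.le
  have hg : (0 : ℝ) < smallWeight k := by exact_mod_cast smallWeight_pos hk
  have hm : n / k = m := by rw [hn]; exact Nat.mul_div_cancel_left _ (by omega)
  have hreps : ∀ D, (4 * n + 1) * 2 ^ D * (denom k : ℝ) ^ n / smallWeight k ^ m - 1 ≤
      reps n k D := by
    intro D
    have h := Nat.lt_div_mul_add (a := (4 * n + 1) * 2 ^ D * denom k ^ n)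
      (b := smallWeight k ^ m) (pow_pos (smallWeight_pos hk) m)
    have h2 : (4 * n + 1) * 2 ^ D * denom k ^ n ≤ (reps n k D + 1) * smallWeight k ^ m := by
      rw [reps, hm]
      exact h.le.trans_eq (by ring)
    have h3 : (4 * n + 1) * 2 ^ D * (denom k : ℝ) ^ n ≤ (reps n k D + 1) * smallWeight k ^ m := by
      exact_mod_cast h2
    rw [sub_le_iff_le_add, div_le_iff₀ (by positivity)]
    exact h3
  have hsum1 : ∑ D ∈ Finset.range (2 * m + 1), (goodCount 𝒮 D : ℝ) *
      ((2 * numer k) ^ D * ((denom k : ℝ) - numer k) ^ (n - D)) = smallWeight k ^ m := by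
    rw [← hcard, sum_goodCount hcov hdisj fun D => (2 * (numer k : ℝ)) ^ D *
      ((denom k : ℝ) - numer k) ^ (n - D), sum_good hk hcov hdisj h𝒮, smallWeight_eq]
    push_cast [Nat.cast_sub hlt.le]
    rfl
  have hsum2 : ∑ D ∈ Finset.range (2 * m + 1), (goodCount 𝒮 D : ℝ) *
      ((numer k : ℝ) ^ D * ((denom k : ℝ) - numer k) ^ (n - D)) ≤ denom k ^ n := by
    rw [← hcard, sum_goodCount hcov hdisj fun D => (numer k : ℝ) ^ D *
      ((denom k : ℝ) - numer k) ^ (n - D)]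
    have h := Fintype.sum_pow_mul_eq_add_pow (Fin n) (numer k : ℝ) ((denom k : ℝ) - numer k)
    rw [Fintype.card_fin, add_sub_cancel] at h
    rw [← h]
    exact Finset.sum_le_sum_of_subset_of_nonneg (Finset.subset_univ _) fun U _ _ =>
      mul_nonneg (by positivity) (pow_nonneg hba _)
  calc (n : ℝ) = (4 * n + 1) / (4 * smallWeight k ^ m) * smallWeight k ^ m -
        1 / (4 * (denom k : ℝ) ^ n) * denom k ^ n := by
        field_simp
        ring
    _ ≤ (4 * n + 1) / (4 * smallWeight k ^ m) * (∑ D ∈ Finset.range (2 * m + 1),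
          (goodCount 𝒮 D : ℝ) * ((2 * numer k) ^ D * ((denom k : ℝ) - numer k) ^ (n - D))) -
        1 / (4 * (denom k : ℝ) ^ n) * ∑ D ∈ Finset.range (2 * m + 1), (goodCount 𝒮 D : ℝ) *
          ((numer k : ℝ) ^ D * ((denom k : ℝ) - numer k) ^ (n - D)) := by
        rw [hsum1]
        gcongr
    _ = ∑ D ∈ Finset.range (2 * m + 1),
          ((4 * n + 1) * 2 ^ D * (denom k : ℝ) ^ n / smallWeight k ^ m - 1) *
          (goodCount 𝒮 D * ((numer k : ℝ) ^ D * ((denom k : ℝ) - numer k) ^ (n - D)) /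
            (4 * (denom k : ℝ) ^ n)) := by
        rw [Finset.mul_sum, Finset.mul_sum, ← Finset.sum_sub_distrib]
        refine Finset.sum_congr rfl fun D _ => ?_
        rw [mul_pow]
        field_simp
    _ ≤ _ := by
        refine Finset.sum_le_sum fun D _ => mul_le_mul_of_nonneg_right (hreps D) ?_
        exact div_nonneg (mul_nonneg (by positivity) (mul_nonneg (by positivity)
          (pow_nonneg hba _))) (by positivity)

theorem coinMeasure_not_someHit_le_of_hasExactCover (hk : 2 ≤ k) (hn0 : 0 < n)
    (hH : H.HasExactCover) :
    coinMeasure {r | ¬ SomeHit r H.encode n k H.edges.length} ≤ (2⁻¹ : ℝ≥0∞) ^ n := by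
  obtain ⟨𝒮, h𝒮, hcov, hdisj⟩ := hH
  have h𝒮k : ∀ e ∈ 𝒮, e.card = k := fun e he => H.card_eq e (h𝒮 e he)
  obtain ⟨m, hcard⟩ : ∃ m, 𝒮.card = m := ⟨_, rfl⟩
  have hn : n = k * m := by rw [← hcard]; exact mul_card_eq hcov hdisj h𝒮k
  have hm : n / k = m := by rw [hn]; exact Nat.mul_div_cancel_left _ (by omega)
  have hnk : n % k = 0 := by rw [hn]; exact Nat.mul_mod_right _ _
  refine (coinMeasure_not_someHit_le hn0 hnk).trans ?_
  rw [hm]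
  set F := coinsPerTrial n H.edges.length with hF
  set z : ℕ → ℕ := fun D => ((Finset.range (2 ^ F)).filter fun ρ =>
    trial H.encode n k H.edges.length (thresh n k) D ρ = 0).card with hz
  set s : ℕ → ℕ := fun D => ((Finset.range (2 ^ F)).filter fun ρ =>
    trial H.encode n k H.edges.length (thresh n k) D ρ ≠ 0).card with hs
  have hzs : ∀ D, (z D : ℝ) / 2 ^ F = 1 - s D / 2 ^ F := by
    intro D
    have h := Finset.card_filter_add_card_filter_not (s := Finset.range (2 ^ F)) fun ρ =>
      trial H.encode n k H.edges.length (thresh n k) D ρ = 0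
    rw [Finset.card_range] at h
    have h2 : (z D : ℝ) + s D = 2 ^ F := by exact_mod_cast h
    rw [eq_sub_iff_add_eq, ← add_div, h2, div_self (by positivity)]
  have hfac : ∀ D, (z D : ℝ≥0∞) * (2⁻¹ : ℝ≥0∞) ^ F = ENNReal.ofReal (z D / 2 ^ F) := by
    intro D
    rw [ENNReal.ofReal_div_of_pos (by positivity), ENNReal.ofReal_natCast,
      ENNReal.ofReal_pow (by norm_num), ENNReal.ofReal_ofNat, div_eq_mul_inv, ENNReal.inv_pow]
  have hprod : ∏ D ∈ Finset.range (2 * m + 1), ((z D : ℝ≥0∞) * (2⁻¹ : ℝ≥0∞) ^ F) ^ reps n k D =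
      ENNReal.ofReal (∏ D ∈ Finset.range (2 * m + 1), ((z D : ℝ) / 2 ^ F) ^ reps n k D) := by
    rw [ENNReal.ofReal_prod_of_nonneg fun D _ => by positivity]
    refine Finset.prod_congr rfl fun D _ => ?_
    rw [hfac, ENNReal.ofReal_pow (by positivity)]
  have hright : (2⁻¹ : ℝ≥0∞) ^ n = ENNReal.ofReal ((2 : ℝ)⁻¹ ^ n) := by
    rw [ENNReal.ofReal_pow (by norm_num), ENNReal.ofReal_inv_of_pos (by norm_num),
      ENNReal.ofReal_ofNat]
  rw [hprod, hright]
  refine ENNReal.ofReal_le_ofReal ?_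
  calc ∏ D ∈ Finset.range (2 * m + 1), ((z D : ℝ) / 2 ^ F) ^ reps n k D
      ≤ ∏ D ∈ Finset.range (2 * m + 1), Real.exp (-(reps n k D * (s D / 2 ^ F))) := by
        refine Finset.prod_le_prod (fun D _ => by positivity) fun D _ => ?_
        rw [← mul_neg, Real.exp_nat_mul]
        refine pow_le_pow_left₀ (by positivity) ?_ _
        rw [hzs]
        exact Real.one_sub_le_exp_neg _
    _ = Real.exp (-∑ D ∈ Finset.range (2 * m + 1), (reps n k D : ℝ) * ((s D : ℝ) / 2 ^ F)) := by
        rw [← Real.exp_sum, Finset.sum_neg_distrib]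
    _ ≤ Real.exp (-n) := by
        refine Real.exp_le_exp.mpr (neg_le_neg ?_)
        refine (le_sum_reps hk hn hcov hdisj hcard h𝒮k).trans (Finset.sum_le_sum fun D hD => ?_)
        refine mul_le_mul_of_nonneg_left ?_ (Nat.cast_nonneg _)
        exact success_ge H hn0 hk hn (by rw [Finset.mem_range] at hD; omega) h𝒮 hcov hdisj hcard
    _ = (Real.exp 1)⁻¹ ^ n := by
        rw [← Real.exp_neg, ← Real.exp_nat_mul, mul_neg, mul_one]
    -- The expected number of successes is at least n, and 2 ≤ e.
    _ ≤ (2 : ℝ)⁻¹ ^ n := by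
        refine pow_le_pow_left₀ (by positivity) ?_ _
        refine inv_anti₀ (by norm_num) ?_
        have := Real.add_one_le_exp 1
        linarith

end

/-! ### The constants -/

/-- The base of the running time that the analysis of the algorithm yields, to the power `k`. -/
noncomputable def ratio (k : ℕ) : ℝ := (2 * denom k : ℝ) ^ k / smallWeight k

/-- The base of the running time. -/
noncomputable def growth (k : ℕ) : ℝ :=
  if k = 3 then 1.496 else if k = 4 then 1.642 else if k = 5 then 1.721 else
    if k = 6 then 1.771 else if k = 7 then 1.806 else ratio k ^ (1 / (k : ℝ))

/-- The quantity in the bound for the base of the running time. -/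
noncomputable def boundBase (k : ℕ) : ℝ :=
  8.415 * (k : ℝ) ^ (0.9 - (k : ℝ)) * ((k : ℝ) - 1) ^ (0.6 : ℝ) *
    ((k : ℝ) - 1.5) ^ ((k : ℝ) - 1.5)

theorem one_le_ratio {k : ℕ} (hk : 2 ≤ k) : 1 ≤ ratio k := by
  have hg : (0 : ℝ) < smallWeight k := by exact_mod_cast smallWeight_pos hk
  rw [ratio, le_div_iff₀ hg, one_mul]
  exact_mod_cast smallWeight_le hk

theorem growth_pow_of_ne {k : ℕ} (hk : 2 ≤ k) (h : k = 2 ∨ 8 ≤ k) : growth k ^ k = ratio k := by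
  have h0 := one_le_ratio hk
  rw [growth, if_neg (by omega), if_neg (by omega), if_neg (by omega), if_neg (by omega),
    if_neg (by omega), ← Real.rpow_mul_natCast (by linarith),
    one_div_mul_cancel (by exact_mod_cast (by omega : k ≠ 0)), Real.rpow_one]

/-- For k = 3, …, 7 the constants are decimal upper bounds for the k-th root of `ratio k`, which is
checked with rational numbers. -/
theorem ratio_le_growth_pow {k : ℕ} (hk : 2 ≤ k) : ratio k ≤ growth k ^ k := by
  by_cases h : k = 2 ∨ 8 ≤ k
  · exact (growth_pow_of_ne hk h).ge
  · obtain rfl | rfl | rfl | rfl | rfl : k = 3 ∨ k = 4 ∨ k = 5 ∨ k = 6 ∨ k = 7 := by omega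
    all_goals
      norm_num [ratio, growth, denom, smallWeight, numer]

theorem one_le_growth {k : ℕ} (hk : 2 ≤ k) : 1 ≤ growth k := by
  by_cases h : k = 2 ∨ 8 ≤ k
  · rw [growth, if_neg (by omega), if_neg (by omega), if_neg (by omega), if_neg (by omega),
      if_neg (by omega)]
    exact Real.one_le_rpow (one_le_ratio hk) (by positivity)
  · obtain rfl | rfl | rfl | rfl | rfl : k = 3 ∨ k = 4 ∨ k = 5 ∨ k = 6 ∨ k = 7 := by omega
    all_goals norm_num [growth]

theorem boundBase_pos {k : ℕ} (hk : 2 ≤ k) : 0 < boundBase k := by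
  have h : (2 : ℝ) ≤ k := by exact_mod_cast hk
  unfold boundBase
  have h1 : (0 : ℝ) < (k : ℝ) - 1 := by linarith
  have h2 : (0 : ℝ) < (k : ℝ) - 1.5 := by linarith
  positivity

theorem lt_of_boundBase_mul_lt {k : ℕ} (hk : 2 ≤ k) {c : ℝ} (h : boundBase k * c ^ k < 2 ^ k) :
    c < 2 * boundBase k ^ (-1 / (k : ℝ)) := by
  have hE := boundBase_pos hk
  have hk0 : (k : ℝ) ≠ 0 := by exact_mod_cast (by omega : k ≠ 0)
  refine lt_of_pow_lt_pow_left₀ k (by positivity) ?_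
  rw [mul_pow, ← Real.rpow_mul_natCast hE.le, div_mul_cancel₀ _ hk0, Real.rpow_neg_one,
    ← div_eq_mul_inv, lt_div_iff₀ hE, mul_comm]
  exact h

/-- The tenth power clears the exponents with one decimal, so that small cases reduce to rational
arithmetic. -/
theorem boundBase_pow_ten {k : ℕ} (hk : 2 ≤ k) : boundBase k ^ 10 =
    8.415 ^ 10 * ((k : ℝ) - 1) ^ 6 * ((k : ℝ) - 1.5) ^ (10 * k - 15) / (k : ℝ) ^ (10 * k - 9) := by
  have h : (2 : ℝ) ≤ k := by exact_mod_cast hk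
  have h1 : (0 : ℝ) ≤ (k : ℝ) - 1 := by linarith
  have h2 : (0 : ℝ) ≤ (k : ℝ) - 1.5 := by linarith
  have h3 : ((k : ℝ) ^ (0.9 - (k : ℝ))) ^ 10 = ((k : ℝ) ^ (10 * k - 9))⁻¹ := by
    rw [← Real.rpow_natCast _ (10 * k - 9), ← Real.rpow_neg (by linarith),
      ← Real.rpow_mul_natCast (by linarith), Nat.cast_sub (by omega)]
    congr 1
    push_cast
    ring
  have h4 : (((k : ℝ) - 1) ^ (0.6 : ℝ)) ^ 10 = ((k : ℝ) - 1) ^ 6 := by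
    rw [← Real.rpow_natCast _ 6, ← Real.rpow_mul_natCast h1]
    norm_num
  have h5 : (((k : ℝ) - 1.5) ^ ((k : ℝ) - 1.5)) ^ 10 = ((k : ℝ) - 1.5) ^ (10 * k - 15) := by
    rw [← Real.rpow_natCast _ (10 * k - 15), ← Real.rpow_mul_natCast h2, Nat.cast_sub (by omega)]
    congr 1
    push_cast
    ring
  rw [boundBase, mul_pow, mul_pow, mul_pow, h3, h4, h5]
  ring

theorem boundBase_mul_lt_of_pow {k : ℕ} (hk : 2 ≤ k) {x : ℝ}
    (h : 8.415 ^ 10 * ((k : ℝ) - 1) ^ 6 * ((k : ℝ) - 1.5) ^ (10 * k - 15) / (k : ℝ) ^ (10 * k - 9) *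
      x ^ 10 < (2 ^ k) ^ 10) : boundBase k * x < 2 ^ k := by
  refine lt_of_pow_lt_pow_left₀ 10 (by positivity) ?_
  rw [mul_pow, boundBase_pow_ten hk]
  exact h

/-- With p = 3/(2k), the terms j = 0, 1, 2 of the sum of C(k, j) (2p)^j (1-p)^(k-j) are (1-p)^k
times 1, 3(1+u) and 4.5(1+u)(1+u/3). -/
theorem ratio_of_eight_le {k : ℕ} (hk : 8 ≤ k) {u : ℝ} (hu : u = 1.5 / ((k : ℝ) - 1.5)) :
    ratio k = 2 ^ k / ((((k : ℝ) - 1.5) / k) ^ k * (8.5 + 9 * u + 1.5 * u ^ 2)) := by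
  have h : (8 : ℝ) ≤ k := by exact_mod_cast hk
  have h2 : (0 : ℝ) < (k : ℝ) - 1.5 := by linarith
  have hg : (smallWeight k : ℝ) = (2 * k) ^ k *
      ((((k : ℝ) - 1.5) / k) ^ k * (8.5 + 9 * u + 1.5 * u ^ 2)) := by
    have hnum : numer k = 3 := by simp [numer, show k ≠ 3 by omega]
    have hden : denom k = 2 * k := by simp [denom, show k ≠ 3 by omega]
    have hch : (k.choose 2 : ℝ) = k * (k - 1) / 2 := Nat.cast_choose_two ℝ k
    obtain ⟨j, rfl⟩ : ∃ j, k = j + 2 := ⟨k - 2, by omega⟩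
    rw [smallWeight_eq, hnum, hden]
    simp only [Finset.sum_range_succ, Finset.sum_range_zero]
    push_cast [Nat.cast_sub (show 3 ≤ 2 * (j + 2) by omega)] at *
    rw [hch, ← mul_assoc, ← mul_pow, hu]
    have e1 : 2 * ((j : ℝ) + 2) * (((j : ℝ) + 2 - 1.5) / (j + 2)) = 2 * (j + 2) - 3 := by
      field_simp
      ring
    have e2 : (j : ℝ) + 2 - 1.5 = (2 * (j + 2) - 3) / 2 := by ring
    rw [e1, e2]
    have h3 : (0 : ℝ) < 2 * ((j : ℝ) + 2) - 3 := by linarith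
    simp only [Nat.choose_zero_right, Nat.choose_one_right, pow_succ]
    push_cast
    field_simp
    ring
  have hden : denom k = 2 * k := by simp [denom, show k ≠ 3 by omega]
  rw [ratio, hg, hden]
  push_cast
  rw [mul_pow 2 (2 * (k : ℝ)), mul_comm (2 ^ k : ℝ), mul_div_mul_left]
  exact pow_ne_zero _ (by linarith)

/-- Writing k = (k-1.5)(1+u) and k-1 = (k-1.5)(1+u/3) reduces the claim to 8.415 (1+u)^0.9
(1+u/3)^0.6 < 8.5 + 9u + 1.5u². Bernoulli's inequality makes the left side quadratic, and u ≤ 3/13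
suffices. -/
theorem boundBase_lt_of_eight_le {k : ℕ} (hk : 8 ≤ k) {u : ℝ} (hu : u = 1.5 / ((k : ℝ) - 1.5)) :
    boundBase k < (((k : ℝ) - 1.5) / k) ^ k * (8.5 + 9 * u + 1.5 * u ^ 2) := by
  have h : (8 : ℝ) ≤ k := by exact_mod_cast hk
  have h0 : (0 : ℝ) < k := by linarith
  have h1 : (0 : ℝ) < (k : ℝ) - 1 := by linarith
  have h2 : (0 : ℝ) < (k : ℝ) - 1.5 := by linarith
  have hu0 : 0 ≤ u := by rw [hu]; positivity
  have hu1 : u ≤ 3 / 13 := by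
    rw [hu, div_le_div_iff₀ h2 (by norm_num)]
    linarith
  have e1 : (k : ℝ) = ((k : ℝ) - 1.5) * (1 + u) := by rw [hu]; field_simp; ring
  have e2 : (k : ℝ) - 1 = ((k : ℝ) - 1.5) * (1 + u / 3) := by rw [hu]; field_simp; ring
  have b1 : (1 + u) ^ (0.9 : ℝ) ≤ 1 + 0.9 * u :=
    rpow_one_add_le_one_add_mul_self (by linarith) (by norm_num) (by norm_num)
  have b2 : (1 + u / 3) ^ (0.6 : ℝ) ≤ 1 + 0.6 * (u / 3) :=
    rpow_one_add_le_one_add_mul_self (by linarith) (by norm_num) (by norm_num)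
  have e3 : boundBase k = (((k : ℝ) - 1.5) / k) ^ k *
      (8.415 * (1 + u) ^ (0.9 : ℝ) * (1 + u / 3) ^ (0.6 : ℝ)) := by
    have f1 : (k : ℝ) ^ (0.9 : ℝ) = ((k : ℝ) - 1.5) ^ (0.9 : ℝ) * (1 + u) ^ (0.9 : ℝ) := by
      rw [← Real.mul_rpow h2.le (by linarith), ← e1]
    have f2 : ((k : ℝ) - 1) ^ (0.6 : ℝ) = ((k : ℝ) - 1.5) ^ (0.6 : ℝ) * (1 + u / 3) ^ (0.6 : ℝ) := by
      rw [← Real.mul_rpow h2.le (by linarith), ← e2]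
    have f3 : ((k : ℝ) - 1.5) ^ (0.9 : ℝ) * ((k : ℝ) - 1.5) ^ (0.6 : ℝ) =
        ((k : ℝ) - 1.5) ^ (1.5 : ℝ) := by
      rw [← Real.rpow_add h2]
      norm_num
    rw [boundBase, Real.rpow_sub h0, Real.rpow_sub h2, Real.rpow_natCast, Real.rpow_natCast, f1, f2,
      ← f3, div_pow]
    field_simp
  rw [e3]
  refine mul_lt_mul_of_pos_left ?_ (by positivity)
  calc 8.415 * (1 + u) ^ (0.9 : ℝ) * (1 + u / 3) ^ (0.6 : ℝ)
      ≤ 8.415 * (1 + 0.9 * u) * (1 + 0.6 * (u / 3)) := by gcongr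
    _ < _ := by nlinarith

theorem growth_lt {k : ℕ} (hk : 2 ≤ k) : growth k < 2 * boundBase k ^ (-1 / (k : ℝ)) := by
  refine lt_of_boundBase_mul_lt hk ?_
  rcases le_or_gt 8 k with h8 | h8
  · rw [growth_pow_of_ne hk (Or.inr h8), ratio_of_eight_le h8 rfl]
    have h := boundBase_lt_of_eight_le h8 rfl
    have h0 := boundBase_pos hk
    rw [← mul_div_assoc, div_lt_iff₀ (h0.trans h), mul_comm]
    exact mul_lt_mul_of_pos_left h (by positivity)
  · refine boundBase_mul_lt_of_pow hk ?_
    obtain rfl | rfl | rfl | rfl | rfl | rfl : k = 2 ∨ k = 3 ∨ k = 4 ∨ k = 5 ∨ k = 6 ∨ k = 7 := by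
      omega
    · rw [growth_pow_of_ne le_rfl (Or.inl rfl)]
      norm_num [ratio, denom, smallWeight, numer]
    all_goals norm_num [growth]

/-! ### Correctness and running time of the program -/

section
variable {k n : ℕ} (H : UniformHypergraph k n)

theorem answersNo_coverProg (hk : 2 ≤ k) (h : ¬ H.HasExactCover) (r : ℕ → Bool) :
    AnswersNo coverProg H.encode r := by
  classical
  obtain ⟨σ, t, s, h1, h2, -⟩ := exec_coverProg H hk r (w := work n k) fun _ => le_rfl
  refine ⟨σ, t, s, h1, ?_⟩
  rw [h2, if_neg fun h3 => h (hasExactCover_of_someHit H (by omega) h3)]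

theorem answersYes_coverProg (hk : 2 ≤ k) {r : ℕ → Bool}
    (h : SomeHit r H.encode n k H.edges.length) : AnswersYes coverProg H.encode r := by
  classical
  obtain ⟨σ, t, s, h1, h2, -⟩ := exec_coverProg H hk r (w := work n k) fun _ => le_rfl
  refine ⟨σ, t, s, h1, ?_⟩
  rw [h2, if_pos h]
  exact one_ne_zero

theorem coinMeasure_not_answersYes_le (hk : 2 ≤ k) (h : H.HasExactCover) :
    coinMeasure {r | ¬ AnswersYes coverProg H.encode r} ≤ (2⁻¹ : ℝ≥0∞) ^ n := by
  rcases Nat.eq_zero_or_pos n with rfl | hn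
  · have : IsProbabilityMeasure coinMeasure := by unfold coinMeasure; infer_instance
    rw [pow_zero]
    exact prob_le_one
  · refine (measure_mono fun r hr => ?_).trans
      (coinMeasure_not_someHit_le_of_hasExactCover H hk hn h)
    exact fun h => hr (answersYes_coverProg H hk h)

/-- For n = km the quotient defining `work` is, before rounding, `(4 * n + 1) * ratio k ^ m`. -/
theorem work_le (hk : 2 ≤ k) (hn : n % k = 0) :
    (work n k : ℝ) ≤ (4 * n + 1) * growth k ^ n := by
  have hg : (0 : ℝ) < smallWeight k := by exact_mod_cast smallWeight_pos hk
  obtain ⟨m, hm⟩ : ∃ m, n / k = m := ⟨_, rfl⟩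
  have hnm : n = k * m := by rw [← hm]; exact (Nat.mul_div_cancel' (Nat.dvd_of_mod_eq_zero hn)).symm
  calc (work n k : ℝ) ≤ ((4 * n + 1) * 2 ^ n * denom k ^ n : ℕ) / (smallWeight k ^ m : ℕ) := by
        rw [work, hm]
        exact Nat.cast_div_le
    _ = (4 * n + 1) * ratio k ^ m := by
        rw [ratio, div_pow, ← pow_mul, ← hnm, mul_pow]
        push_cast
        ring
    _ ≤ (4 * n + 1) * (growth k ^ k) ^ m := by
        have h0 := one_le_ratio hk
        exact mul_le_mul_of_nonneg_left
          (pow_le_pow_left₀ (by linarith) (ratio_le_growth_pow hk) m) (by positivity)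
    _ = (4 * n + 1) * growth k ^ n := by rw [← pow_mul, ← hnm]

/-- A bound for the space, and for the time up to an exponential factor. -/
def resourceBound (z : ℕ) : ℕ :=
  (4 * z + 2) * (wordBound z ^ 560 * (40 * (wordBound z + 1) ^ 2)) +
    ((wordBound z + wordBound z) * (1 + wordBound z + wordBound z) + 2)

theorem runsWithin_coverProg (hk : 2 ≤ k) :
    RunsWithin coverProg H.encode
      ((resourceBound (n + k + H.edges.length) : ℕ) * growth k ^ n)
      (resourceBound (n + k + H.edges.length)) := by
  intro r
  have hc := one_le_pow₀ (one_le_growth hk) (n := n)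
  -- If `k` does not divide `n`, the loops are never entered and `w = 0` will do; `work_le` needs
  -- divisibility.
  obtain ⟨w, hw, hwc⟩ : ∃ w : ℕ, (n % k = 0 → work n k ≤ w) ∧
      (w : ℝ) ≤ (4 * n + 1) * growth k ^ n := by
    by_cases hn : n % k = 0
    · exact ⟨work n k, fun _ => le_rfl, work_le hk hn⟩
    · exact ⟨0, fun h => absurd h hn, by rw [Nat.cast_zero]; positivity⟩
  obtain ⟨σ, t, s, h1, -, h2, h3⟩ := exec_coverProg H hk r hw
  refine ⟨σ, t, s, h1, ?_, h3.trans (Nat.le_add_left _ _)⟩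
  set z := n + k + H.edges.length with hz
  obtain ⟨B, hB⟩ : ∃ B, wordBound z ^ 560 * (40 * (wordBound z + 1) ^ 2) = B := ⟨_, rfl⟩
  rw [hB] at h2
  have hnz : (n : ℝ) ≤ z := by exact_mod_cast (by omega : n ≤ z)
  calc (t : ℝ) ≤ ((w + 1) * B : ℕ) := by exact_mod_cast h2
    _ = ((w : ℝ) + 1) * (B : ℕ) := by push_cast; ring
    _ ≤ ((4 * n + 1) * growth k ^ n + growth k ^ n) * (B : ℕ) := by gcongr
    _ = ((4 * n + 2) * (B : ℕ)) * growth k ^ n := by ring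
    _ ≤ ((4 * z + 2) * (B : ℕ)) * growth k ^ n := by gcongr
    _ = ((4 * z + 2) * B : ℕ) * growth k ^ n := by push_cast; ring
    _ ≤ (resourceBound z : ℕ) * growth k ^ n := by
        refine mul_le_mul_of_nonneg_right ?_ (by linarith)
        rw [resourceBound, hB]
        exact_mod_cast Nat.le_add_right _ _

theorem length_edges_le (h : H.edges.Nodup) : H.edges.length ≤ n ^ k := by
  classical
  rw [← List.toFinset_card_of_nodup h]
  calc H.edges.toFinset.card ≤ (Finset.powersetCard k (Finset.univ : Finset (Fin n))).card := by
        refine Finset.card_le_card fun e he => ?_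
        rw [Finset.mem_powersetCard]
        exact ⟨Finset.subset_univ _, H.card_eq e (List.mem_toFinset.mp he)⟩
    _ = n.choose k := by rw [Finset.card_powersetCard, Finset.card_univ, Fintype.card_fin]
    _ ≤ n ^ k := Nat.choose_le_pow n k

end

theorem eval_mono (p : Polynomial ℕ) {a b : ℕ} (h : a ≤ b) : p.eval a ≤ p.eval b := by
  rw [Polynomial.eval_eq_sum_range, Polynomial.eval_eq_sum_range]
  gcongr

open Polynomial in
theorem exists_eval_eq_resourceBound : ∃ p : ℕ[X], ∀ z, p.eval z = resourceBound z := by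
  obtain ⟨q, hq⟩ : ∃ q : ℕ[X], ∀ z, q.eval z = wordBound z := by
    refine ⟨600 + (3 * X + 20) + (3 + X * X + X) +
      ((X + 3) * X + (X + 2) * (X * (2 * X)) + X + 5) +
      (2 * X * (2 * X + 4) * (2 * X * (2 * X)) + 2 * X * (2 * X + 4) + (2 * X + 4) + 1) +
      ((4 * X + 28) * (X + X) + 6 * X + 300 * X * X + 300), fun z => ?_⟩
    simp [wordBound]
  refine ⟨(4 * X + 2) * (q ^ 560 * (40 * (q + 1) ^ 2)) + ((q + q) * (1 + q + q) + 2), fun z => ?_⟩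
  simp [resourceBound, hq]

theorem RunsWithin.mono {P : Prog} {x : List ℕ} {T T' : ℝ} {S S' : ℕ} (h : RunsWithin P x T S)
    (hT : T ≤ T') (hS : S ≤ S') : RunsWithin P x T' S' := fun r =>
  let ⟨σ, t, s, h1, h2, h3⟩ := h r
  ⟨σ, t, s, h1, h2.trans hT, h3.trans hS⟩

end XkC

theorem theorem2 :
    ∃ c : ℕ → ℝ,
      -- the constants
      (c 3 = 1.496 ∧ c 4 = 1.642 ∧ c 5 = 1.721 ∧ c 6 = 1.771 ∧ c 7 = 1.806 ∧
        ∀ k : ℕ, 2 ≤ k →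
          c k < 2 * (8.415 * (k : ℝ) ^ (0.9 - (k : ℝ)) * ((k : ℝ) - 1) ^ (0.6 : ℝ) *
            ((k : ℝ) - 1.5) ^ ((k : ℝ) - 1.5)) ^ (-1 / (k : ℝ))) ∧
      -- one algorithm for all `k`
      ∃ P : XkC.Prog,
        -- it never errs on instances without a cover, and rarely on instances with a cover
        (∀ k n : ℕ, 2 ≤ k → ∀ H : XkC.UniformHypergraph k n,
          (¬ H.HasExactCover → ∀ r : ℕ → Bool, XkC.AnswersNo P H.encode r) ∧
          (H.HasExactCover →
            XkC.coinMeasure {r | ¬ XkC.AnswersYes P H.encode r} ≤ (2⁻¹ : ℝ≥0∞) ^ n)) ∧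
        -- time and space, up to a polynomial in `n`, `k` and the number of edges
        (∃ p : Polynomial ℕ, ∀ k n : ℕ, 2 ≤ k → ∀ H : XkC.UniformHypergraph k n,
          XkC.RunsWithin P H.encode
            ((p.eval (n + k + H.edges.length) : ℕ) * c k ^ n)
            (p.eval (n + k + H.edges.length))) ∧
        -- for fixed `k` and without repeated edges, up to a polynomial in `n` alone
        (∀ k : ℕ, 2 ≤ k → ∃ q : Polynomial ℕ, ∀ n : ℕ, ∀ H : XkC.UniformHypergraph k n,
          H.edges.Nodup →
            XkC.RunsWithin P H.encode ((q.eval n : ℕ) * c k ^ n) (q.eval n)) := by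
  obtain ⟨p, hp⟩ := XkC.exists_eval_eq_resourceBound
  have hrun : ∀ k n : ℕ, 2 ≤ k → ∀ H : XkC.UniformHypergraph k n,
      XkC.RunsWithin XkC.coverProg H.encode
        ((p.eval (n + k + H.edges.length) : ℕ) * XkC.growth k ^ n)
        (p.eval (n + k + H.edges.length)) := by
    intro k n hk H
    rw [hp]
    exact XkC.runsWithin_coverProg H hk
  refine ⟨XkC.growth, ⟨by norm_num [XkC.growth], by norm_num [XkC.growth], by norm_num [XkC.growth],
    by norm_num [XkC.growth], by norm_num [XkC.growth], fun k hk => XkC.growth_lt hk⟩,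
    XkC.coverProg, fun k n hk H => ⟨fun h r => XkC.answersNo_coverProg H hk h r,
      XkC.coinMeasure_not_answersYes_le H hk⟩, ⟨p, hrun⟩, fun k hk =>
      -- Without repetition there are at most `n ^ k` edges, and this is a polynomial in `n` once
      -- `k` is fixed.
      ⟨p.comp (Polynomial.X + Polynomial.C k + Polynomial.X ^ k), fun n H hH => ?_⟩⟩
  have heval : (p.comp (Polynomial.X + Polynomial.C k + Polynomial.X ^ k)).eval n =
      p.eval (n + k + n ^ k) := by
    simp [Polynomial.eval_comp]
  have hle : p.eval (n + k + H.edges.length) ≤ p.eval (n + k + n ^ k) :=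
    XkC.eval_mono p (Nat.add_le_add_left (XkC.length_edges_le H hH) _)
  rw [heval]
  refine (hrun k n hk H).mono (mul_le_mul_of_nonneg_right (by exact_mod_cast hle) ?_) hle
  exact pow_nonneg (zero_le_one.trans (XkC.one_le_growth hk)) _
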